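/- **Ribbon graphs.** A ribbon graph is a finite nonempty connected graph with all valences at least $3$ and a cyclic order of the half-edges at each vertex. A morphism $\Gamma\to\Gamma'$ is an isomorphism $\Gamma/F\cong\Gamma'$ of ribbon graphs, where $F$ is a spanning forest of $\Gamma$ whose trees are collapsed to points; this gives the category $\mathcal{F}at$. The codimension of $\Gamma$ is $\sum_v(\mathrm{val}(v)-3)$. An orientation of $\Gamma$ is an orientation of the vector space spanned by its vertices and half-edges. If all valences are odd there is a natural one (each vertex followed by its half-edges in cyclic order), and $o(\Gamma)=\pm1$ compares a given orientation with it. If an edge with halves $e^-,e^+$ and source and target $v,w$ is collapsed to a vertex $v_*$, the orientation $v\,w\,e^-e^+\cdots$ induces the orientation $v_*\cdots$. **Graph cohomology.** Let $\mathcal G^n$ be the abelian group generated by the isomorphism classes $[\Gamma]$ of oriented ribbon graphs of codimension $n$, with the relations $[-\Gamma]=-[\Gamma]$. Let $\mathcal G_n$ be the group of homomorphisms $\mathcal G^n\to\mathbb Z$ which are nonzero on only finitely many $[\Gamma]$. It is generated by the dual elements $[\Gamma]^*$; put $\langle\Gamma\rangle=|\mathrm{Aut}(\Gamma)|\,[\Gamma]^*$.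 For a partition $\mu=(\mu_1,\dots,\mu_r)$ of $n$ let $W_\mu$ be the set of ribbon graphs which are trivalent except for $r$ vertices, of valences $2\mu_i+3$. Define $W_\mu^*:\mathcal G_{2n}\to\mathbb Q$ by $W_\mu^*[\Gamma]^*=o(\Gamma)/|\mathrm{Aut}(\Gamma)|$ if $\Gamma\in W_\mu$ and $W_\mu^*[\Gamma]^*=0$ otherwise. **Dual cells.** For an oriented $\Gamma$ of codimension $n$, choose one representative of each isomorphism class of ribbon graphs over $\Gamma$, the identity of $\Gamma$ being one of them. The corresponding dual cell is $D(\Gamma)=\sum o(\Gamma_*)(\Gamma_0\to\cdots\to\Gamma_n=\Gamma)\in C_n(\mathcal{F}at)$, the sum being over all simplices over $\Gamma$ such that $\Gamma_i$ is a representative of codimension $i$; here $o(\Gamma_*)=1$ if the orientation of $\Gamma$ is induced from the natural one of the trivalent graph $\Gamma_0$, and $o(\Gamma_*)=-1$ otherwise. Let $\mathcal{F}in$ be a full subcategory of $\mathcal{F}at$ with exactly one object from each isomorphism class, and let $$\overline D(\Gamma)=\sum\frac{o(\Gamma_*)}{\prod_i|\mathrm{Aut}(\Gamma_i)|}(\Gamma_0\to\cdots\to\Gamma_n),$$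 the sum being over all sequences $\Gamma_0\to\cdots\to\Gamma_n\cong\Gamma$ in $\mathcal{F}in/\Gamma$ such that $\Gamma_i$ has codimension $i$. Define $\psi:\mathcal G_n\to C_n(\mathcal{F}at;\mathbb Q)$ by $\psi\langle\Gamma\rangle=(-1)^{\binom{n+1}{2}}\overline D(\Gamma)$. **Cyclic set cocycles.** For $k\ge1$ and a simplex $\Gamma_*=(\Gamma_0\to\cdots\to\Gamma_{2k})$ let $$\tilde c^{\,k}_{\mathcal{F}at}(\Gamma_*)=\sum_{v}(\mathrm{val}(v)-2)\,\frac{\sum\mathrm{sgn}(a_0,\dots,a_{2k})}{(-2)^{k+1}(2k-1)!!\,|C_0|\cdots|C_{2k}|},$$ where $v$ runs over the vertices of $\Gamma_0$, $C_i$ is the cyclically ordered set of corners at the image of $v$ in $\Gamma_i$ (corners inject into corners when trees are collapsed, $C_0\hookrightarrow C_1\hookrightarrow\cdots\hookrightarrow C_{2k}$), the inner sum is over all choices of $a_i\in C_i\setminus C_{i-1}$ (with $C_{-1}=\emptyset$), and $\mathrm{sgn}$ is the sign of the permutation which puts the elements of $C_{2k}$ in question into cyclic order. For a sequence $\lambda=(\lambda_1,\dots,\lambda_s)$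 of positive integers with sum $n$ put $$\tilde c_{\mathcal G}^\lambda=\psi^*\bigl(\tilde c_{\mathcal{F}at}^{\lambda_1}\cup\cdots\cup\tilde c_{\mathcal{F}at}^{\lambda_s}\bigr)\in\mathrm{Hom}(\mathcal G_{2n},\mathbb Q).$$ **Theorem.** Let $\lambda=(\lambda_1,\dots,\lambda_s)$ be a sequence of positive integers with sum $n$. 1. For every partition $\mu$ of $n$ there is a unique number $b_\lambda^\mu\in\mathbb Q$ such that $$b_\lambda^\mu=\tilde c_{\mathcal G}^\lambda\langle\Gamma\rangle=(-1)^n\bigl(\tilde c_{\mathcal{F}at}^{\lambda_1}\cup\cdots\cup\tilde c_{\mathcal{F}at}^{\lambda_s}\bigr)(D(\Gamma))$$ for every $\Gamma\in W_\mu$ with its natural orientation, every dual cell $D(\Gamma)$ and every choice of $\mathcal{F}in$. 2. As homomorphisms $\mathcal G_{2n}\to\mathbb Q$, $$\tilde c_{\mathcal G}^\lambda=\sum_\mu b_\lambda^\mu W_\mu^*,$$ where the sum is over all partitions $\mu$ of $n$ of which $\lambda$ is a refinement, that is, $\mu=(\mu_1,\dots,\mu_r)$ such that $\{1,\dots,s\}$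 can be partitioned into sets $\pi(1),\dots,\pi(r)$ with $\mu_i=\sum_{j\in\pi(i)}\lambda_j$ for all $i$. 3. For every partition $\mu=(\mu_1,\dots,\mu_r)$ of $n$, $$b_\lambda^\mu=\sum_\pi\prod_{i=1}^r b_{\lambda_{\pi(i)}}^{\mu_i},$$ where the sum is over all $\pi=(\pi(1),\dots,\pi(r))$ as in part 2, $\lambda_{\pi(i)}$ is the subsequence of $\lambda$ with indices in $\pi(i)$, and the upper index $\mu_i$ is the partition of $\mu_i$ with one part. -/

import Mathlib

open CategoryTheory

noncomputable section

/-! ### Ribbon graphs -/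

/-- A ribbon graph: a finite nonempty connected graph all of whose vertices have valence at least
three, with a cyclic ordering of the half-edges at each vertex.  `H` is the set of half-edges,
`τ` exchanges the two halves of each edge (so edges are the orbits of `τ`), and `σ` sends a
half-edge to the next one in the cyclic order at its vertex (so vertices are the orbits of `σ`). -/
structure RibbonGraph where
  H : Type
  finite_H : Finite H
  nonempty_H : Nonempty H
  σ : Equiv.Perm H
  τ : Equiv.Perm H
  τ_τ : ∀ h, τ (τ h) = h
  τ_ne : ∀ h, τ h ≠ h
  three_le : ∀ h, 3 ≤ Nat.card {k : H // σ.SameCycle h k}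
  connected : ∀ h k, ∃ g ∈ Subgroup.closure {σ, τ}, g h = k

namespace RibbonGraph

instance (Γ : RibbonGraph) : Finite Γ.H := Γ.finite_H

instance (Γ : RibbonGraph) : Nonempty Γ.H := Γ.nonempty_H

/-- Vertices are the orbits of `σ`. -/
abbrev Vertex (Γ : RibbonGraph) : Type := Quotient (Equiv.Perm.SameCycle.setoid Γ.σ)

/-- The vertex to which a half-edge is incident. -/
def vert (Γ : RibbonGraph) (h : Γ.H) : Γ.Vertex := Quotient.mk _ h

theorem vert_surjective (Γ : RibbonGraph) : Function.Surjective Γ.vert := Quotient.mk_surjective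

instance (Γ : RibbonGraph) : Finite Γ.Vertex := Finite.of_surjective _ Γ.vert_surjective

instance (Γ : RibbonGraph) : Fintype Γ.Vertex := Fintype.ofFinite _

/-- The valence of a vertex. -/
def valence (Γ : RibbonGraph) (v : Γ.Vertex) : ℕ := Nat.card {h : Γ.H // Γ.vert h = v}

/-- The codimension of a graph: the sum over the vertices of the valence minus three, which is the
number of edges collapsed when the graph is obtained from a trivalent one. -/
def codim (Γ : RibbonGraph) : ℕ := ∑ v : Γ.Vertex, (Γ.valence v - 3)

/-- `Γ.Turn C x y`: starting with the half-edge `x` and, as long as the current half-edge is in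
`C`, crossing its edge and passing to the next half-edge in cyclic order, one ends at `y`.
When the edges in `C` form a forest which is collapsed, the corner just before `x` in the cyclic
order at its vertex becomes the corner just before the leaf `y` (the two corners lie in the
same region of the complement of the tree). -/
inductive Turn (Γ : RibbonGraph) (C : Set Γ.H) : Γ.H → Γ.H → Prop
  | leaf (x : Γ.H) : x ∉ C → Turn Γ C x x
  | cross (x y : Γ.H) : x ∈ C → Turn Γ C (Γ.σ (Γ.τ x)) y → Turn Γ C x y

/-- Two vertices are joined by an edge whose half-edges lie in `C`. -/
def Joined (Γ : RibbonGraph) (C : Set Γ.H) (v w : Γ.Vertex) : Prop :=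
  ∃ h ∈ C, Γ.vert h = v ∧ Γ.vert (Γ.τ h) = w

/-- A morphism of ribbon graphs `Γ → Γ'`: an isomorphism of `Γ / F` with `Γ'` where `F` is a
spanning forest of `Γ`.  The map `inv` gives the half-edge of `Γ` over each half-edge of `Γ'`,
and `vmap` gives the vertex of `Γ'` to which a vertex of `Γ` is sent.  The half-edges of `F` are
those outside the range of `inv`; the vertices with the same image are those which are connected
in `F`, and each of these components is a tree: it has one more vertex than edges (each edge
having two halves).  The last condition says that the cyclic order at each vertex of `Γ'` is
the one of the leaves of the corresponding tree. -/
@[ext]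
structure Hom (Γ Γ' : RibbonGraph) where
  inv : Γ'.H → Γ.H
  vmap : Γ.Vertex → Γ'.Vertex
  inv_injective : Function.Injective inv
  inv_τ : ∀ k, inv (Γ'.τ k) = Γ.τ (inv k)
  vmap_vert : ∀ k, vmap (Γ.vert (inv k)) = Γ'.vert k
  vmap_eq_iff : ∀ v w, vmap v = vmap w ↔ Relation.EqvGen (Γ.Joined (Set.range inv)ᶜ) v w
  tree : ∀ x : Γ'.Vertex,
    2 * Nat.card {v : Γ.Vertex // vmap v = x} =
      Nat.card {h : Γ.H // h ∉ Set.range inv ∧ vmap (Γ.vert h) = x} + 2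
  cyclic : ∀ k, Γ.Turn (Set.range inv)ᶜ (Γ.σ (inv k)) (inv (Γ'.σ k))

namespace Hom

theorem vmap_surjective {Γ Γ' : RibbonGraph} (f : Hom Γ Γ') : Function.Surjective f.vmap := by
  intro x
  obtain ⟨k, rfl⟩ := Γ'.vert_surjective x
  exact ⟨_, f.vmap_vert k⟩

/-- The identity morphism. -/
def id (Γ : RibbonGraph) : Hom Γ Γ where
  inv := fun h => h
  vmap := fun v => v
  inv_injective := fun _ _ h => h
  inv_τ := fun _ => rfl
  vmap_vert := fun _ => rfl
  vmap_eq_iff := by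
    intro v w
    constructor
    · rintro rfl
      exact Relation.EqvGen.refl _
    · intro h
      induction h with
      | rel x y h =>
        obtain ⟨h, hh, -⟩ := h
        exact absurd ⟨h, rfl⟩ hh
      | refl x => rfl
      | symm x y _ ih => exact ih.symm
      | trans x y z _ _ ih1 ih2 => exact ih1.trans ih2
  tree := by
    intro x
    have : IsEmpty {h : Γ.H // h ∉ Set.range (fun h : Γ.H => h) ∧ Γ.vert h = x} :=
      ⟨fun h => h.2.1 ⟨h.1, rfl⟩⟩
    simp
  cyclic := fun k => Turn.leaf _ (fun h => h ⟨_, rfl⟩)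

theorem turn_trans {Γ : RibbonGraph} {C D : Set Γ.H} (hCD : C ⊆ D) {x y z : Γ.H}
    (h : Γ.Turn C x y) (h' : Γ.Turn D y z) : Γ.Turn D x z := by
  induction h with
  | leaf x _ => exact h'
  | cross x y hx _ ih => exact Turn.cross _ _ (hCD hx) (ih h')

theorem turn_comp {Γ Γ' : RibbonGraph} (f : Hom Γ Γ') {C : Set Γ'.H} {D : Set Γ.H}
    (h1 : (Set.range f.inv)ᶜ ⊆ D) (h2 : ∀ k, f.inv k ∈ D ↔ k ∈ C)
    {x y : Γ'.H} (h : Γ'.Turn C x y) :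
    ∀ a, Γ.Turn (Set.range f.inv)ᶜ a (f.inv x) → Γ.Turn D a (f.inv y) := by
  induction h with
  | leaf x hx =>
    intro a ha
    exact turn_trans h1 ha (Turn.leaf _ (fun h => hx ((h2 x).1 h)))
  | cross x y hx _ ih =>
    intro a ha
    refine turn_trans h1 ha (Turn.cross _ _ ((h2 x).2 hx) (ih _ ?_))
    rw [← f.inv_τ]
    exact f.cyclic _

theorem compl_range_comp {Γ Γ' Γ'' : RibbonGraph} (f : Hom Γ Γ') (g : Hom Γ' Γ'') :
    (Set.range f.inv)ᶜ ⊆ (Set.range (fun k => f.inv (g.inv k)))ᶜ := by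
  rintro h hh ⟨k, rfl⟩
  exact hh ⟨_, rfl⟩

theorem inv_mem_compl_range_comp {Γ Γ' Γ'' : RibbonGraph} (f : Hom Γ Γ') (g : Hom Γ' Γ'')
    (k : Γ'.H) :
    f.inv k ∈ (Set.range (fun k => f.inv (g.inv k)))ᶜ ↔ k ∈ (Set.range g.inv)ᶜ := by
  simp only [Set.mem_compl_iff, not_iff_not]
  constructor
  · rintro ⟨l, hl⟩
    exact ⟨l, f.inv_injective hl⟩
  · rintro ⟨l, rfl⟩
    exact ⟨l, rfl⟩

theorem eqvGen_mono {α : Type} {r s : α → α → Prop} (h : ∀ a b, r a b → s a b) {a b : α}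
    (hab : Relation.EqvGen r a b) : Relation.EqvGen s a b := by
  induction hab with
  | rel x y hxy => exact Relation.EqvGen.rel _ _ (h _ _ hxy)
  | refl x => exact Relation.EqvGen.refl _
  | symm x y _ ih => exact Relation.EqvGen.symm _ _ ih
  | trans x y z _ _ ih1 ih2 => exact Relation.EqvGen.trans _ _ _ ih1 ih2

theorem comp_vmap_eq_iff {Γ Γ' Γ'' : RibbonGraph} (f : Hom Γ Γ') (g : Hom Γ' Γ'')
    (v w : Γ.Vertex) : g.vmap (f.vmap v) = g.vmap (f.vmap w) ↔
      Relation.EqvGen (Γ.Joined (Set.range (fun k => f.inv (g.inv k)))ᶜ) v w := by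
  have key : ∀ v w, f.vmap v = f.vmap w →
      Relation.EqvGen (Γ.Joined (Set.range (fun k => f.inv (g.inv k)))ᶜ) v w := by
    intro v w h
    refine eqvGen_mono ?_ ((f.vmap_eq_iff v w).1 h)
    rintro a b ⟨h, hh, ha, hb⟩
    exact ⟨h, compl_range_comp f g hh, ha, hb⟩
  constructor
  · intro h
    have h' := (g.vmap_eq_iff _ _).1 h
    have gen : ∀ x y, Relation.EqvGen (Γ'.Joined (Set.range g.inv)ᶜ) x y →
        ∀ v w, f.vmap v = x → f.vmap w = y →
        Relation.EqvGen (Γ.Joined (Set.range (fun k => f.inv (g.inv k)))ᶜ) v w := by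
      intro x y hxy
      induction hxy with
      | rel x y hxy =>
        intro v w hv hw
        obtain ⟨k, hk, hx, hy⟩ := hxy
        refine Relation.EqvGen.trans _ (Γ.vert (f.inv k)) _ (key _ _ ?_)
          (Relation.EqvGen.trans _ (Γ.vert (Γ.τ (f.inv k))) _
            (Relation.EqvGen.rel _ _ ⟨f.inv k, ?_, rfl, rfl⟩) (key _ _ ?_))
        · rw [hv, f.vmap_vert, hx]
        · exact (inv_mem_compl_range_comp f g k).2 hk
        · rw [hw, ← f.inv_τ, f.vmap_vert, hy]
      | refl x =>
        intro v w hv hw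
        exact key _ _ (hv.trans hw.symm)
      | symm x y _ ih =>
        intro v w hv hw
        exact Relation.EqvGen.symm _ _ (ih w v hw hv)
      | trans x y z _ _ ih1 ih2 =>
        intro v w hv hw
        obtain ⟨u, hu⟩ := f.vmap_surjective y
        exact Relation.EqvGen.trans _ u _ (ih1 v u hv hu) (ih2 u w hu hw)
    exact gen _ _ h' v w rfl rfl
  · intro h
    induction h with
    | rel x y h =>
      obtain ⟨h, hh, rfl, rfl⟩ := h
      by_cases hf : h ∈ Set.range f.inv
      · obtain ⟨k, rfl⟩ := hf
        rw [← f.inv_τ, f.vmap_vert, f.vmap_vert]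
        exact (g.vmap_eq_iff _ _).2 (Relation.EqvGen.rel _ _
          ⟨k, (inv_mem_compl_range_comp f g k).1 hh, rfl, rfl⟩)
      · exact congrArg g.vmap ((f.vmap_eq_iff _ _).2 (Relation.EqvGen.rel _ _ ⟨h, hf, rfl, rfl⟩))
    | refl x => rfl
    | symm x y _ ih => exact ih.symm
    | trans x y z _ _ ih1 ih2 => exact ih1.trans ih2

theorem comp_tree {Γ Γ' Γ'' : RibbonGraph} (f : Hom Γ Γ') (g : Hom Γ' Γ'') (z : Γ''.Vertex) :
    2 * Nat.card {v : Γ.Vertex // g.vmap (f.vmap v) = z} =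
      Nat.card {h : Γ.H // h ∉ Set.range (fun k => f.inv (g.inv k)) ∧
        g.vmap (f.vmap (Γ.vert h)) = z} + 2 := by
  classical
  have : Fintype {x : Γ'.Vertex // g.vmap x = z} := Fintype.ofFinite _
  have e1 : {v : Γ.Vertex // g.vmap (f.vmap v) = z} ≃
      Σ x : {x : Γ'.Vertex // g.vmap x = z}, {v : Γ.Vertex // f.vmap v = x} :=
    { toFun := fun v => ⟨⟨f.vmap v.1, v.2⟩, ⟨v.1, rfl⟩⟩
      invFun := fun p => ⟨p.2.1, by rw [p.2.2]; exact p.1.2⟩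
      left_inv := fun v => rfl
      right_inv := by
        rintro ⟨⟨x, hx⟩, v, (rfl : f.vmap v = x)⟩
        rfl }
  have e2 : {h : Γ.H // h ∉ Set.range (fun k => f.inv (g.inv k)) ∧
        g.vmap (f.vmap (Γ.vert h)) = z} ≃
      (Σ x : {x : Γ'.Vertex // g.vmap x = z},
        {h : Γ.H // h ∉ Set.range f.inv ∧ f.vmap (Γ.vert h) = x}) ⊕
      {k : Γ'.H // k ∉ Set.range g.inv ∧ g.vmap (Γ'.vert k) = z} :=
    { toFun := fun h => if hf : h.1 ∈ Set.range f.inv then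
          Sum.inr ⟨hf.choose, by
            have hk := hf.choose_spec
            constructor
            · apply (inv_mem_compl_range_comp f g _).1
              rw [hk]
              exact h.2.1
            · rw [← f.vmap_vert, hk]
              exact h.2.2⟩
        else Sum.inl ⟨⟨_, h.2.2⟩, ⟨h.1, hf, rfl⟩⟩
      invFun := fun p => match p with
        | Sum.inl p => ⟨p.2.1, compl_range_comp f g p.2.2.1, by rw [p.2.2.2]; exact p.1.2⟩
        | Sum.inr k => ⟨f.inv k.1, (inv_mem_compl_range_comp f g _).2 k.2.1, by
            rw [f.vmap_vert]; exact k.2.2⟩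
      left_inv := by
        rintro ⟨h, h1, h2⟩
        by_cases hf : h ∈ Set.range f.inv
        · simp only [hf, dite_true]
          exact Subtype.ext hf.choose_spec
        · simp only [hf, dite_false]
      right_inv := by
        rintro (⟨⟨x, hx⟩, ⟨h, hf, hv⟩⟩ | ⟨k, hk⟩)
        · simp only at hv
          subst hv
          simp only [hf, dite_false]
        · have hf : f.inv k ∈ Set.range f.inv := ⟨k, rfl⟩
          simp only [hf, dite_true]
          congr 1
          exact Subtype.ext (f.inv_injective hf.choose_spec) }
  rw [Nat.card_congr e1, Nat.card_congr e2, Nat.card_sum, Nat.card_sigma, Nat.card_sigma,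
    Finset.mul_sum, Finset.sum_congr rfl (fun x _ => f.tree x.1), Finset.sum_add_distrib]
  have hg := g.tree z
  rw [Nat.card_eq_fintype_card] at hg
  simp only [Finset.sum_const, Finset.card_univ, smul_eq_mul]
  omega

/-- Composition of morphisms. -/
def comp {Γ Γ' Γ'' : RibbonGraph} (f : Hom Γ Γ') (g : Hom Γ' Γ'') : Hom Γ Γ'' where
  inv := fun k => f.inv (g.inv k)
  vmap := fun v => g.vmap (f.vmap v)
  inv_injective := f.inv_injective.comp g.inv_injective
  inv_τ := fun k => by rw [g.inv_τ, f.inv_τ]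
  vmap_vert := fun k => by rw [f.vmap_vert, g.vmap_vert]
  vmap_eq_iff := comp_vmap_eq_iff f g
  tree := comp_tree f g
  cyclic := fun k => turn_comp f (compl_range_comp f g) (inv_mem_compl_range_comp f g)
    (g.cyclic k) _ (f.cyclic _)

end Hom

/-- The category of ribbon graphs. -/
instance : Category RibbonGraph where
  Hom := Hom
  id := Hom.id
  comp := Hom.comp

/-! ### Orientations -/

/-- An orientation of the vector space spanned by a finite set `S`, given by its values `±1` on
the ordered bases formed by the elements of `S`. -/
@[ext]
structure SetOrientation (S : Type) where
  sgn : ∀ {N : ℕ}, (Fin N ≃ S) → ℤˣ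
  sgn_perm : ∀ {N : ℕ} (e : Fin N ≃ S) (π : Equiv.Perm (Fin N)),
    sgn (π.trans e) = Equiv.Perm.sign π * sgn e

namespace SetOrientation

instance {S : Type} : Neg (SetOrientation S) where
  neg ω :=
    { sgn := fun e => - ω.sgn e
      sgn_perm := fun e π => by rw [ω.sgn_perm, mul_neg] }

theorem neg_sgn {S : Type} (ω : SetOrientation S) {N : ℕ} (e : Fin N ≃ S) :
    (-ω).sgn e = - ω.sgn e := rfl

/-- Transport of an orientation along a bijection. -/
def map {S S' : Type} (c : S ≃ S') (ω : SetOrientation S) : SetOrientation S' where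
  sgn := fun e => ω.sgn (e.trans c.symm)
  sgn_perm := fun e π => ω.sgn_perm (e.trans c.symm) π

end SetOrientation

/-- The set of vertices and half-edges. -/
abbrev Cell (Γ : RibbonGraph) : Type := Γ.Vertex ⊕ Γ.H

/-- An orientation of a graph: an orientation of the vector space spanned by the vertices and
half-edges. -/
abbrev GraphOrientation (Γ : RibbonGraph) : Type := SetOrientation Γ.Cell

/-- The bijection on vertices and half-edges given by an isomorphism. -/
def cellEquiv {Γ Γ' : RibbonGraph} (φ : Γ ≅ Γ') : Γ.Cell ≃ Γ'.Cell where
  toFun := Sum.map (Hom.vmap φ.hom) (Hom.inv φ.inv)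
  invFun := Sum.map (Hom.vmap φ.inv) (Hom.inv φ.hom)
  left_inv := by
    rintro (v | h)
    · exact congrArg Sum.inl (congrFun (congrArg Hom.vmap φ.hom_inv_id) v)
    · exact congrArg Sum.inr (congrFun (congrArg Hom.inv φ.hom_inv_id) h)
  right_inv := by
    rintro (v | h)
    · exact congrArg Sum.inl (congrFun (congrArg Hom.vmap φ.inv_hom_id) v)
    · exact congrArg Sum.inr (congrFun (congrArg Hom.inv φ.inv_hom_id) h)

/-- The orientation of `Γ` is the natural one, given by taking each vertex followed by its incident
half-edges in cyclic order.  This does not depend on the order of the vertices and on the first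
half-edge at each of them, provided that all vertices have odd valence. -/
def IsNatural {Γ : RibbonGraph} (ω : Γ.GraphOrientation) : Prop :=
  ∀ (N : ℕ) (e : Fin N ≃ Γ.Cell) (hs : List Γ.H),
    List.ofFn e = hs.flatMap (fun h => Sum.inl (Γ.vert h) ::
      (List.range (Γ.valence (Γ.vert h))).map (fun j => Sum.inr ((Γ.σ ^ j) h))) →
    ω.sgn e = 1

open Classical in
/-- The sign of an orientation with respect to the natural one. -/
def naturalSign {Γ : RibbonGraph} (ω : Γ.GraphOrientation) : ℤ := if IsNatural ω then 1 else -1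

/-- The morphism `φ : Γ → Γ'` collapses exactly one edge and `ω'` is the orientation of `Γ'`
induced by `ω`: writing `h, τ h` for the halves of the collapsed edge and `v, w` for its source
and target, the ordering `v, w, h, τ h, …` of `Γ` is sent to the ordering `v', …` of `Γ'` where
`v'` is the coalesced vertex and the other vertices and half-edges are in the same order. -/
def Induces {Γ Γ' : RibbonGraph} (φ : Γ ⟶ Γ') (ω : Γ.GraphOrientation)
    (ω' : Γ'.GraphOrientation) : Prop :=
  ∃ (N : ℕ) (e : Fin (4 + N) ≃ Γ.Cell) (e' : Fin (1 + N) ≃ Γ'.Cell) (h : Γ.H),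
    e (Fin.castAdd N 0) = Sum.inl (Γ.vert h) ∧
    e (Fin.castAdd N 1) = Sum.inl (Γ.vert (Γ.τ h)) ∧
    e (Fin.castAdd N 2) = Sum.inr h ∧
    e (Fin.castAdd N 3) = Sum.inr (Γ.τ h) ∧
    e' (Fin.castAdd N 0) = Sum.inl (Hom.vmap φ (Γ.vert h)) ∧
    (∀ i : Fin N,
      (∃ v, e (Fin.natAdd 4 i) = Sum.inl v ∧ e' (Fin.natAdd 1 i) = Sum.inl (Hom.vmap φ v)) ∨
      (∃ k, e (Fin.natAdd 4 i) = Sum.inr (Hom.inv φ k) ∧ e' (Fin.natAdd 1 i) = Sum.inr k)) ∧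
    ω.sgn e = ω'.sgn e'

/-! ### The graph complex and its compactly supported dual -/

/-- An oriented ribbon graph of codimension `n`. -/
structure OGraph (n : ℕ) where
  graph : RibbonGraph
  codim_eq : graph.codim = n
  orient : graph.GraphOrientation

namespace OGraph

variable {n : ℕ}

instance : Neg (OGraph n) where
  neg A := ⟨A.graph, A.codim_eq, -A.orient⟩

/-- Isomorphism of oriented ribbon graphs. -/
def OIso (A B : OGraph n) : Prop :=
  ∃ φ : A.graph ≅ B.graph, A.orient.map (cellEquiv φ) = B.orient

theorem OIso.symm {A B : OGraph n} (h : OIso A B) : OIso B A := by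
  obtain ⟨φ, hφ⟩ := h
  refine ⟨φ.symm, ?_⟩
  rw [← hφ]
  refine SetOrientation.ext ?_
  funext N e
  show A.orient.sgn ((e.trans (cellEquiv φ.symm).symm).trans (cellEquiv φ).symm) = _
  congr 1
  ext x
  exact (cellEquiv φ).symm_apply_apply (e x)

theorem OIso.trans {A B C : OGraph n} (h : OIso A B) (h' : OIso B C) : OIso A C := by
  obtain ⟨φ, hφ⟩ := h
  obtain ⟨ψ, hψ⟩ := h'
  refine ⟨φ ≪≫ ψ, ?_⟩
  rw [← hψ, ← hφ]
  refine SetOrientation.ext ?_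
  funext N e
  show A.orient.sgn _ = A.orient.sgn _
  congr 1
  ext x
  show (cellEquiv (φ ≪≫ ψ)).symm (e x) = (cellEquiv φ).symm ((cellEquiv ψ).symm (e x))
  rcases e x with v | h <;> rfl

theorem OIso.neg {A B : OGraph n} (h : OIso A B) : OIso (-A) (-B) := by
  obtain ⟨φ, hφ⟩ := h
  refine ⟨φ, ?_⟩
  show (-A.orient).map (cellEquiv φ) = - B.orient
  rw [← hφ]
  rfl

theorem neg_neg' (A : OGraph n) : - -A = A := by
  obtain ⟨Γ, h, ω⟩ := A
  show (⟨Γ, h, - -ω⟩ : OGraph n) = _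
  congr 1
  ext N e
  simp [SetOrientation.neg_sgn]

/-- Two oriented graphs are equivalent if they are isomorphic after forgetting orientations. -/
instance unorientedSetoid (n : ℕ) : Setoid (OGraph n) where
  r A B := Nonempty (A.graph ≅ B.graph)
  iseqv := ⟨fun _ => ⟨Iso.refl _⟩, fun ⟨φ⟩ => ⟨φ.symm⟩, fun ⟨φ⟩ ⟨ψ⟩ => ⟨φ ≪≫ ψ⟩⟩

end OGraph

/-- The relations `[Γ] = [Γ']` for isomorphic oriented graphs and `[-Γ] = -[Γ]`. -/
def graphRelations (n : ℕ) : AddSubgroup (FreeAbelianGroup (OGraph n)) :=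
  AddSubgroup.closure
    ({x | ∃ A B : OGraph n, A.OIso B ∧ x = FreeAbelianGroup.of A - FreeAbelianGroup.of B} ∪
     {x | ∃ A : OGraph n, x = FreeAbelianGroup.of A + FreeAbelianGroup.of (-A)})

/-- The `n`-th group of the associative graph homology complex. -/
abbrev GraphHomologyGroup (n : ℕ) : Type 1 := FreeAbelianGroup (OGraph n) ⧸ graphRelations n

/-- The generator `[Γ]`. -/
def gen {n : ℕ} (A : OGraph n) : GraphHomologyGroup n :=
  QuotientAddGroup.mk (FreeAbelianGroup.of A)

/-- The isomorphism classes of graphs on which a homomorphism does not vanish. -/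
def supportClasses {n : ℕ} (f : GraphHomologyGroup n →+ ℤ) :
    Set (Quotient (OGraph.unorientedSetoid n)) :=
  {q | ∃ A : OGraph n, Quotient.mk _ A = q ∧ f (gen A) ≠ 0}

/-- The `n`-th group of the associative graph cohomology complex: the homomorphisms on the `n`-th
group of the graph homology complex which are nonzero on only finitely many isomorphism classes. -/
def GraphCohomologyGroup (n : ℕ) : AddSubgroup (GraphHomologyGroup n →+ ℤ) where
  carrier := {f | (supportClasses f).Finite}
  add_mem' := by
    intro f g hf hg
    refine (Set.Finite.union hf hg).subset ?_
    rintro q ⟨A, hA, h⟩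
    by_cases h1 : f (gen A) = 0
    · refine Or.inr ⟨A, hA, fun h2 => h ?_⟩
      simp [h1, h2]
    · exact Or.inl ⟨A, hA, h1⟩
  zero_mem' := by
    refine Set.finite_empty.subset ?_
    rintro q ⟨A, hA, h⟩
    exact h rfl
  neg_mem' := by
    intro f hf
    refine Set.Finite.subset hf ?_
    rintro q ⟨A, hA, h⟩
    exact ⟨A, hA, fun h2 => h (by simp [h2])⟩

open Classical in
/-- The dual generator `[Γ]^*` as a homomorphism: it sends `[Γ']` to the number `1`, `-1` or `0` if
`Γ'` is isomorphic to `Γ`, to `-Γ` or to neither of them (and `[Γ]^* = 0` if `Γ ≅ -Γ`). -/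
def dualHom {n : ℕ} (A : OGraph n) : GraphHomologyGroup n →+ ℤ :=
  QuotientAddGroup.lift (graphRelations n)
    (FreeAbelianGroup.lift fun B : OGraph n =>
      (if B.OIso A then (1 : ℤ) else 0) - (if B.OIso (-A) then (1 : ℤ) else 0))
    (by
      refine (AddSubgroup.closure_le _).2 ?_
      rintro x (⟨B, C, h, rfl⟩ | ⟨B, rfl⟩)
      · have h1 : ∀ D : OGraph n, B.OIso D ↔ C.OIso D := fun D =>
          ⟨fun h2 => h.symm.trans h2, fun h2 => h.trans h2⟩
        simp [AddMonoidHom.mem_ker, h1]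
      · have h1 : ∀ D : OGraph n, (-B).OIso D ↔ B.OIso (-D) := fun D =>
          ⟨fun h2 => by simpa [OGraph.neg_neg'] using h2.neg,
           fun h2 => by simpa [OGraph.neg_neg'] using h2.neg⟩
        simp [AddMonoidHom.mem_ker, h1, OGraph.neg_neg'])

open Classical in
theorem dualHom_gen {n : ℕ} (A B : OGraph n) : dualHom A (gen B) =
    (if B.OIso A then (1 : ℤ) else 0) - (if B.OIso (-A) then (1 : ℤ) else 0) := by
  exact (QuotientAddGroup.lift_mk' _ _ _).trans (FreeAbelianGroup.lift_apply_of _ _)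

/-- The dual generator `[Γ]^*`. -/
def dualGen {n : ℕ} (A : OGraph n) : GraphCohomologyGroup n :=
  ⟨dualHom A, by
    refine (Set.finite_singleton (Quotient.mk (OGraph.unorientedSetoid n) A)).subset ?_
    rintro q ⟨B, rfl, h⟩
    rw [dualHom_gen] at h
    by_cases h1 : B.OIso A
    · exact Quotient.sound ⟨h1.choose⟩
    · by_cases h2 : B.OIso (-A)
      · exact Quotient.sound ⟨h2.choose⟩
      · simp [h1, h2] at h⟩

/-- The order of the automorphism group. -/
def autCard (Γ : RibbonGraph) : ℕ := Nat.card (Aut Γ)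

/-- The generator `⟨Γ⟩ = |Aut Γ| [Γ]^*`. -/
def intGen {n : ℕ} (A : OGraph n) : GraphCohomologyGroup n := autCard A.graph • dualGen A

/-- The linear extension of an assignment `[Γ]^* ↦ g Γ`, where `g` is isomorphism invariant and
odd: it sends `f = ∑ f[Γ] [Γ]^*` to `∑ f[Γ] g(Γ)`, the sums being over one (arbitrarily oriented)
representative of each isomorphism class of graphs (and `f[Γ] = 0` if `Γ ≅ -Γ`). -/
def linearExtend {n : ℕ} {M : Type*} [AddCommGroup M] (g : OGraph n → M) :
    GraphCohomologyGroup n →+ M where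
  toFun f := ∑ᶠ q : Quotient (OGraph.unorientedSetoid n), f.1 (gen q.out) • g q.out
  map_zero' := by simp
  map_add' := by
    intro f f'
    have hfin : ∀ f : GraphCohomologyGroup n,
        (Function.support fun q : Quotient (OGraph.unorientedSetoid n) =>
          f.1 (gen q.out) • g q.out).Finite := by
      intro f
      refine Set.Finite.subset f.2 ?_
      intro q hq
      exact ⟨q.out, q.out_eq, fun h => hq (by simp [h])⟩
    rw [← finsum_add_distrib (hfin f) (hfin f')]
    refine finsum_congr fun q => ?_
    simp [add_smul]

/-! ### Kontsevich cycles -/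

/-- The Kontsevich cycle `W_μ`: graphs which are trivalent except for vertices of valences
`2 μ_i + 3`. -/
def InW {n : ℕ} (μ : Nat.Partition n) (Γ : RibbonGraph) : Prop :=
  ((Finset.univ : Finset Γ.Vertex).val.map Γ.valence).filter (fun m => m ≠ 3) =
    μ.parts.map (fun m => 2 * m + 3)

open Classical in
/-- The dual Kontsevich cycle `W_μ^*`, the linear extension of `[Γ]^* ↦ o(Γ) / |Aut Γ|` for `Γ` in
`W_μ` and `[Γ]^* ↦ 0` otherwise. -/
def dualKontsevich {n : ℕ} (μ : Nat.Partition n) : GraphCohomologyGroup (2 * n) →+ ℚ :=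
  linearExtend fun A =>
    if InW μ A.graph then (naturalSign A.orient : ℚ) / autCard A.graph else 0

/-! ### Chains and cochains of the category of ribbon graphs -/

/-- The `n`-simplices `Γ₀ → ⋯ → Γ_n` of the nerve of the category of ribbon graphs. -/
abbrev Simplex (n : ℕ) := ComposableArrows RibbonGraph n

/-- Rational cellular chains of the category of ribbon graphs. -/
abbrev Chain (n : ℕ) := Simplex n →₀ ℚ

/-- Rational cochains. -/
abbrev Cochain (n : ℕ) := Simplex n → ℚ

/-- The value of a cochain on a chain. -/
def Cochain.eval {n : ℕ} (c : Cochain n) : Chain n →ₗ[ℚ] ℚ := Finsupp.linearCombination ℚ c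

/-- The subsimplex `Γ_p → ⋯ → Γ_{p+m}`. -/
def face {n : ℕ} (p m : ℕ) (h : p + m ≤ n) (X : Simplex n) : Simplex m :=
  Monotone.functor (f := fun i : Fin (m + 1) => (⟨p + i, by omega⟩ : Fin (n + 1)))
    (fun i j hij => by
      have : (i : ℕ) ≤ j := hij
      simp only [Fin.mk_le_mk]
      omega) ⋙ X

/-- The cup product (front face times back face). -/
def cup {p q n : ℕ} (h : p + q = n) (a : Cochain p) (b : Cochain q) : Cochain n :=
  fun X => a (face 0 p (by omega) X) * b (face p q (by omega) X)

/-! ### The cyclic set cocycle -/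

/-- The sign of the permutation which puts the sequence `a` in the cyclic order given by `σ` (all
`a i` lie in one orbit of `σ`): their positions are counted from `a 0`.  (For sequences of odd
length it does not matter where one starts.) -/
def cyclicSign {H : Type} (σ : Equiv.Perm H) {m : ℕ} (a : Fin (m + 1) → H) : ℤ :=
  ∏ i : Fin (m + 1), ∏ j ∈ Finset.Ioi i,
    Int.sign ((sInf {t : ℕ | (σ ^ t) (a 0) = a j} : ℕ) - (sInf {t : ℕ | (σ ^ t) (a 0) = a i} : ℕ))

open scoped Nat in
/-- The adjusted cyclic set cocycle on a sequence `C 0 ⊆ C 1 ⊆ ⋯ ⊆ C (2k)` of subsets of a set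
which is cyclically ordered by `σ`. -/
def cyclicSetCocycle {H : Type} (σ : Equiv.Perm H) (k : ℕ) (C : Fin (2 * k + 1) → Set H) : ℚ :=
  (∑ᶠ a : {a : Fin (2 * k + 1) → H // ∀ i, a i ∈ C i ∧ ∀ j < i, a i ∉ C j},
      (cyclicSign σ a.1 : ℚ)) /
    ((-2) ^ (k + 1) * ((2 * k - 1)‼ : ℕ) * ∏ i, ((C i).ncard : ℚ))

/-- The image in `Γ'` of the cyclically ordered set of corners at the vertex `v` of `Γ`.  A corner is
denoted by the half-edge which follows it in the cyclic order. -/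
def cornerImage {Γ Γ' : RibbonGraph} (φ : Γ ⟶ Γ') (v : Γ.Vertex) : Set Γ'.H :=
  {k | ∃ h, Γ.vert h = v ∧ Γ.Turn (Set.range (Hom.inv φ))ᶜ h (Hom.inv φ k)}

/-- The cyclic set cocycle on the category of ribbon graphs: the sum over the vertices `v` of `Γ₀`,
counted with multiplicity (the valence minus two), of the value of the cyclic set cocycle on the
sequence of cyclically ordered sets of corners at the images of `v` in `Γ₀, …, Γ_{2k}`. -/
def cFat (k : ℕ) : Cochain (2 * k) := fun X =>
  ∑ v : (X.obj 0).Vertex, (((X.obj 0).valence v : ℚ) - 2) *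
    cyclicSetCocycle (X.obj (Fin.last _)).σ k fun i =>
      cornerImage (X.map (homOfLE (Fin.le_last i)))
        (Hom.vmap (X.map (homOfLE (Fin.zero_le i))) v)

/-- The cup product of the cyclic set cocycles of degrees `2 λ₁, …, 2 λ_s`. -/
def cFatList : (l : List ℕ) → {n : ℕ} → l.sum = n → Cochain (2 * n)
  | [], _, _ => fun _ => 1
  | a :: l, _, h =>
    cup (by rw [← h, List.sum_cons]; ring) (cFat a) (cFatList l (rfl : l.sum = l.sum))

/-- The cup product of cyclic set cocycles given by the sequence `c` of positive integers with
sum `n`. -/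
def cFatProd {n : ℕ} (c : Composition n) : Cochain (2 * n) := cFatList c.blocks c.blocks_sum

/-! ### Dual cells and the pull-back to graph cohomology -/

/-- A sequence of graphs over `Γ` of codimensions `0, 1, …, n` in the set `R` of objects over `Γ`. -/
def OverFlag (Γ : RibbonGraph) (R : Set (Over Γ)) (n : ℕ) :=
  {Y : ComposableArrows (Over Γ) n // ∀ i, Y.obj i ∈ R ∧ (Y.obj i).left.codim = i}

/-- The orientation `ω` of `Γ` is the one induced, through `Γ₀ → ⋯ → Γ_n ≅ Γ`, from the natural
orientation of the trivalent graph `Γ₀`. -/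
def InducedFromStart {Γ : RibbonGraph} {n : ℕ} (Y : ComposableArrows (Over Γ) n)
    (ω : Γ.GraphOrientation) : Prop :=
  ∃ (o : ∀ i : Fin (n + 1), (Y.obj i).left.GraphOrientation) (φ : (Y.obj (Fin.last n)).left ≅ Γ),
    IsNatural (o 0) ∧
    (∀ i : Fin n, Induces (Y.map (homOfLE i.castSucc_lt_succ.le)).left (o i.castSucc) (o i.succ)) ∧
    φ.hom = (Y.obj (Fin.last n)).hom ∧
    (o (Fin.last n)).map (cellEquiv φ) = ω

open Classical in
/-- The sign `o(Γ_*)`. -/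
def flagSign {Γ : RibbonGraph} {n : ℕ} (Y : ComposableArrows (Over Γ) n)
    (ω : Γ.GraphOrientation) : ℚ := if InducedFromStart Y ω then 1 else -1

/-- `D` is a dual cell of the oriented graph `A` of codimension `n`: it is given by choosing one
representative of each isomorphism class of objects over the graph, the identity being one of them,
as the signed sum of all `Γ₀ → ⋯ → Γ_n` where `Γ_i` is a representative of codimension `i` (so that
`Γ_n` is the identity). -/
def IsDualCell {n : ℕ} (A : OGraph n) (D : Chain n) : Prop :=
  ∃ R : Set (Over A.graph), (∀ X : Over A.graph, ∃! Y, Y ∈ R ∧ Nonempty (X ≅ Y)) ∧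
    Over.mk (𝟙 A.graph) ∈ R ∧
    D = ∑ᶠ Y : OverFlag A.graph R n,
      Finsupp.single (Y.1 ⋙ Over.forget A.graph) (flagSign Y.1 A.orient)

/-- A finite model: a (full) subcategory with exactly one object from each isomorphism class. -/
def IsFiniteModel (S : Set RibbonGraph) : Prop :=
  ∀ Γ : RibbonGraph, ∃! Γ', Γ' ∈ S ∧ Nonempty (Γ ≅ Γ')

/-- The average dual cell of an oriented graph in a finite model. -/
def averageDualCell (S : Set RibbonGraph) {n : ℕ} (A : OGraph n) : Chain n :=
  ∑ᶠ Y : OverFlag A.graph {X | X.left ∈ S} n,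
    Finsupp.single (Y.1 ⋙ Over.forget A.graph)
      (flagSign Y.1 A.orient / ∏ i, (autCard (Y.1.obj i).left : ℚ))

/-- The chain map `ψ` from graph cohomology to the chains of the category of ribbon graphs: the
linear extension of `⟨Γ⟩ ↦ (-1)^{n(n+1)/2}` times the average dual cell of `Γ`
(where `⟨Γ⟩ = |Aut Γ| [Γ]^*`). -/
def psi (S : Set RibbonGraph) (n : ℕ) : GraphCohomologyGroup n →+ Chain n :=
  linearExtend fun A => ((-1 : ℚ) ^ ((n + 1).choose 2) / autCard A.graph) • averageDualCell S A

/-- The pull-back along `ψ` of the cup product of cyclic set cocycles. -/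
def cGraph (S : Set RibbonGraph) {n : ℕ} (c : Composition n) :
    GraphCohomologyGroup (2 * n) →+ ℚ :=
  (Cochain.eval (cFatProd c)).toAddMonoidHom.comp (psi S (2 * n))

/-- `b` gives, for each sequence `l` and each partition `μ` of `n`, the value of
`(-1)^n` times the cup product of cyclic set cocycles on every dual cell of every naturally oriented
graph in `W_μ`. -/
def IsDualCellValue (b : ∀ n : ℕ, Composition n → Nat.Partition n → ℚ) : Prop :=
  ∀ (n : ℕ) (l : Composition n) (μ : Nat.Partition n) (A : OGraph (2 * n)),
    InW μ A.graph → IsNatural A.orient → ∀ D : Chain (2 * n), IsDualCell A D →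
      (-1) ^ n * (cFatProd l).eval D = b n l μ

end RibbonGraph

/-! ### Refinements -/

/-- The ways of representing `l` as a refinement of `m`: the partitions of the set of indices of `l`
into parts `π(i) = f⁻¹(i)` such that `m_i` is the sum of the `l_j` for `j` in `π(i)`. -/
abbrev Refinement {n : ℕ} (l m : Composition n) : Type :=
  {f : Fin l.length → Fin m.length //
    ∀ i, (((List.finRange l.length).filter (fun j => f j = i)).map l.blocksFun).sum = m.blocksFun i}

/-- The subsequence of `l` with indices in `π(i)`, as an ordered partition of `m_i`. -/
def Refinement.part {n : ℕ} {l m : Composition n} (π : Refinement l m) (i : Fin m.length) :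
    Composition (m.blocksFun i) where
  blocks := ((List.finRange l.length).filter (fun j => π.1 j = i)).map l.blocksFun
  blocks_pos := by
    intro a ha
    obtain ⟨j, -, rfl⟩ := List.mem_map.1 ha
    exact l.blocks_pos (l.blocksFun_mem_blocks j)
  blocks_sum := π.2 i

/-- The ordered partition `l` is a refinement of the unordered partition `μ`. -/
def Refines {n : ℕ} (l : Composition n) (μ : Nat.Partition n) : Prop :=
  ∃ m : Composition n, Nat.Partition.ofComposition n m = μ ∧ Nonempty (Refinement l m)

end

open CategoryTheory

noncomputable section

namespace RibbonGraph

/-! ### Orientations evaluated on lists -/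

namespace SetOrientation

variable {S S' : Type}

/-! A vertex of valence m is treated as an m-gon whose corners are its half-edges. Undoing the
collapse of one edge means cutting one of these polygons along a diagonal: by `exists_oneEdge` and
`OneEdge.exists_iso` a one-edge collapse is determined, up to isomorphism over its target, by an
unordered pair of non-adjacent corners at one vertex, and `exists_expansion` shows that every such
pair occurs. Read from the top graph downwards, a sequence in a dual cell is therefore a succession
of diagonals, and evaluating a cochain on the cell is a signed sum over such successions.

The choice of representatives enters only through the total weight of each isomorphism class over
the given graph (`IsWeight`). This weight is one for a dual cell. It is also one for an average dual
cell: isomorphisms over the graph are unique, so the model contains |Aut| objects of a class, each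
of weight 1/|Aut| (`isWeight_finiteModel`). One computation, `sum_overFlag`, thus treats both kinds
of cell. Signs are read off from an enumeration of the cells vertex by vertex, the frame of a
presentation. By `OneEdge.sgnL_frame_lift`, drawing a diagonal multiplies the sign of the frame by a
`stepSign` which depends only on positions.

A cup product is evaluated from its last factor, the one nearest to the top graph. The cyclic set
cocycle chooses a new corner at each step, so it vanishes if the set of corners at the image of the
vertex does not change in some step (`cycValue_eq_zero`). Hence the 2a diagonals belonging to a
factor of degree 2a must all cut the polygon which contains the chosen vertex of the lowest graph,
and all of them lie in one polygon of the upper graph (`diagonalSum_eq`). The total becomes a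
recursively defined function `cellValue` of the multiset of valences, and since each factor acts on
a single polygon, this function is multiplicative over distributions of the factors among the
vertices (`cellValue_sum`).

Two invariants decide where it vanishes. Cutting an m-gon gives two polygons whose sizes add up to m
+ 2. So the parity of the sum of (size + 1) changes with every diagonal, which shows that an even
polygon can never be resolved into triangles with nonzero value (`cellValue_eq_zero_of_even`). The
sum of (size - 3) drops by one with every diagonal, so the degrees assigned to a vertex must exhaust
its codimension exactly (`cellValue_eq_zero_of_excess`). The first fact confines the support to the
Kontsevich cycles; the second turns arbitrary distributions into refinements, which gives the
product formula.

Uniqueness of the numbers requires that every Kontsevich cycle is nonempty and that dual cells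
exist; a ring of trivalent vertices with vertices of the prescribed valences attached provides the
graph (`exists_inW`). -/

open Classical in
/-- The value of an orientation on a list which enumerates the set without repetitions (and zero on
all other lists). -/
def sgnL (ω : SetOrientation S) (L : List S) : ℤ :=
  if h : ∃ e : Fin L.length ≃ S, List.ofFn e = L then (ω.sgn h.choose : ℤ) else 0

theorem sgnL_ofFn (ω : SetOrientation S) {N : ℕ} (e : Fin N ≃ S) :
    ω.sgnL (List.ofFn e) = ω.sgn e := by
  -- The length of `List.ofFn e` is only propositionally `N`, so the claim is proved for a general
  -- list of length `N`, where the equality can be substituted.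
  have key : ∀ (L : List S) (hN : L.length = N), List.ofFn e = L → ω.sgnL L = ω.sgn e := by
    intro L hN hL
    subst hN
    have h : ∃ e : Fin L.length ≃ S, List.ofFn e = L := ⟨e, hL⟩
    rw [sgnL, dif_pos h]
    have h2 := h.choose_spec.trans hL.symm
    have h3 : h.choose = e := by
      ext i
      exact congrFun (List.ofFn_injective h2) i
    rw [h3]
  exact key _ (by simp) rfl

theorem exists_ofFn_eq {L : List S} (hn : L.Nodup) (hL : ∀ s, s ∈ L) :
    ∃ e : Fin L.length ≃ S, List.ofFn e = L := by
  classical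
  refine ⟨hn.getEquivOfForallMemList L hL, ?_⟩
  apply List.ext_getElem <;> simp

theorem sgnL_eq_of_ofFn {ω : SetOrientation S} {L : List S} {N : ℕ} {e : Fin N ≃ S}
    (h : List.ofFn e = L) : ω.sgnL L = ω.sgn e := by
  rw [← h, sgnL_ofFn]

theorem nodup_of_ofFn {L : List S} {N : ℕ} {e : Fin N ≃ S} (h : List.ofFn e = L) :
    L.Nodup ∧ ∀ s, s ∈ L := by
  subst h
  refine ⟨List.nodup_ofFn.2 e.injective, fun s => ?_⟩
  rw [List.mem_ofFn]
  exact ⟨e.symm s, by simp⟩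

theorem sgnL_of_not {ω : SetOrientation S} {L : List S} (h : ¬ (L.Nodup ∧ ∀ s, s ∈ L)) :
    ω.sgnL L = 0 := by
  rw [sgnL, dif_neg]
  rintro ⟨e, he⟩
  exact h (nodup_of_ofFn he)

theorem sgnL_mul_self (ω : SetOrientation S) {L : List S} (hn : L.Nodup) (hL : ∀ s, s ∈ L) :
    ω.sgnL L * ω.sgnL L = 1 := by
  obtain ⟨e, he⟩ := exists_ofFn_eq hn hL
  rw [sgnL_eq_of_ofFn he, ← Units.val_mul, Int.units_mul_self, Units.val_one]

theorem sgnL_eq_one_or (ω : SetOrientation S) {L : List S} (hn : L.Nodup) (hL : ∀ s, s ∈ L) :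
    ω.sgnL L = 1 ∨ ω.sgnL L = -1 := by
  have := ω.sgnL_mul_self hn hL
  exact Int.eq_one_or_neg_one_of_mul_eq_one this

theorem sgnL_neg (ω : SetOrientation S) (L : List S) : (-ω).sgnL L = - ω.sgnL L := by
  by_cases h : ∃ e : Fin L.length ≃ S, List.ofFn e = L
  · obtain ⟨e, he⟩ := h
    rw [sgnL_eq_of_ofFn he, sgnL_eq_of_ofFn he, neg_sgn, Units.val_neg]
  · rw [sgnL, sgnL, dif_neg h, dif_neg h, neg_zero]

theorem sgnL_map (ω : SetOrientation S) (c : S ≃ S') (L : List S) :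
    (ω.map c).sgnL (L.map c) = ω.sgnL L := by
  by_cases h : L.Nodup ∧ ∀ s, s ∈ L
  · obtain ⟨e, he⟩ := exists_ofFn_eq h.1 h.2
    have h' : List.ofFn (e.trans c) = L.map c := by
      have := congrArg (List.map c) he
      rw [List.map_ofFn] at this
      exact this
    rw [sgnL_eq_of_ofFn he, sgnL_eq_of_ofFn h']
    show ((ω.sgn ((e.trans c).trans c.symm) : ℤˣ) : ℤ) = _
    congr 2
    ext x; simp
  · rw [sgnL_of_not h, sgnL_of_not]
    rintro ⟨h1, h2⟩
    refine h ⟨h1.of_map, fun s => ?_⟩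
    simpa using h2 (c s)

/-- Exchanging adjacent entries is precomposition with the transposition of the positions `A.length`
and `A.length + 1`. A list which is no enumeration gives zero on both sides, so no hypothesis is
needed. -/
theorem sgnL_swap (ω : SetOrientation S) (A D : List S) (a b : S) :
    ω.sgnL (A ++ a :: b :: D) = - ω.sgnL (A ++ b :: a :: D) := by
  by_cases h : (A ++ b :: a :: D).Nodup ∧ ∀ s, s ∈ A ++ b :: a :: D
  · obtain ⟨e, he⟩ := exists_ofFn_eq h.1 h.2
    have hl : (A ++ b :: a :: D).length = A.length + (D.length + 2) := by simp
    set i : Fin (A ++ b :: a :: D).length := ⟨A.length, by omega⟩ with hi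
    set j : Fin (A ++ b :: a :: D).length := ⟨A.length + 1, by omega⟩ with hj
    have hij : i ≠ j := by simp [hi, hj]
    have hget : ∀ k : Fin (A ++ b :: a :: D).length, e k = (A ++ b :: a :: D)[k] := by
      intro k
      have : (List.ofFn e)[k.1]'(by rw [List.length_ofFn]; exact k.2) = (A ++ b :: a :: D)[k.1] := by
        simp only [he]
      rwa [List.getElem_ofFn] at this
    have h' : List.ofFn ((Equiv.swap i j).trans e) = A ++ a :: b :: D := by
      apply List.ext_getElem
      · rw [List.length_ofFn]; simp
      intro k h1 h2
      rw [List.getElem_ofFn]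
      simp only [Equiv.trans_apply]
      rw [hget]
      have hk : k < (A ++ b :: a :: D).length := by rwa [List.length_ofFn] at h1
      rcases lt_trichotomy k A.length with hlt | heq | hgt
      · rw [Equiv.swap_apply_of_ne_of_ne]
        · simp [List.getElem_append_left, hlt]
        · simp [hi]; omega
        · simp [hj]; omega
      · have : (⟨k, hk⟩ : Fin _) = i := by ext; exact heq
        rw [this, Equiv.swap_apply_left]
        simp [hj, heq, List.getElem_append_right]
      · by_cases hk1 : k = A.length + 1
        · have : (⟨k, hk⟩ : Fin _) = j := by ext; exact hk1
          rw [this, Equiv.swap_apply_right]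
          simp [hi, hk1, List.getElem_append_right]
        · rw [Equiv.swap_apply_of_ne_of_ne]
          · obtain ⟨r, rfl⟩ : ∃ r, k = A.length + (r + 2) := ⟨k - A.length - 2, by omega⟩
            simp [List.getElem_append_right]
          · simp [hi]; omega
          · simp [hj]; omega
    rw [sgnL_eq_of_ofFn he, sgnL_eq_of_ofFn h', sgn_perm, Equiv.Perm.sign_swap hij]
    simp
  · rw [sgnL_of_not h, sgnL_of_not, neg_zero]
    rintro ⟨h1, h2⟩
    have hp : (A ++ a :: b :: D).Perm (A ++ b :: a :: D) :=
      List.Perm.append_left A (List.Perm.swap b a D)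
    exact h ⟨hp.nodup_iff.1 h1, fun s => hp.mem_iff.1 (h2 s)⟩

theorem sgnL_move_one (ω : SetOrientation S) (B : List S) : ∀ (A D : List S) (c : S),
    ω.sgnL (A ++ B ++ c :: D) = (-1) ^ B.length * ω.sgnL (A ++ c :: B ++ D) := by
  induction B with
  | nil => intro A D c; simp
  | cons b B ih =>
    intro A D c
    have h := ih (A ++ [b]) D c
    simp only [List.append_assoc, List.cons_append, List.nil_append] at h ⊢
    rw [h, ω.sgnL_swap A (B ++ D) b c, List.length_cons, pow_succ]
    ring

/-- Moving a block of a list past another one changes the sign according to the lengths. -/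
theorem sgnL_move (ω : SetOrientation S) (C : List S) : ∀ (A B D : List S),
    ω.sgnL (A ++ B ++ C ++ D) = (-1) ^ (B.length * C.length) * ω.sgnL (A ++ C ++ B ++ D) := by
  induction C with
  | nil => intro A B D; simp
  | cons c C ih =>
    intro A B D
    have h1 := ω.sgnL_move_one B A (C ++ D) c
    have h2 := ih (A ++ [c]) B D
    simp only [List.append_assoc, List.cons_append, List.nil_append] at h1 h2 ⊢
    rw [h1, h2, List.length_cons, Nat.mul_succ, pow_add]
    ring

/-- Two orientations which agree on one enumeration are equal. -/
theorem eq_of_sgnL_eq {ω ω' : SetOrientation S} {L : List S} (hn : L.Nodup) (hL : ∀ s, s ∈ L)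
    (h : ω.sgnL L = ω'.sgnL L) : ω = ω' := by
  obtain ⟨e, he⟩ := exists_ofFn_eq hn hL
  rw [sgnL_eq_of_ofFn he, sgnL_eq_of_ofFn he] at h
  have h' : ω.sgn e = ω'.sgn e := Units.ext h
  ext N f
  have hN : N = L.length := by
    have := Fintype.card_congr (f.trans e.symm)
    simpa using this
  subst hN
  have hf : f = (f.trans e.symm).trans e := by ext; simp
  rw [hf, sgn_perm, sgn_perm, h']

/-- There is an orientation with a given value on a given enumeration. -/
theorem exists_sgnL_eq {L : List S} (hn : L.Nodup) (hL : ∀ s, s ∈ L) {s : ℤ}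
    (hs : s = 1 ∨ s = -1) : ∃ ω : SetOrientation S, ω.sgnL L = s := by
  obtain ⟨e, he⟩ := exists_ofFn_eq hn hL
  have hN : ∀ {N : ℕ}, (Fin N ≃ S) → N = L.length := fun f => by
    have := Fintype.card_congr (f.trans e.symm)
    simpa using this
  -- The sign of the permutation relating an enumeration to the fixed one `e`; every enumeration has
  -- the length of `L`.
  let ω : SetOrientation S :=
    { sgn := fun f => Equiv.Perm.sign ((f.trans e.symm).trans (finCongr (hN f).symm))
      sgn_perm := by
        intro N f π
        rw [← Equiv.Perm.sign_mul, Equiv.Perm.sign_mul, mul_comm, ← Equiv.Perm.sign_mul]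
        rfl }
  have hω : ω.sgnL L = 1 := by
    rw [sgnL_eq_of_ofFn he]
    show ((Equiv.Perm.sign _ : ℤˣ) : ℤ) = 1
    have : (e.trans e.symm).trans (finCongr (hN e).symm) = Equiv.refl _ := by
      ext; simp
    rw [this]
    simp
  rcases hs with rfl | rfl
  · exact ⟨ω, hω⟩
  · exact ⟨-ω, by rw [sgnL_neg, hω]⟩

/-- The effect on signs of permuting the elements of a list is the same for two orientations. -/
theorem sgnL_mul_sgnL_perm (ω : SetOrientation S) (ω' : SetOrientation S') (f : S → S')
    {T T' : List S} (h : T.Perm T') : ∀ (A : List S) (A' : List S'),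
    ω.sgnL (A ++ T) = ω'.sgnL (A' ++ T.map f) → ω.sgnL (A ++ T') = ω'.sgnL (A' ++ T'.map f) := by
  induction h with
  | nil => exact fun A A' h => h
  | cons x _ ih =>
    intro A A' h
    have := ih (A ++ [x]) (A' ++ [f x])
    simp only [List.append_assoc, List.cons_append, List.nil_append, List.map_cons] at this h ⊢
    exact this h
  | swap x y l =>
    intro A A' h
    rw [List.map_cons, List.map_cons] at h ⊢
    rw [sgnL_swap, h, sgnL_swap, neg_neg]
  | trans _ _ ih1 ih2 => exact fun A A' h => ih2 A A' (ih1 A A' h)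

end SetOrientation

/-! ### Morphisms and isomorphisms of ribbon graphs -/

theorem vert_eq_iff {Γ : RibbonGraph} {h k : Γ.H} : Γ.vert h = Γ.vert k ↔ Γ.σ.SameCycle h k :=
  Quotient.eq

theorem vert_σ {Γ : RibbonGraph} (h : Γ.H) : Γ.vert (Γ.σ h) = Γ.vert h :=
  vert_eq_iff.2 (Equiv.Perm.sameCycle_apply_left.2 (Equiv.Perm.SameCycle.refl _ _))

/-- Walking around the collapsed trees is deterministic. This makes the map on corners single-valued
and lets the cyclic condition on morphisms be used as an equation. -/
theorem Turn.unique {Γ : RibbonGraph} {C : Set Γ.H} {x y z : Γ.H} (h : Γ.Turn C x y)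
    (h' : Γ.Turn C x z) : y = z := by
  induction h with
  | leaf x hx =>
    cases h' with
    | leaf => rfl
    | cross _ _ hx' => exact absurd hx' hx
  | cross x y hx _ ih =>
    cases h' with
    | leaf _ hx' => exact absurd hx hx'
    | cross _ _ _ h'' => exact ih h''

/-- The fibres of `vmap` are the components of the collapsed forest, which is the complement of the
range of `inv`, and each fibre contains the vertex of some `inv k`. -/
theorem Hom.ext_inv {Γ Γ' : RibbonGraph} {f g : Γ ⟶ Γ'} (h : Hom.inv f = Hom.inv g) : f = g := by
  refine Hom.ext h ?_
  funext v
  obtain ⟨k, hk⟩ := Γ'.vert_surjective (Hom.vmap f v)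
  have h1 : Hom.vmap f v = Hom.vmap f (Γ.vert (Hom.inv f k)) := by rw [Hom.vmap_vert, hk]
  have h2 := (Hom.vmap_eq_iff f _ _).1 h1
  have h3 : Hom.vmap g v = Hom.vmap g (Γ.vert (Hom.inv f k)) :=
    (Hom.vmap_eq_iff g _ _).2 (h ▸ h2)
  rw [h3, ← hk, h, Hom.vmap_vert]

theorem inv_comp {Γ Γ' Γ'' : RibbonGraph} (f : Γ ⟶ Γ') (g : Γ' ⟶ Γ'') (k : Γ''.H) :
    Hom.inv (f ≫ g) k = Hom.inv f (Hom.inv g k) := rfl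

theorem vmap_comp {Γ Γ' Γ'' : RibbonGraph} (f : Γ ⟶ Γ') (g : Γ' ⟶ Γ'') (v : Γ.Vertex) :
    Hom.vmap (f ≫ g) v = Hom.vmap g (Hom.vmap f v) := rfl

theorem vmap_id (Γ : RibbonGraph) (v : Γ.Vertex) : Hom.vmap (𝟙 Γ) v = v := rfl

theorem three_le_valence (Γ : RibbonGraph) (v : Γ.Vertex) : 3 ≤ Γ.valence v := by
  obtain ⟨h, rfl⟩ := Γ.vert_surjective v
  refine (Γ.three_le h).trans_eq (Nat.card_congr (Equiv.subtypeEquivRight fun k => ?_))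
  rw [eq_comm (a := Γ.vert k), vert_eq_iff]

theorem sum_valence (Γ : RibbonGraph) : ∑ v : Γ.Vertex, Γ.valence v = Nat.card Γ.H := by
  have e : (Σ v : Γ.Vertex, {h : Γ.H // Γ.vert h = v}) ≃ Γ.H := Equiv.sigmaFiberEquiv Γ.vert
  rw [← Nat.card_congr e, Nat.card_sigma]
  rfl

theorem codim_add (Γ : RibbonGraph) : Γ.codim + 3 * Nat.card Γ.Vertex = Nat.card Γ.H := by
  rw [← sum_valence, codim, Nat.card_eq_fintype_card, ← Finset.card_univ, mul_comm,
    ← smul_eq_mul, ← Finset.sum_const, ← Finset.sum_add_distrib]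
  exact Finset.sum_congr rfl fun v _ => Nat.sub_add_cancel (Γ.three_le_valence v)

/-- Sum of the tree condition over all vertices of the target: a collapse raises the codimension by
the number of collapsed edges. -/
theorem codim_collapse {Γ Γ' : RibbonGraph} (f : Γ ⟶ Γ') :
    2 * Γ.codim + Nat.card {h : Γ.H // h ∉ Set.range (Hom.inv f)} = 2 * Γ'.codim := by
  have h1 := Γ.codim_add
  have h2 := Γ'.codim_add
  have h3 : Nat.card Γ.H = Nat.card Γ'.H + Nat.card {h : Γ.H // h ∉ Set.range (Hom.inv f)} := by
    classical
    rw [← Nat.card_congr (Equiv.sumCompl fun h => h ∈ Set.range (Hom.inv f)), Nat.card_sum,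
      ← Nat.card_congr (Equiv.ofInjective _ (Hom.inv_injective f))]
  have h4 : 2 * Nat.card Γ.Vertex =
      Nat.card {h : Γ.H // h ∉ Set.range (Hom.inv f)} + 2 * Nat.card Γ'.Vertex := by
    rw [← Nat.card_congr (Equiv.sigmaFiberEquiv (Hom.vmap f)), Nat.card_sigma, Finset.mul_sum,
      Finset.sum_congr rfl fun x _ => Hom.tree f x, Finset.sum_add_distrib]
    congr 1
    · rw [← Nat.card_congr (Equiv.sigmaFiberEquiv
        (fun h : {h : Γ.H // h ∉ Set.range (Hom.inv f)} => Hom.vmap f (Γ.vert h.1))),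
        Nat.card_sigma]
      refine Finset.sum_congr rfl fun x _ => Nat.card_congr ?_
      exact (Equiv.subtypeSubtypeEquivSubtypeInter _ _).symm
    · simp [mul_comm]
  omega

/-- A bijection on half-edges which commutes with the structure maps gives a morphism. -/
def homOfEquiv {Γ Γ' : RibbonGraph} (θ : Γ.H ≃ Γ'.H) (hσ : ∀ h, θ (Γ.σ h) = Γ'.σ (θ h))
    (hτ : ∀ h, θ (Γ.τ h) = Γ'.τ (θ h)) : Γ ⟶ Γ' :=
  have hσ' : ∀ k, θ.symm (Γ'.σ k) = Γ.σ (θ.symm k) := fun k => by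
    rw [Equiv.symm_apply_eq, hσ, Equiv.apply_symm_apply]
  have hc : ∀ h k, Γ.σ.SameCycle h k ↔ Γ'.σ.SameCycle (θ h) (θ k) := by
    have : Γ'.σ = θ.permCongr Γ.σ := by
      ext k
      rw [Equiv.permCongr_apply, hσ, Equiv.apply_symm_apply]
    intro h k
    constructor
    · rintro ⟨i, rfl⟩
      refine ⟨i, ?_⟩
      rw [this, show θ.permCongr Γ.σ = θ.permCongrHom Γ.σ from rfl, ← map_zpow]
      simp
    · rintro ⟨i, hi⟩
      refine ⟨i, θ.injective ?_⟩
      rw [← hi, this, show θ.permCongr Γ.σ = θ.permCongrHom Γ.σ from rfl, ← map_zpow]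
      simp
  have hr : Set.range θ.symm = Set.univ := θ.symm.surjective.range_eq
  let vm : Γ.Vertex → Γ'.Vertex := Quotient.map θ fun h k => (hc h k).1
  have hvm : Function.Bijective vm := by
    constructor
    · intro v w
      refine Quotient.inductionOn₂ v w fun h k hhk => Quotient.sound ((hc h k).2 ?_)
      exact Quotient.exact hhk
    · intro x
      obtain ⟨k, rfl⟩ := Γ'.vert_surjective x
      exact ⟨Γ.vert (θ.symm k), congrArg Γ'.vert (θ.apply_symm_apply k)⟩
  show Hom Γ Γ' from
  { inv := θ.symm
    vmap := vm
    inv_injective := θ.symm.injective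
    inv_τ := fun k => by rw [Equiv.symm_apply_eq, hτ, Equiv.apply_symm_apply]
    vmap_vert := fun k => congrArg Γ'.vert (θ.apply_symm_apply k)
    vmap_eq_iff := by
      intro v w
      rw [hvm.1.eq_iff]
      constructor
      · rintro rfl
        exact Relation.EqvGen.refl _
      · intro h
        induction h with
        | rel x y h =>
          obtain ⟨h, hh, -⟩ := h
          simp [hr] at hh
        | refl x => rfl
        | symm x y _ ih => exact ih.symm
        | trans x y z _ _ ih1 ih2 => exact ih1.trans ih2
    tree := by
      intro x
      have : IsEmpty {h : Γ.H // h ∉ Set.range θ.symm ∧ vm (Γ.vert h) = x} :=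
        ⟨fun h => h.2.1 ⟨θ h.1, θ.symm_apply_apply _⟩⟩
      obtain ⟨v, hv⟩ := hvm.2 x
      have h1 : Nat.card {w : Γ.Vertex // vm w = x} = 1 := by
        rw [Nat.card_eq_one_iff_unique]
        exact ⟨⟨fun a b => Subtype.ext (hvm.1 (a.2.trans b.2.symm))⟩, ⟨⟨v, hv⟩⟩⟩
      rw [h1]
      simp
    cyclic := fun k => by
      rw [← hσ']
      exact Turn.leaf _ (fun h => h ⟨_, rfl⟩) }

theorem inv_homOfEquiv {Γ Γ' : RibbonGraph} (θ : Γ.H ≃ Γ'.H) (hσ : ∀ h, θ (Γ.σ h) = Γ'.σ (θ h))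
    (hτ : ∀ h, θ (Γ.τ h) = Γ'.τ (θ h)) : Hom.inv (homOfEquiv θ hσ hτ) = θ.symm := rfl

/-- A bijection on half-edges which commutes with the structure maps gives an isomorphism. -/
def isoOfEquiv {Γ Γ' : RibbonGraph} (θ : Γ.H ≃ Γ'.H) (hσ : ∀ h, θ (Γ.σ h) = Γ'.σ (θ h))
    (hτ : ∀ h, θ (Γ.τ h) = Γ'.τ (θ h)) : Γ ≅ Γ' where
  hom := homOfEquiv θ hσ hτ
  inv := homOfEquiv θ.symm
    (fun k => by rw [Equiv.symm_apply_eq, hσ, Equiv.apply_symm_apply])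
    (fun k => by rw [Equiv.symm_apply_eq, hτ, Equiv.apply_symm_apply])
  hom_inv_id := Hom.ext_inv (by
    funext k
    rw [inv_comp, inv_homOfEquiv, inv_homOfEquiv, Equiv.symm_symm, Equiv.symm_apply_apply]
    rfl)
  inv_hom_id := Hom.ext_inv (by
    funext k
    rw [inv_comp, inv_homOfEquiv, inv_homOfEquiv, Equiv.symm_symm, Equiv.apply_symm_apply]
    rfl)

theorem inv_isoOfEquiv_hom {Γ Γ' : RibbonGraph} (θ : Γ.H ≃ Γ'.H)
    (hσ : ∀ h, θ (Γ.σ h) = Γ'.σ (θ h)) (hτ : ∀ h, θ (Γ.τ h) = Γ'.τ (θ h)) :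
    Hom.inv (isoOfEquiv θ hσ hτ).hom = θ.symm := rfl

theorem inv_σ_of_surjective {Γ Γ' : RibbonGraph} {f : Γ ⟶ Γ'}
    (hf : Function.Surjective (Hom.inv f)) (k : Γ'.H) :
    Hom.inv f (Γ'.σ k) = Γ.σ (Hom.inv f k) := by
  have h := Hom.cyclic f k
  exact (h.unique (Turn.leaf _ (fun h => h (hf _)))) 

/-- A morphism which collapses nothing is an isomorphism. -/
theorem exists_iso_of_surjective {Γ Γ' : RibbonGraph} {f : Γ ⟶ Γ'}
    (hf : Function.Surjective (Hom.inv f)) : ∃ φ : Γ ≅ Γ', φ.hom = f := by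
  let θ : Γ'.H ≃ Γ.H := Equiv.ofBijective _ ⟨Hom.inv_injective f, hf⟩
  refine ⟨isoOfEquiv θ.symm (fun h => ?_) (fun h => ?_), Hom.ext_inv ?_⟩
  · rw [Equiv.symm_apply_eq]
    obtain ⟨k, rfl⟩ := θ.surjective h
    rw [Equiv.symm_apply_apply]
    exact (inv_σ_of_surjective hf k).symm
  · rw [Equiv.symm_apply_eq]
    obtain ⟨k, rfl⟩ := θ.surjective h
    rw [Equiv.symm_apply_apply]
    exact (Hom.inv_τ f k).symm
  · rw [inv_isoOfEquiv_hom, Equiv.symm_symm]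
    rfl

/-- By `codim_collapse` the forest has no edges, so `inv` is surjective. -/
theorem exists_iso_of_codim_eq {Γ Γ' : RibbonGraph} (f : Γ ⟶ Γ') (h : Γ.codim = Γ'.codim) :
    ∃ φ : Γ ≅ Γ', φ.hom = f := by
  refine exists_iso_of_surjective fun a => ?_
  by_contra ha
  have h1 := codim_collapse f
  have h2 : Nat.card {h : Γ.H // h ∉ Set.range (Hom.inv f)} = 0 := by omega
  rw [Nat.card_eq_zero] at h2
  rcases h2 with h2 | h2
  · exact h2.false ⟨a, ha⟩
  · exact h2.not_finite inferInstance

/-! ### Isomorphisms are rigid. -/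

section Iso

variable {Γ Γ' : RibbonGraph}

/-- The bijection on half-edges given by an isomorphism. -/
def isoEquiv (φ : Γ ≅ Γ') : Γ.H ≃ Γ'.H where
  toFun := Hom.inv φ.inv
  invFun := Hom.inv φ.hom
  left_inv h := congrFun (congrArg Hom.inv φ.hom_inv_id) h
  right_inv h := congrFun (congrArg Hom.inv φ.inv_hom_id) h

theorem isoEquiv_σ (φ : Γ ≅ Γ') (h : Γ.H) : isoEquiv φ (Γ.σ h) = Γ'.σ (isoEquiv φ h) :=
  inv_σ_of_surjective (isoEquiv φ).surjective h

theorem isoEquiv_τ (φ : Γ ≅ Γ') (h : Γ.H) : isoEquiv φ (Γ.τ h) = Γ'.τ (isoEquiv φ h) :=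
  Hom.inv_τ φ.inv h

theorem vert_isoEquiv (φ : Γ ≅ Γ') (h : Γ.H) :
    Γ'.vert (isoEquiv φ h) = Hom.vmap φ.hom (Γ.vert h) := by
  have h1 := Hom.vmap_vert φ.hom (isoEquiv φ h)
  have h2 : Hom.inv φ.hom (isoEquiv φ h) = h := (isoEquiv φ).symm_apply_apply h
  rw [← h1, h2]

/-- Isomorphisms of ribbon graphs are determined by their values on one half-edge. -/
theorem iso_ext {φ ψ : Γ ≅ Γ'} {k : Γ.H} (h : isoEquiv φ k = isoEquiv ψ k) : φ = ψ := by
  have key : ∀ g ∈ Subgroup.closure {Γ.σ, Γ.τ}, ∀ k, isoEquiv φ k = isoEquiv ψ k →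
      isoEquiv φ (g k) = isoEquiv ψ (g k) := by
    intro g hg
    induction hg using Subgroup.closure_induction with
    | mem x hx =>
      intro k hk
      rcases hx with rfl | rfl
      · rw [isoEquiv_σ, isoEquiv_σ, hk]
      · rw [isoEquiv_τ, isoEquiv_τ, hk]
    | one => exact fun k hk => hk
    | mul x y _ _ ihx ihy => exact fun k hk => ihx _ (ihy _ hk)
    | inv x hx ih =>
      intro k hk
      -- The permutation group of a finite set is finite, so the inverse of `x` is a natural power
      -- of `x` and the forward implication suffices.
      have hsymm : ∀ (n : ℕ) k, isoEquiv φ k = isoEquiv ψ k →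
          isoEquiv φ ((x ^ n) k) = isoEquiv ψ ((x ^ n) k) := by
        intro n
        induction n with
        | zero => exact fun k hk => hk
        | succ n ihn => intro k hk; rw [pow_succ']; exact ih _ (ihn _ hk)
      have hfin : IsOfFinOrder x := isOfFinOrder_of_finite x
      have hx' : x⁻¹ = x ^ (orderOf x - 1) := by
        rw [inv_eq_iff_mul_eq_one, ← pow_succ', Nat.sub_add_cancel hfin.orderOf_pos,
          pow_orderOf_eq_one]
      rw [hx']
      exact hsymm _ _ hk
  have h1 : ∀ a, isoEquiv φ a = isoEquiv ψ a := by
    intro a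
    obtain ⟨g, hg, rfl⟩ := Γ.connected k a
    exact key g hg k h
  have h2 : φ.inv = ψ.inv := Hom.ext_inv (funext h1)
  exact Iso.ext_inv h2

instance : Finite (Γ ≅ Γ') :=
  Finite.of_injective (fun φ => (isoEquiv φ : Γ.H → Γ'.H)) fun _ _ h =>
    iso_ext (k := Γ.nonempty_H.some) (congrFun h _)

end Iso

/-! ### Collapsing one edge -/

/-- The morphism `f` collapses exactly the edge with halves `h` and `τ h`, the successors of which
are `x` and `y`. -/
structure OneEdge {Γ Γ' : RibbonGraph} (f : Γ ⟶ Γ') (h : Γ.H) (x y : Γ'.H) : Prop where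
  not_mem_range : ∀ a, a ∉ Set.range (Hom.inv f) ↔ a = h ∨ a = Γ.τ h
  vert_ne : Γ.vert h ≠ Γ.vert (Γ.τ h)
  σ_h : Γ.σ h = Hom.inv f x
  σ_τ_h : Γ.σ (Γ.τ h) = Hom.inv f y

theorem σ_ne (Γ : RibbonGraph) (h : Γ.H) : Γ.σ h ≠ h := by
  intro hh
  have h3 := Γ.three_le h
  have : Nat.card {k : Γ.H // Γ.σ.SameCycle h k} ≤ 1 := by
    rw [Finite.card_le_one_iff_subsingleton]
    refine ⟨fun a b => Subtype.ext ?_⟩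
    have : ∀ k, Γ.σ.SameCycle h k → k = h := by
      rintro k ⟨i, rfl⟩
      exact Equiv.Perm.zpow_apply_eq_self_of_apply_eq_self hh i
    rw [this _ a.2, this _ b.2]
  omega

/-- `codim_collapse` leaves exactly two half-edges outside the range of `inv`. They are closed under
`τ`, hence form one edge. -/
theorem exists_oneEdge {Γ Γ' : RibbonGraph} (f : Γ ⟶ Γ') (hc : Γ.codim + 1 = Γ'.codim) :
    ∃ h x y, OneEdge f h x y := by
  have hcard : Nat.card {h : Γ.H // h ∉ Set.range (Hom.inv f)} = 2 := by
    have := codim_collapse f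
    omega
  have hτ : ∀ a, a ∉ Set.range (Hom.inv f) → Γ.τ a ∉ Set.range (Hom.inv f) := by
    rintro a ha ⟨k, hk⟩
    exact ha ⟨Γ'.τ k, by rw [Hom.inv_τ, hk, Γ.τ_τ]⟩
  have hne : Nonempty {h : Γ.H // h ∉ Set.range (Hom.inv f)} := by
    rw [← Finite.card_pos_iff, hcard]; norm_num
  obtain ⟨h, hh⟩ := hne
  have hmem : ∀ a, a ∉ Set.range (Hom.inv f) ↔ a = h ∨ a = Γ.τ h := by
    intro a
    constructor
    · intro ha
      by_contra hcon
      push Not at hcon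
      have hsub : ({h, Γ.τ h, a} : Set Γ.H) ⊆ {a | a ∉ Set.range (Hom.inv f)} := by
        rintro b (rfl | rfl | rfl)
        exacts [hh, hτ _ hh, ha]
      have h3 : Set.ncard ({h, Γ.τ h, a} : Set Γ.H) = 3 :=
        Set.ncard_eq_three.2 ⟨_, _, _, (Γ.τ_ne h).symm, hcon.1.symm, hcon.2.symm, rfl⟩
      have h4 := Set.ncard_le_ncard hsub (Set.toFinite _)
      have h5 : Set.ncard {a | a ∉ Set.range (Hom.inv f)} = 2 := hcard
      omega
    · rintro (rfl | rfl)
      · exact hh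
      · exact hτ _ hh
  -- If the edge were a loop, `vmap` would be injective, and the tree condition at its vertex would
  -- leave no collapsed half-edge there.
  have hv : Γ.vert h ≠ Γ.vert (Γ.τ h) := by
    intro hv
    have hinj : ∀ v w, Hom.vmap f v = Hom.vmap f w → v = w := by
      intro v w hvw
      have := (Hom.vmap_eq_iff f v w).1 hvw
      clear hvw
      induction this with
      | rel v w h' =>
        obtain ⟨b, hb, rfl, rfl⟩ := h'
        rcases (hmem b).1 hb with rfl | rfl
        · exact hv
        · rw [Γ.τ_τ]; exact hv.symm
      | refl x => rfl
      | symm x y _ ih => exact ih.symm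
      | trans x y z _ _ ih1 ih2 => exact ih1.trans ih2
    have ht := Hom.tree f (Hom.vmap f (Γ.vert h))
    have h1 : Nat.card {v : Γ.Vertex // Hom.vmap f v = Hom.vmap f (Γ.vert h)} = 1 := by
      rw [Nat.card_eq_one_iff_unique]
      exact ⟨⟨fun a b => Subtype.ext (hinj _ _ (a.2.trans b.2.symm))⟩, ⟨⟨_, rfl⟩⟩⟩
    have h2 : Nat.card {a : Γ.H // a ∉ Set.range (Hom.inv f) ∧
        Hom.vmap f (Γ.vert a) = Hom.vmap f (Γ.vert h)} ≠ 0 := by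
      rw [Nat.card_ne_zero]
      exact ⟨⟨⟨h, hh, rfl⟩⟩, inferInstance⟩
    omega
  have hx : Γ.σ h ∈ Set.range (Hom.inv f) := by
    by_contra hx
    rcases (hmem _).1 hx with h1 | h1
    · exact Γ.σ_ne h h1
    · exact hv (by rw [← h1, vert_σ])
  have hy : Γ.σ (Γ.τ h) ∈ Set.range (Hom.inv f) := by
    by_contra hy
    rcases (hmem _).1 hy with h1 | h1
    · exact hv (by rw [← vert_σ (Γ.τ h), h1])
    · exact Γ.σ_ne _ h1
  obtain ⟨x, hx⟩ := hx
  obtain ⟨y, hy⟩ := hy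
  exact ⟨h, x, y, hmem, hv, hx.symm, hy.symm⟩

/-! ### Local structure of a one-edge collapse. -/

namespace OneEdge

variable {Γ Γ' : RibbonGraph} {f : Γ ⟶ Γ'} {h : Γ.H} {x y : Γ'.H}

theorem symm (H : OneEdge f h x y) : OneEdge f (Γ.τ h) y x where
  not_mem_range a := by rw [H.not_mem_range, Γ.τ_τ, or_comm]
  vert_ne := by rw [Γ.τ_τ]; exact H.vert_ne.symm
  σ_h := H.σ_τ_h
  σ_τ_h := by rw [Γ.τ_τ]; exact H.σ_h

theorem h_not_mem (H : OneEdge f h x y) : h ∉ Set.range (Hom.inv f) :=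
  (H.not_mem_range h).2 (Or.inl rfl)

theorem τ_h_not_mem (H : OneEdge f h x y) : Γ.τ h ∉ Set.range (Hom.inv f) :=
  (H.not_mem_range _).2 (Or.inr rfl)

theorem inv_ne (H : OneEdge f h x y) (k : Γ'.H) : Hom.inv f k ≠ h :=
  fun hk => H.h_not_mem ⟨k, hk⟩

theorem ne (H : OneEdge f h x y) : x ≠ y := by
  rintro rfl
  exact Γ.τ_ne h (Γ.σ.injective (H.σ_τ_h.trans H.σ_h.symm))

theorem turn_h (H : OneEdge f h x y) : Γ.Turn (Set.range (Hom.inv f))ᶜ h (Hom.inv f y) := by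
  refine Turn.cross _ _ H.h_not_mem ?_
  rw [H.σ_τ_h]
  exact Turn.leaf _ (fun hh => hh ⟨_, rfl⟩)

/-- The cyclic order at the ends of the collapsed edge. -/
theorem σ_inv_eq_h_iff (H : OneEdge f h x y) (k : Γ'.H) :
    Γ.σ (Hom.inv f k) = h ↔ Γ'.σ k = y := by
  have hc := Hom.cyclic f k
  constructor
  · intro hk
    rw [hk] at hc
    exact Hom.inv_injective f (hc.unique H.turn_h)
  · intro hk
    by_contra hne
    have hmem : Γ.σ (Hom.inv f k) ∈ Set.range (Hom.inv f) := by
      by_contra hmem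
      rcases (H.not_mem_range _).1 hmem with h1 | h1
      · exact hne h1
      · rw [h1] at hc
        exact H.ne (Hom.inv_injective f (H.symm.turn_h.unique hc) |>.trans hk)
    have := hc.unique (Turn.leaf _ (fun hh => hh hmem))
    rw [hk, ← H.σ_τ_h] at this
    exact H.symm.inv_ne k (Γ.σ.injective this.symm)

theorem σ_inv_eq_τ_h_iff (H : OneEdge f h x y) (k : Γ'.H) :
    Γ.σ (Hom.inv f k) = Γ.τ h ↔ Γ'.σ k = x := H.symm.σ_inv_eq_h_iff k

theorem σ_inv (H : OneEdge f h x y) {k : Γ'.H} (hx : Γ'.σ k ≠ x) (hy : Γ'.σ k ≠ y) :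
    Γ.σ (Hom.inv f k) = Hom.inv f (Γ'.σ k) := by
  have hmem : Γ.σ (Hom.inv f k) ∈ Set.range (Hom.inv f) := by
    by_contra hmem
    rcases (H.not_mem_range _).1 hmem with h1 | h1
    · exact hy ((H.σ_inv_eq_h_iff k).1 h1)
    · exact hx ((H.σ_inv_eq_τ_h_iff k).1 h1)
  exact ((Hom.cyclic f k).unique (Turn.leaf _ (fun hh => hh hmem))).symm

theorem vmap_h (H : OneEdge f h x y) : Hom.vmap f (Γ.vert h) = Γ'.vert x := by
  rw [← vert_σ, H.σ_h, Hom.vmap_vert]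

theorem vert_eq (H : OneEdge f h x y) : Γ'.vert x = Γ'.vert y := by
  rw [← H.vmap_h, ← H.symm.vmap_h]
  exact (Hom.vmap_eq_iff f _ _).2 (Relation.EqvGen.rel _ _ ⟨h, H.h_not_mem, rfl, rfl⟩)

/-- If `y` followed `x`, the vertex of `h` would consist of `h` and `Γ.σ h` only, contradicting
valence at least three. With `symm` this says that the corners joined by the diagonal are not
adjacent. -/
theorem σ_x_ne (H : OneEdge f h x y) : Γ'.σ x ≠ y := by
  intro hxy
  have h1 := (H.σ_inv_eq_h_iff x).2 hxy
  rw [← H.σ_h] at h1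
  have h3 := Γ.three_le h
  have : Nat.card {k : Γ.H // Γ.σ.SameCycle h k} ≤ 2 := by
    have hsub : {k : Γ.H | Γ.σ.SameCycle h k} ⊆ {h, Γ.σ h} := by
      have hp : (Γ.σ ^ 2) h = h := h1
      rintro k ⟨i, rfl⟩
      rcases Int.even_or_odd' i with ⟨c, rfl | rfl⟩
      · left
        rw [zpow_mul]
        exact Equiv.Perm.zpow_apply_eq_self_of_apply_eq_self hp c
      · right
        rw [add_comm, zpow_add, zpow_mul, Equiv.Perm.mul_apply]
        have h5 : ((Γ.σ ^ (2 : ℤ)) ^ c) h = h :=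
          Equiv.Perm.zpow_apply_eq_self_of_apply_eq_self hp c
        rw [h5]
        simp
    have h4 := Set.ncard_le_ncard hsub (Set.toFinite _)
    exact h4.trans ((Set.ncard_insert_le _ _).trans (by simp))
  omega

/-- Every half-edge lies over a half-edge of the target or is one of the collapsed ones. -/
theorem cases (H : OneEdge f h x y) (a : Γ.H) :
    (∃ k, a = Hom.inv f k) ∨ a = h ∨ a = Γ.τ h := by
  by_cases ha : a ∈ Set.range (Hom.inv f)
  · obtain ⟨k, rfl⟩ := ha
    exact Or.inl ⟨k, rfl⟩
  · exact Or.inr ((H.not_mem_range a).1 ha)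

open Classical in
/-- The map on corners given by collapsing one edge. -/
def corner (_ : OneEdge f h x y) (a : Γ.H) : Γ'.H :=
  if ha : ∃ k, Hom.inv f k = a then ha.choose else if a = h then y else x

theorem corner_inv (H : OneEdge f h x y) (k : Γ'.H) : H.corner (Hom.inv f k) = k := by
  have ha : ∃ l, Hom.inv f l = Hom.inv f k := ⟨k, rfl⟩
  rw [corner, dif_pos ha]
  exact Hom.inv_injective f ha.choose_spec

theorem corner_h (H : OneEdge f h x y) : H.corner h = y := by
  rw [corner, dif_neg (show ¬ ∃ k, Hom.inv f k = h from H.h_not_mem), if_pos rfl]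

theorem corner_τ_h (H : OneEdge f h x y) : H.corner (Γ.τ h) = x := by
  rw [corner, dif_neg (show ¬ ∃ k, Hom.inv f k = Γ.τ h from H.τ_h_not_mem), if_neg (Γ.τ_ne h)]

theorem turn_corner (H : OneEdge f h x y) (a : Γ.H) :
    Γ.Turn (Set.range (Hom.inv f))ᶜ a (Hom.inv f (H.corner a)) := by
  rcases H.cases a with ⟨k, rfl⟩ | rfl | rfl
  · rw [H.corner_inv]
    exact Turn.leaf _ (fun hh => hh ⟨_, rfl⟩)
  · rw [H.corner_h]
    exact H.turn_h
  · rw [H.corner_τ_h]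
    exact H.symm.turn_h

/-- Two morphisms which collapse one edge and have the same successors are isomorphic. -/
theorem exists_iso {Δ : RibbonGraph} {g : Δ ⟶ Γ'} {d : Δ.H} (H : OneEdge f h x y)
    (D : OneEdge g d x y) : ∃ φ : Γ ≅ Δ, φ.hom ≫ g = f := by
  classical
  let F : Γ.H → Δ.H := fun a =>
    if ha : ∃ k, Hom.inv f k = a then Hom.inv g ha.choose else if a = h then d else Δ.τ d
  have F1 : ∀ k, F (Hom.inv f k) = Hom.inv g k := by
    intro k
    have ha : ∃ l, Hom.inv f l = Hom.inv f k := ⟨k, rfl⟩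
    simp only [F]
    rw [dif_pos ha, Hom.inv_injective f ha.choose_spec]
  have F2 : F h = d := by
    exact (dif_neg (show ¬ ∃ k, Hom.inv f k = h from H.h_not_mem)).trans (if_pos rfl)
  have F3 : F (Γ.τ h) = Δ.τ d := by
    exact (dif_neg (show ¬ ∃ k, Hom.inv f k = Γ.τ h from H.τ_h_not_mem)).trans
      (if_neg (Γ.τ_ne h))
  have hF : Function.Bijective F := by
    constructor
    · intro a b hab
      rcases H.cases a with ⟨k, rfl⟩ | rfl | rfl <;> rcases H.cases b with ⟨l, rfl⟩ | rfl | rfl <;>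
        simp only [F1, F2, F3] at hab
      · rw [Hom.inv_injective g hab]
      · exact absurd hab (D.inv_ne _)
      · exact absurd hab (D.symm.inv_ne _)
      · exact absurd hab.symm (D.inv_ne _)
      · rfl
      · exact absurd hab.symm (Δ.τ_ne _)
      · exact absurd hab.symm (D.symm.inv_ne _)
      · exact absurd hab (Δ.τ_ne _)
      · rfl
    · intro b
      rcases D.cases b with ⟨k, rfl⟩ | rfl | rfl
      exacts [⟨_, F1 k⟩, ⟨_, F2⟩, ⟨_, F3⟩]
  let θ : Γ.H ≃ Δ.H := Equiv.ofBijective F hF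
  -- The collapsed half-edges are inserted exactly where the order of `Γ'` reaches `y` or `x`, so
  -- the cyclic order upstairs is determined by that of `Γ'` and the pair of successors.
  have hσ : ∀ a, θ (Γ.σ a) = Δ.σ (θ a) := by
    intro a
    show F (Γ.σ a) = Δ.σ (F a)
    rcases H.cases a with ⟨k, rfl⟩ | rfl | rfl
    · rw [F1]
      by_cases hy : Γ'.σ k = y
      · rw [(H.σ_inv_eq_h_iff k).2 hy, (D.σ_inv_eq_h_iff k).2 hy, F2]
      by_cases hx : Γ'.σ k = x
      · rw [(H.σ_inv_eq_τ_h_iff k).2 hx, (D.σ_inv_eq_τ_h_iff k).2 hx, F3]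
      rw [H.σ_inv hx hy, D.σ_inv hx hy, F1]
    · rw [H.σ_h, F1, F2, D.σ_h]
    · rw [H.σ_τ_h, F1, F3, D.σ_τ_h]
  have hτ : ∀ a, θ (Γ.τ a) = Δ.τ (θ a) := by
    intro a
    show F (Γ.τ a) = Δ.τ (F a)
    rcases H.cases a with ⟨k, rfl⟩ | rfl | rfl
    · rw [F1, ← Hom.inv_τ, F1, Hom.inv_τ]
    · rw [F2, F3]
    · rw [Γ.τ_τ, F2, F3, Δ.τ_τ]
  refine ⟨isoOfEquiv θ hσ hτ, Hom.ext_inv ?_⟩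
  funext k
  rw [inv_comp, inv_isoOfEquiv_hom, Equiv.symm_apply_eq]
  exact (F1 k).symm

/-- The collapse of one edge is preserved by isomorphisms of the source. -/
theorem iso_comp {Δ : RibbonGraph} (H : OneEdge f h x y) (φ : Δ ≅ Γ) :
    OneEdge (φ.hom ≫ f) ((isoEquiv φ).symm h) x y := by
  have hs : ∀ a, isoEquiv φ (Δ.σ a) = Γ.σ (isoEquiv φ a) := isoEquiv_σ φ
  have hi : ∀ k, Hom.inv (φ.hom ≫ f) k = (isoEquiv φ).symm (Hom.inv f k) := fun k => rfl
  have ht : Δ.τ ((isoEquiv φ).symm h) = (isoEquiv φ).symm (Γ.τ h) := by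
    rw [Equiv.eq_symm_apply, isoEquiv_τ, Equiv.apply_symm_apply]
  constructor
  · intro a
    have := H.not_mem_range (isoEquiv φ a)
    rw [ht, Equiv.eq_symm_apply, Equiv.eq_symm_apply, ← this, not_iff_not]
    constructor
    · rintro ⟨k, rfl⟩
      exact ⟨k, by rw [hi, Equiv.apply_symm_apply]⟩
    · rintro ⟨k, hk⟩
      exact ⟨k, by rw [hi, hk, Equiv.symm_apply_apply]⟩
  · intro hv
    apply H.vert_ne
    rw [ht] at hv
    have := congrArg (Hom.vmap φ.hom) hv
    rwa [← vert_isoEquiv, ← vert_isoEquiv, Equiv.apply_symm_apply, Equiv.apply_symm_apply] at this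
  · rw [hi, Equiv.eq_symm_apply, isoEquiv_σ, Equiv.apply_symm_apply, H.σ_h]
  · rw [ht, hi, Equiv.eq_symm_apply, isoEquiv_σ, Equiv.apply_symm_apply, H.σ_τ_h]

theorem codim_eq (H : OneEdge f h x y) : Γ.codim + 1 = Γ'.codim := by
  have h1 := codim_collapse f
  have h2 : Nat.card {a : Γ.H // a ∉ Set.range (Hom.inv f)} = 2 := by
    have : {a : Γ.H | a ∉ Set.range (Hom.inv f)} = {h, Γ.τ h} := by
      ext a
      exact H.not_mem_range a
    show Set.ncard {a : Γ.H | a ∉ Set.range (Hom.inv f)} = 2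
    rw [this, Set.ncard_pair (Γ.τ_ne h).symm]
  omega

/-- The pair of successors is determined by the morphism up to order. -/
theorem eq_or_eq {h' : Γ.H} {x' y' : Γ'.H} (H : OneEdge f h x y) (H' : OneEdge f h' x' y') :
    (x' = x ∧ y' = y) ∨ (x' = y ∧ y' = x) := by
  rcases (H.not_mem_range h').1 H'.h_not_mem with rfl | rfl
  · left
    exact ⟨Hom.inv_injective f (H'.σ_h.symm.trans H.σ_h),
      Hom.inv_injective f (H'.σ_τ_h.symm.trans H.σ_τ_h)⟩
  · right
    refine ⟨Hom.inv_injective f (H'.σ_h.symm.trans H.σ_τ_h),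
      Hom.inv_injective f (H'.σ_τ_h.symm.trans ?_)⟩
    rw [Γ.τ_τ, H.σ_h]

end OneEdge

/-! ### Lists which enumerate the cycles of a permutation -/

theorem apply_eq_of_sameCycle {A V : Type} {σ : Equiv.Perm A} {g : A → V}
    (hg : ∀ a, g (σ a) = g a) {a b : A} (h : σ.SameCycle a b) : g a = g b := by
  obtain ⟨i, rfl⟩ := h
  have hn : ∀ (n : ℕ) a, g ((σ ^ n) a) = g a := by
    intro n
    induction n with
    | zero => exact fun _ => rfl
    | succ n ih => intro a; rw [pow_succ', Equiv.Perm.mul_apply, hg, ih]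
  obtain ⟨n, rfl | rfl⟩ := i.eq_nat_or_neg
  · rw [zpow_natCast, hn]
  · rw [zpow_neg, zpow_natCast, ← hn n ((σ ^ n)⁻¹ a), ← Equiv.Perm.mul_apply, mul_inv_cancel,
      Equiv.Perm.one_apply]

/-- The list `Q` enumerates a cycle of `σ`, each element being followed by its image. -/
def IsCycleList {A : Type} (σ : Equiv.Perm A) (Q : List A) : Prop :=
  ∃ a T, Q = a :: T ∧ (a :: T ++ [a]).IsChain (fun b c => σ b = c)

namespace IsCycleList

variable {A : Type} {σ : Equiv.Perm A} {Q : List A}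

theorem ne_nil (h : IsCycleList σ Q) : Q ≠ [] := by
  obtain ⟨a, T, rfl, -⟩ := h
  simp

theorem σ_eq_of_split {B D : List A} {a b : A} (h : IsCycleList σ Q) (hQ : Q = B ++ a :: b :: D) :
    σ a = b := by
  obtain ⟨c, T, rfl, hc⟩ := h
  rw [hQ] at hc
  simp only [List.append_assoc, List.cons_append] at hc
  have := (List.isChain_append.1 hc).2.1
  exact (List.isChain_cons_cons.1 this).1

theorem σ_last {c : A} {B : List A} {a : A} (h : IsCycleList σ (c :: B ++ [a])) : σ a = c := by
  obtain ⟨c', T, hT, hc⟩ := h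
  rw [← hT] at hc
  simp only [List.cons_append, List.cons.injEq] at hT
  obtain ⟨rfl, -⟩ := hT
  simp only [List.append_assoc, List.cons_append, List.nil_append] at hc
  have := (List.isChain_append.1 (List.cons_append ▸ hc : ((c :: B) ++ [a, c]).IsChain _)).2.1
  exact (List.isChain_cons_cons.1 this).1

/-- A closed chain splits at the element where the rotation starts, and its two arcs can be glued in
the other order. -/
theorem rotate {B D : List A} (h : IsCycleList σ (B ++ D)) : IsCycleList σ (D ++ B) := by
  rcases B with _ | ⟨b, B⟩
  · simpa using h
  rcases D with _ | ⟨d, D⟩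
  · simpa using h
  obtain ⟨c, T, hT, hc⟩ := h
  rw [← hT] at hc
  simp only [List.cons_append, List.cons.injEq] at hT
  obtain ⟨rfl, -⟩ := hT
  refine ⟨d, D ++ b :: B, rfl, ?_⟩
  simp only [List.append_assoc, List.cons_append] at hc ⊢
  have hc' : ((b :: B) ++ d :: (D ++ [b])).IsChain (fun b c => σ b = c) := hc
  rw [List.isChain_split] at hc'
  have h2 : ((d :: D) ++ b :: (B ++ [d])).IsChain (fun b c => σ b = c) := by
    rw [List.isChain_split]
    exact ⟨hc'.2, hc'.1⟩
  exact h2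

theorem σ_mem (h : IsCycleList σ Q) {a : A} (ha : a ∈ Q) : σ a ∈ Q := by
  obtain ⟨B, D, rfl⟩ := List.append_of_mem ha
  rcases D with _ | ⟨d, D⟩
  · rcases B with _ | ⟨b, B⟩
    · obtain ⟨c, T, hT, hc⟩ := h
      simp only [List.nil_append, List.cons.injEq] at hT
      obtain ⟨rfl, rfl⟩ := hT
      have := (List.isChain_cons_cons.1 hc).1
      simp [this]
    · rw [h.σ_last]; simp
  · rw [h.σ_eq_of_split rfl]; simp

theorem sameCycle (h : IsCycleList σ Q) {a b : A} (ha : a ∈ Q) (hb : b ∈ Q) :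
    σ.SameCycle a b := by
  have key : ∀ (T : List A) c, (c :: T).IsChain (fun b c => σ b = c) → ∀ d ∈ c :: T,
      σ.SameCycle c d := by
    intro T
    induction T with
    | nil =>
      intro c _ d hd
      rw [List.mem_singleton.1 hd]
    | cons e T ih =>
      intro c hc d hd
      rw [List.isChain_cons_cons] at hc
      rcases List.mem_cons.1 hd with rfl | hd
      · exact Equiv.Perm.SameCycle.refl _ _
      · have := ih e hc.2 d hd
        rw [← hc.1] at this
        exact Equiv.Perm.sameCycle_apply_left.1 this
  obtain ⟨c, T, rfl, hc⟩ := h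
  have hc' : (c :: T).IsChain (fun b c => σ b = c) := (List.isChain_append.1 hc).1
  exact (key T c hc' a ha).symm.trans (key T c hc' b hb)

theorem mem_of_sameCycle (h : IsCycleList σ Q) {a b : A} (ha : a ∈ Q) (hab : σ.SameCycle a b)
    [Finite A] : b ∈ Q := by
  obtain ⟨n, rfl⟩ := hab.exists_nat_pow_eq
  clear hab
  induction n with
  | zero => exact ha
  | succ n ih => rw [pow_succ', Equiv.Perm.mul_apply]; exact h.σ_mem ih

theorem mem_iff (h : IsCycleList σ Q) {a b : A} (ha : a ∈ Q) [Finite A] :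
    b ∈ Q ↔ σ.SameCycle a b :=
  ⟨fun hb => h.sameCycle ha hb, fun hb => h.mem_of_sameCycle ha hb⟩

theorem card_eq (h : IsCycleList σ Q) (hn : Q.Nodup) {a : A} (ha : a ∈ Q) [Finite A] :
    Nat.card {b : A // σ.SameCycle a b} = Q.length := by
  classical
  have : {b : A // σ.SameCycle a b} ≃ {b : A // b ∈ Q.toFinset} :=
    Equiv.subtypeEquivRight fun b => by rw [List.mem_toFinset, h.mem_iff ha]
  rw [Nat.card_congr this, Nat.card_eq_fintype_card, Fintype.card_coe,
    List.toFinset_card_of_nodup hn]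

/-- A cycle list is determined by its first element. -/
theorem eq_of_head {a : A} {T T' : List A} (h : IsCycleList σ (a :: T))
    (h' : IsCycleList σ (a :: T')) (hn : (a :: T).Nodup) (hn' : (a :: T').Nodup) :
    T = T' := by
  have key : ∀ (T T' : List A) (b : A), (b :: T ++ [a]).IsChain (fun b c => σ b = c) →
      (b :: T' ++ [a]).IsChain (fun b c => σ b = c) → a ∉ T → a ∉ T' → T = T' := by
    intro T
    induction T with
    | nil =>
      intro T' b h1 h2 _ h4
      rcases T' with _ | ⟨c, T'⟩
      · rfl
      · have e1 := (List.isChain_cons_cons.1 h1).1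
        have e2 := (List.isChain_cons_cons.1 h2).1
        rw [e1] at e2
        exact absurd (by simp [e2]) h4
    | cons d T ih =>
      intro T' b h1 h2 h3 h4
      have e1 := List.isChain_cons_cons.1 h1
      rcases T' with _ | ⟨c, T'⟩
      · have e2 := (List.isChain_cons_cons.1 h2).1
        rw [e1.1] at e2
        exact absurd (by simp [e2]) h3
      · have e2 := List.isChain_cons_cons.1 h2
        obtain rfl : d = c := by rw [← e1.1, ← e2.1]
        rw [ih T' d e1.2 e2.2 (fun h => h3 (by simp [h])) (fun h => h4 (by simp [h]))]
  obtain ⟨c, S, hS, hc⟩ := h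
  obtain ⟨c', S', hS', hc'⟩ := h'
  simp only [List.cons.injEq] at hS hS'
  obtain ⟨rfl, rfl⟩ := hS
  obtain ⟨rfl, rfl⟩ := hS'
  exact key _ _ _ hc hc' (List.nodup_cons.1 hn).1 (List.nodup_cons.1 hn').1

theorem map_of_semiconj {B : Type} {ρ : Equiv.Perm B} {f : A → B}
    (h : IsCycleList σ Q) (hf : ∀ a ∈ Q, f (σ a) = ρ (f a)) : IsCycleList ρ (Q.map f) := by
  obtain ⟨c, T, rfl, hc⟩ := h
  refine ⟨f c, T.map f, rfl, ?_⟩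
  have : f c :: T.map f ++ [f c] = (c :: T ++ [c]).map f := by simp
  rw [this, List.isChain_map]
  refine List.IsChain.imp_of_mem_imp ?_ hc
  intro a b ha hb hab
  rw [← hf, hab]
  rcases List.mem_append.1 ha with ha | ha
  · exact ha
  · rw [List.mem_singleton.1 ha]; simp

/-! ### Cutting a cycle into two cycles. -/

section Cut

variable {B : Type} {ρ : Equiv.Perm B} {i : A → B} {h : B} {x y : A} {u s t : List A}

/-- Cutting a cycle before two of its elements: the first half, closed up by a new element. -/
theorem cut (hQ : IsCycleList σ (u ++ x :: (s ++ y :: t))) (hn : (u ++ x :: (s ++ y :: t)).Nodup)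
    (h1 : ρ h = i x) (h2 : ∀ k, σ k = y → ρ (i k) = h)
    (h3 : ∀ k, σ k ≠ x → σ k ≠ y → ρ (i k) = i (σ k)) :
    IsCycleList ρ (h :: (x :: s).map i) := by
  have hc : (x :: s ++ [y]).IsChain (fun b c => σ b = c) := by
    obtain ⟨a, T, hT, hc⟩ := hQ.rotate
    rw [← hT] at hc
    have e : x :: (s ++ y :: t) ++ u ++ [a] = (x :: s ++ [y]) ++ (t ++ u ++ [a]) := by simp
    rw [e] at hc
    exact (List.isChain_append.1 hc).1
  have hn' : (x :: (s ++ y :: t)).Nodup := (List.nodup_append.1 hn).2.1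
  simp only [List.nodup_cons, List.nodup_append, List.mem_append, List.mem_cons, not_or] at hn'
  -- On the arc no element after the first one is `x` or `y`, so each step of the arc falls under
  -- `h3`.
  have key : ∀ P : List A, P.IsChain (fun b c => σ b = c) → x ∉ P.tail → y ∉ P.tail →
      (P.map i).IsChain (fun b c => ρ b = c) := by
    intro P
    rw [List.isChain_map]
    induction P with
    | nil => exact fun _ _ _ => List.isChain_nil
    | cons a P ih =>
      intro h hx hy
      rcases P with _ | ⟨b, P⟩
      · exact List.isChain_singleton _
      · rw [List.isChain_cons_cons] at h ⊢
        simp only [List.tail_cons, List.mem_cons, not_or] at hx hy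
        refine ⟨?_, ih h.2 hx.2 hy.2⟩
        rw [h3, h.1]
        · rw [h.1]; exact fun e => hx.1 e.symm
        · rw [h.1]; exact fun e => hy.1 e.symm
  have hk := key _ (List.isChain_append.1 hc).1 (by simpa using hn'.1.1) (by
      simp only [List.tail_cons]
      intro hys
      exact hn'.2.2.2 y hys y (Or.inl rfl) rfl)
  refine ⟨_, _, rfl, ?_⟩
  show (h :: ((x :: s).map i ++ [h])).IsChain _
  rw [List.map_cons, List.cons_append, List.isChain_cons_cons]
  refine ⟨h1, ?_⟩
  show ((x :: s).map i ++ [h]).IsChain _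
  rw [List.isChain_append]
  refine ⟨hk, List.isChain_singleton _, ?_⟩
  intro a ha b hb
  simp only [List.head?_cons, Option.mem_def, Option.some.injEq] at hb
  subst hb
  rw [List.getLast?_map] at ha
  simp only [Option.mem_def, Option.map_eq_some_iff] at ha
  obtain ⟨k, hk, rfl⟩ := ha
  exact h2 _ ((List.isChain_append.1 hc).2.2 k hk y rfl)

/-- Cutting a cycle before two of its elements: the second half, closed up by a new element. -/
theorem cut' (hQ : IsCycleList σ (u ++ x :: (s ++ y :: t))) (hn : (u ++ x :: (s ++ y :: t)).Nodup)
    (h1 : ρ h = i y) (h2 : ∀ k, σ k = x → ρ (i k) = h)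
    (h3 : ∀ k, σ k ≠ y → σ k ≠ x → ρ (i k) = i (σ k)) :
    IsCycleList ρ (h :: (y :: (t ++ u)).map i) := by
  -- Rotating the cycle so that `y` comes first exchanges the roles of `x` and `y`.
  have e : (u ++ x :: (s ++ y :: t)) = (u ++ x :: s) ++ y :: t := by simp
  rw [e] at hQ hn
  have hn' := (List.perm_append_comm (l₁ := u ++ x :: s) (l₂ := y :: t)).nodup_iff.1 hn
  have hQ' := hQ.rotate
  have e2 : y :: t ++ (u ++ x :: s) = [] ++ y :: ((t ++ u) ++ x :: s) := by simp
  rw [e2] at hQ' hn'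
  exact hQ'.cut hn' h1 h2 h3

end Cut

end IsCycleList

/-- The minimal period gives a closed chain without repetitions; only then does `card_eq` identify
this period with the size of the orbit. -/
theorem isCycleList_range {A : Type} (σ : Equiv.Perm A) [Finite A] (a : A) :
    IsCycleList σ ((List.range (Nat.card {b : A // σ.SameCycle a b})).map fun j => (σ ^ j) a) ∧
      ((List.range (Nat.card {b : A // σ.SameCycle a b})).map fun j => (σ ^ j) a).Nodup := by
  set n := Function.minimalPeriod σ a with hn
  have hper : a ∈ Function.periodicPts σ := by
    obtain ⟨n, hn, h⟩ := (isOfFinOrder_of_finite σ).exists_pow_eq_one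
    exact ⟨n, hn, by
      rw [Function.IsPeriodicPt, Function.IsFixedPt, Equiv.Perm.iterate_eq_pow, h]; rfl⟩
  have hpos : 0 < n := Function.minimalPeriod_pos_of_mem_periodicPts hper
  have hfix : (σ ^ n) a = a := by
    have := Function.iterate_minimalPeriod (f := σ) (x := a)
    rwa [Equiv.Perm.iterate_eq_pow] at this
  have hnd : ((List.range n).map fun j => (σ ^ j) a).Nodup := by
    have := Function.nodup_periodicOrbit (f := σ) (x := a)
    rw [Function.periodicOrbit, Cycle.nodup_coe_iff] at this
    simpa [Equiv.Perm.iterate_eq_pow] using this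
  have hcl : IsCycleList σ ((List.range n).map fun j => (σ ^ j) a) := by
    obtain ⟨m, hm⟩ : ∃ m, n = m + 1 := ⟨n - 1, by omega⟩
    have hr : (List.range n).map (fun j => (σ ^ j) a) =
        a :: (List.range m).map (fun j => (σ ^ (j + 1)) a) := by
      rw [hm, List.range_succ_eq_map]
      simp [Function.comp_def]
    refine ⟨_, _, hr, ?_⟩
    rw [← hr]
    have h2 : (List.range n).map (fun j => (σ ^ j) a) ++ [a] =
        (List.range (n + 1)).map (fun j => (σ ^ j) a) := by
      rw [List.range_succ]
      simp [hfix]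
    rw [h2, List.isChain_map, List.isChain_iff_getElem]
    intro i hi
    simp [pow_succ', Equiv.Perm.mul_apply]
  have ha : a ∈ (List.range n).map fun j => (σ ^ j) a :=
    List.mem_map.2 ⟨0, List.mem_range.2 hpos, rfl⟩
  have hcard := hcl.card_eq hnd ha
  rw [List.length_map, List.length_range] at hcard
  rw [hcard]
  exact ⟨hcl, hnd⟩

theorem exists_isCycleList {A : Type} (σ : Equiv.Perm A) [Finite A] (a : A) :
    ∃ Q, IsCycleList σ Q ∧ Q.Nodup ∧ a ∈ Q := by
  obtain ⟨h1, h2⟩ := isCycleList_range σ a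
  refine ⟨_, h1, h2, List.mem_map.2 ⟨0, List.mem_range.2 ?_, rfl⟩⟩
  have : Nonempty {b : A // σ.SameCycle a b} := ⟨a, Equiv.Perm.SameCycle.refl _ _⟩
  exact Nat.card_pos

/-! ### Expanding a vertex -/

section Expand

variable {A : Type}

open Classical in
/-- The permutation obtained from `σ` by cutting the cycle containing `x` and `y` before these
elements, closing up the two halves by new elements. -/
def expandPerm (σ : Equiv.Perm A) (x y : A) : Equiv.Perm (A ⊕ Bool) :=
  (Equiv.sumCongr σ (Equiv.refl Bool)).trans
    -- The inner transpositions alone would give `false ↦ y` and `true ↦ x`. The outer one corrects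
    -- this, so that each new element is followed by the first corner of the half which it closes
    -- up.
    (Equiv.swap (Sum.inl x) (Sum.inl y) *
      (Equiv.swap (Sum.inl x) (Sum.inr true) * Equiv.swap (Sum.inl y) (Sum.inr false)))

variable {σ : Equiv.Perm A} {x y : A}

theorem expandPerm_false (hxy : x ≠ y) : expandPerm σ x y (Sum.inr false) = Sum.inl x := by
  simp [expandPerm, Equiv.swap_apply_def, hxy.symm]

theorem expandPerm_true : expandPerm σ x y (Sum.inr true) = Sum.inl y := by
  simp [expandPerm, Equiv.swap_apply_def]

theorem expandPerm_of_eq_left (hxy : x ≠ y) {k : A} (hk : σ k = x) :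
    expandPerm σ x y (Sum.inl k) = Sum.inr true := by
  simp [expandPerm, Equiv.swap_apply_def, hk, hxy]

theorem expandPerm_of_eq_right {k : A} (hk : σ k = y) :
    expandPerm σ x y (Sum.inl k) = Sum.inr false := by
  simp [expandPerm, Equiv.swap_apply_def, hk]

theorem expandPerm_of_ne {k : A} (hx : σ k ≠ x) (hy : σ k ≠ y) :
    expandPerm σ x y (Sum.inl k) = Sum.inl (σ k) := by
  simp [expandPerm, Equiv.swap_apply_def, hx, hy]

/-- The map on corners which undoes the expansion. -/
def expandCorner (x y : A) : A ⊕ Bool → A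
  | Sum.inl k => k
  | Sum.inr false => y
  | Sum.inr true => x

variable {u s t : List A}

theorem isCycleList_expand_left (h : IsCycleList σ (u ++ x :: (s ++ y :: t)))
    (hn : (u ++ x :: (s ++ y :: t)).Nodup) :
    IsCycleList (expandPerm σ x y) (Sum.inr false :: (x :: s).map Sum.inl) :=
  h.cut hn (expandPerm_false fun e => by subst e; simp [List.nodup_append] at hn)
    (fun _ => expandPerm_of_eq_right) (fun _ => expandPerm_of_ne)

theorem isCycleList_expand_right (h : IsCycleList σ (u ++ x :: (s ++ y :: t)))
    (hn : (u ++ x :: (s ++ y :: t)).Nodup) :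
    IsCycleList (expandPerm σ x y) (Sum.inr true :: (y :: (t ++ u)).map Sum.inl) := by
  have hxy : x ≠ y := by
    rintro rfl
    simp [List.nodup_append] at hn
  exact h.cut' hn expandPerm_true (fun _ => expandPerm_of_eq_left hxy)
    (fun _ hy hx => expandPerm_of_ne hx hy)

theorem isCycleList_expand_of_not_mem {P : List A} (h : IsCycleList σ P) (hx : x ∉ P)
    (hy : y ∉ P) : IsCycleList (expandPerm σ x y) (P.map Sum.inl) := by
  refine h.map_of_semiconj fun a ha => ?_
  have := h.σ_mem ha
  rw [expandPerm_of_ne]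
  · rintro rfl; exact hx this
  · rintro rfl; exact hy this

/-- Needed for the vertex map of the expansion to descend to the orbits of `expandPerm`. -/
theorem expandCorner_expandPerm {V : Type} {g : A → V} (hg : ∀ a, g (σ a) = g a) (hxy : x ≠ y)
    (hgxy : g x = g y) (a : A ⊕ Bool) :
    g (expandCorner x y (expandPerm σ x y a)) = g (expandCorner x y a) := by
  rcases a with k | _ | _
  · by_cases hx : σ k = x
    · rw [expandPerm_of_eq_left hxy hx]
      show g x = g k
      rw [← hx, hg]
    by_cases hy : σ k = y
    · rw [expandPerm_of_eq_right hy]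
      show g y = g k
      rw [← hy, hg]
    rw [expandPerm_of_ne hx hy]
    exact hg k
  · rw [expandPerm_false hxy]
    exact hgxy
  · rw [expandPerm_true]
    exact hgxy.symm

end Expand

/-- A vertex can be expanded into two vertices along any diagonal. -/
theorem exists_expansion (Γ : RibbonGraph) {u s t : List Γ.H} {x y : Γ.H}
    (hQ : IsCycleList Γ.σ (u ++ x :: (s ++ y :: t))) (hn : (u ++ x :: (s ++ y :: t)).Nodup)
    (hs : s ≠ []) (hut : u ≠ [] ∨ t ≠ []) :
    ∃ (Δ : RibbonGraph) (f : Δ ⟶ Γ) (h : Δ.H), OneEdge f h x y := by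
  have hxy : x ≠ y := by
    rintro rfl
    simp [List.nodup_append] at hn
  set σ' := expandPerm Γ.σ x y with hσ'
  have hv : Γ.vert x = Γ.vert y := vert_eq_iff.2 (hQ.sameCycle (by simp) (by simp))
  have hQ0 := isCycleList_expand_left hQ hn
  have hQ1 := isCycleList_expand_right hQ hn
  have hn0 : ((Sum.inr false : Γ.H ⊕ Bool) :: (x :: s).map Sum.inl).Nodup := by
    rw [List.nodup_cons]
    refine ⟨by simp, List.Nodup.map Sum.inl_injective ?_⟩
    have : (x :: s).Sublist (u ++ x :: (s ++ y :: t)) := by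
      have e : u ++ x :: (s ++ y :: t) = u ++ ((x :: s) ++ y :: t) := by simp
      rw [e]
      exact (List.sublist_append_left _ _).trans (List.sublist_append_right _ _)
    exact hn.sublist this
  have hn1 : ((Sum.inr true : Γ.H ⊕ Bool) :: (y :: (t ++ u)).map Sum.inl).Nodup := by
    rw [List.nodup_cons]
    refine ⟨by simp, List.Nodup.map Sum.inl_injective ?_⟩
    have hp : (y :: t ++ u).Perm (u ++ y :: t) := List.perm_append_comm
    have : (u ++ y :: t).Sublist (u ++ x :: (s ++ y :: t)) := by
      refine List.Sublist.append_left ?_ _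
      exact (List.sublist_append_right s _).trans (List.sublist_cons_self _ _)
    exact hp.nodup_iff.2 (hn.sublist this)
  have hmemQ : ∀ k, k ∈ u ++ x :: (s ++ y :: t) ↔ Γ.vert k = Γ.vert x := by
    intro k
    rw [hQ.mem_iff (a := x) (by simp), eq_comm, vert_eq_iff]
  have hcases : ∀ a : Γ.H ⊕ Bool, Γ.vert (expandCorner x y a) = Γ.vert x →
      a ∈ Sum.inr false :: (x :: s).map Sum.inl ∨
      a ∈ Sum.inr true :: (y :: (t ++ u)).map Sum.inl := by
    intro a ha
    rcases a with k | _ | _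
    · have := (hmemQ k).2 ha
      simp only [List.mem_append, List.mem_cons] at this
      simp only [List.map_cons, List.mem_cons, reduceCtorEq, Sum.inl.injEq, List.mem_map,
        exists_eq_right, List.mem_append, false_or]
      tauto
    · simp
    · simp
  have hcases' : ∀ a : Γ.H ⊕ Bool, Γ.vert (expandCorner x y a) ≠ Γ.vert x →
      ∃ P : List Γ.H, IsCycleList Γ.σ P ∧ P.Nodup ∧ x ∉ P ∧ y ∉ P ∧ a ∈ P.map Sum.inl := by
    intro a ha
    rcases a with k | _ | _
    · obtain ⟨P, h1, h2, h3⟩ := exists_isCycleList Γ.σ k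
      refine ⟨P, h1, h2, fun h => ha ?_, fun h => ha ?_, List.mem_map.2 ⟨k, h3, rfl⟩⟩
      · exact vert_eq_iff.2 (h1.sameCycle h3 h)
      · rw [hv]; exact vert_eq_iff.2 (h1.sameCycle h3 h)
    · exact absurd hv.symm ha
    · exact absurd rfl ha
  have hrel : ∀ {a b : Γ.H ⊕ Bool}, σ'.SameCycle a b →
      Γ.vert (expandCorner x y a) = Γ.vert (expandCorner x y b) := fun h =>
    apply_eq_of_sameCycle (g := fun a => Γ.vert (expandCorner x y a))
      (fun a => expandCorner_expandPerm vert_σ hxy hv a) h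
  let τ' : Equiv.Perm (Γ.H ⊕ Bool) := Equiv.sumCongr Γ.τ (Equiv.swap false true)
  have hclσ : σ' ∈ Subgroup.closure {σ', τ'} := Subgroup.subset_closure (by simp)
  have hclτ : τ' ∈ Subgroup.closure {σ', τ'} := Subgroup.subset_closure (by simp)
  let Rl : Γ.H ⊕ Bool → Γ.H ⊕ Bool → Prop := fun a b => ∃ g ∈ Subgroup.closure {σ', τ'}, g a = b
  have Rsymm : ∀ {a b}, Rl a b → Rl b a := by
    rintro a b ⟨g, hg, rfl⟩
    exact ⟨g⁻¹, inv_mem hg, by simp⟩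
  have Rtrans : ∀ {a b c}, Rl a b → Rl b c → Rl a c := by
    rintro a b c ⟨g, hg, rfl⟩ ⟨g', hg', rfl⟩
    exact ⟨g' * g, mul_mem hg' hg, rfl⟩
  have Rσ : ∀ a, Rl a (σ' a) := fun a => ⟨_, hclσ, rfl⟩
  have Rτ : ∀ a, Rl a (τ' a) := fun a => ⟨_, hclτ, rfl⟩
  -- Where the old successor is `x` or `y`, the connection is restored by a detour across the new
  -- edge.
  have Rσ2 : ∀ k, Rl (Sum.inl k) (Sum.inl (Γ.σ k)) := by
    intro k
    by_cases hx : Γ.σ k = x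
    · have h1 := Rσ (Sum.inl k)
      rw [hσ', expandPerm_of_eq_left hxy hx] at h1
      have h2 := Rσ (τ' (Sum.inr true))
      have e : τ' (Sum.inr true) = Sum.inr false := by simp [τ']
      rw [e, hσ', expandPerm_false hxy, ← hx] at h2
      have h3 := Rτ (Sum.inr true)
      rw [e] at h3
      exact Rtrans h1 (Rtrans h3 h2)
    by_cases hy : Γ.σ k = y
    · have h1 := Rσ (Sum.inl k)
      rw [hσ', expandPerm_of_eq_right hy] at h1
      have h2 := Rσ (τ' (Sum.inr false))
      have e : τ' (Sum.inr false) = Sum.inr true := by simp [τ']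
      rw [e, hσ', expandPerm_true, ← hy] at h2
      have h3 := Rτ (Sum.inr false)
      rw [e] at h3
      exact Rtrans h1 (Rtrans h3 h2)
    have h1 := Rσ (Sum.inl k)
    rwa [hσ', expandPerm_of_ne hx hy] at h1
  have Rcl : ∀ g ∈ Subgroup.closure {Γ.σ, Γ.τ}, ∀ k, Rl (Sum.inl k) (Sum.inl (g k)) := by
    intro g hg
    induction hg using Subgroup.closure_induction with
    | mem x hx =>
      intro k
      rcases hx with rfl | rfl
      · exact Rσ2 k
      · exact Rτ (Sum.inl k)
    | one => exact fun k => ⟨1, one_mem _, rfl⟩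
    | mul x y _ _ ihx ihy => exact fun k => Rtrans (ihy k) (ihx _)
    | inv x hx ih =>
      intro k
      have := ih (x⁻¹ k)
      rw [← Equiv.Perm.mul_apply, mul_inv_cancel, Equiv.Perm.one_apply] at this
      exact Rsymm this
  have Rto : ∀ a, Rl a (Sum.inl x) := by
    rintro (k | _ | _)
    · obtain ⟨g, hg, rfl⟩ := Γ.connected k x
      exact Rcl g hg k
    · have := Rσ (Sum.inr false)
      rwa [hσ', expandPerm_false hxy] at this
    · have h1 := Rσ (Sum.inr true)
      rw [hσ', expandPerm_true] at h1
      obtain ⟨g, hg, hgx⟩ := Γ.connected y x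
      have h2 := Rcl g hg y
      rw [hgx] at h2
      exact Rtrans h1 h2
  let Δ : RibbonGraph :=
    { H := Γ.H ⊕ Bool
      finite_H := inferInstance
      nonempty_H := inferInstance
      σ := σ'
      τ := τ'
      τ_τ := by rintro (k | _ | _) <;> simp [τ', Γ.τ_τ]
      τ_ne := by rintro (k | _ | _) <;> simp [τ', Γ.τ_ne]
      -- The two new vertices have the half-edges `false, x, s` and `true, y, t, u`; non-adjacency
      -- of the corners provides the third half-edge of each.
      three_le := by
        intro a
        by_cases ha : Γ.vert (expandCorner x y a) = Γ.vert x
        · rcases hcases a ha with h | h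
          · rw [hQ0.card_eq hn0 h]
            have := List.length_pos_iff.2 hs
            simp
            omega
          · rw [hQ1.card_eq hn1 h]
            have : 0 < u.length ∨ 0 < t.length := by
              rwa [List.length_pos_iff, List.length_pos_iff]
            simp
            omega
        · obtain ⟨P, h1, h2, h3, h4, h5⟩ := hcases' a ha
          rw [(isCycleList_expand_of_not_mem h1 h3 h4).card_eq (h2.map Sum.inl_injective) h5]
          obtain ⟨k, hk, rfl⟩ := List.mem_map.1 h5
          have := Γ.three_le k
          rw [h1.card_eq h2 hk] at this
          simpa using this
      connected := fun a b => Rtrans (Rto a) (Rsymm (Rto b)) }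
  have hΔv : ∀ {a b : Γ.H ⊕ Bool}, Δ.vert a = Δ.vert b ↔ σ'.SameCycle a b :=
    fun {a b} => vert_eq_iff (Γ := Δ)
  let vm : Δ.Vertex → Γ.Vertex :=
    Quotient.lift (fun a => Γ.vert (expandCorner x y a)) fun a b h => hrel h
  have hvm : ∀ a : Γ.H ⊕ Bool, vm (Δ.vert a) = Γ.vert (expandCorner x y a) := fun a => rfl
  have hrange : ∀ a : Γ.H ⊕ Bool, a ∉ Set.range (Sum.inl : Γ.H → Γ.H ⊕ Bool) ↔
      a = Sum.inr false ∨ a = Sum.inr true := by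
    rintro (k | _ | _) <;> simp
  have hover : ∀ v : Δ.Vertex, vm v = Γ.vert x →
      v = Δ.vert (Sum.inr false) ∨ v = Δ.vert (Sum.inr true) := by
    intro v hvx
    obtain ⟨a, rfl⟩ := Δ.vert_surjective v
    rcases hcases a hvx with h | h
    · left
      exact hΔv.2 (hQ0.sameCycle h (by simp))
    · right
      exact hΔv.2 (hQ1.sameCycle h (by simp))
  have hne01 : Δ.vert (Sum.inr false) ≠ Δ.vert (Sum.inr true) := by
    intro h
    have := hQ0.mem_of_sameCycle (by simp) (hΔv.1 h)
    simp at this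
  have hnot : ∀ v w : Δ.Vertex, vm v = vm w → vm v ≠ Γ.vert x → v = w := by
    intro v w hvw hvx
    obtain ⟨a, rfl⟩ := Δ.vert_surjective v
    obtain ⟨b, rfl⟩ := Δ.vert_surjective w
    obtain ⟨P, h1, h2, h3, h4, h5⟩ := hcases' a hvx
    refine hΔv.2 ((isCycleList_expand_of_not_mem h1 h3 h4).sameCycle h5 ?_)
    obtain ⟨k, hk, rfl⟩ := List.mem_map.1 h5
    rcases b with l | _ | _
    · refine List.mem_map.2 ⟨l, h1.mem_of_sameCycle hk ?_, rfl⟩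
      exact vert_eq_iff.1 hvw
    · exact absurd (hvw.trans hv.symm) hvx
    · exact absurd hvw hvx
  let f : Hom Δ Γ :=
    { inv := Sum.inl
      vmap := vm
      inv_injective := Sum.inl_injective
      inv_τ := fun k => rfl
      vmap_vert := fun k => rfl
      vmap_eq_iff := by
        intro v w
        constructor
        · intro hvw
          by_cases hvx : vm v = Γ.vert x
          · have hj : Δ.Joined (Set.range (Sum.inl : Γ.H → Γ.H ⊕ Bool))ᶜ
                (Δ.vert (Sum.inr false)) (Δ.vert (Sum.inr true)) :=
              ⟨Sum.inr false, by simp, rfl, by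
                show Δ.vert (τ' (Sum.inr false)) = _
                simp [τ']⟩
            rcases hover v hvx with rfl | rfl <;> rcases hover w (hvw ▸ hvx) with rfl | rfl
            · exact Relation.EqvGen.refl _
            · exact Relation.EqvGen.rel _ _ hj
            · exact Relation.EqvGen.symm _ _ (Relation.EqvGen.rel _ _ hj)
            · exact Relation.EqvGen.refl _
          · rw [hnot v w hvw hvx]
            exact Relation.EqvGen.refl _
        · intro h
          induction h with
          | rel v w h =>
            obtain ⟨a, ha, rfl, rfl⟩ := h
            rcases (hrange a).1 ha with rfl | rfl
            · show Γ.vert y = Γ.vert (expandCorner x y (τ' (Sum.inr false)))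
              simp [τ', expandCorner, hv]
            · show Γ.vert x = Γ.vert (expandCorner x y (τ' (Sum.inr true)))
              simp [τ', expandCorner, hv]
          | refl x => rfl
          | symm x y _ ih => exact ih.symm
          | trans x y z _ _ ih1 ih2 => exact ih1.trans ih2
      tree := by
        intro w
        by_cases hw : w = Γ.vert x
        · subst hw
          have e1 : {v : Δ.Vertex | vm v = Γ.vert x} =
              {Δ.vert (Sum.inr false), Δ.vert (Sum.inr true)} := by
            ext v
            constructor
            · exact fun h => hover v h
            · rintro (rfl | rfl)
              · exact hv.symm
              · rfl
          have e2 : {a : Γ.H ⊕ Bool | a ∉ Set.range (Sum.inl : Γ.H → Γ.H ⊕ Bool) ∧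
              vm (Δ.vert a) = Γ.vert x} = {Sum.inr false, Sum.inr true} := by
            ext a
            constructor
            · exact fun h => (hrange a).1 h.1
            · rintro (rfl | rfl)
              · exact ⟨by simp, hv.symm⟩
              · exact ⟨by simp, rfl⟩
          have c1 : Nat.card {v : Δ.Vertex // vm v = Γ.vert x} = 2 := by
            show Set.ncard {v : Δ.Vertex | vm v = Γ.vert x} = 2
            rw [e1, Set.ncard_pair hne01]
          have c2 : Nat.card {a : Γ.H ⊕ Bool // a ∉ Set.range (Sum.inl : Γ.H → Γ.H ⊕ Bool) ∧
              vm (Δ.vert a) = Γ.vert x} = 2 := by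
            show Set.ncard {a : Γ.H ⊕ Bool | a ∉ Set.range (Sum.inl : Γ.H → Γ.H ⊕ Bool) ∧
              vm (Δ.vert a) = Γ.vert x} = 2
            rw [e2, Set.ncard_pair (by simp)]
          rw [c1]
          exact congrArg (· + 2) c2.symm
        · have c1 : Nat.card {v : Δ.Vertex // vm v = w} = 1 := by
            obtain ⟨k, rfl⟩ := Γ.vert_surjective w
            rw [Nat.card_eq_one_iff_unique]
            exact ⟨⟨fun a b => Subtype.ext (hnot _ _ (a.2.trans b.2.symm) (fun e => hw (a.2.symm.trans e)))⟩,
              ⟨⟨Δ.vert (Sum.inl k), rfl⟩⟩⟩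
          have c2 : IsEmpty {a : Γ.H ⊕ Bool // a ∉ Set.range (Sum.inl : Γ.H → Γ.H ⊕ Bool) ∧
              vm (Δ.vert a) = w} := by
            refine ⟨?_⟩
            rintro ⟨a, ha, haw⟩
            rcases (hrange a).1 ha with rfl | rfl
            · exact hw (haw.symm.trans hv.symm)
            · exact hw haw.symm
          rw [c1]
          have c3 : Nat.card {a : Γ.H ⊕ Bool // a ∉ Set.range (Sum.inl : Γ.H → Γ.H ⊕ Bool) ∧
              vm (Δ.vert a) = w} = 0 := Nat.card_of_isEmpty
          exact congrArg (· + 2) c3.symm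
      cyclic := by
        intro k
        show Δ.Turn (Set.range (Sum.inl : Γ.H → Γ.H ⊕ Bool))ᶜ (σ' (Sum.inl k)) (Sum.inl (Γ.σ k))
        have hleaf : ∀ l : Γ.H, Δ.Turn (Set.range (Sum.inl : Γ.H → Γ.H ⊕ Bool))ᶜ
            (Sum.inl l : Γ.H ⊕ Bool) (Sum.inl l : Γ.H ⊕ Bool) :=
          fun l => Turn.leaf (Γ := Δ) _ (fun h => h ⟨l, rfl⟩)
        by_cases hx : Γ.σ k = x
        · rw [hσ', expandPerm_of_eq_left hxy hx]
          refine Turn.cross (Γ := Δ) _ _ (by simp) ?_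
          show Δ.Turn _ (σ' (τ' (Sum.inr true))) _
          have e : σ' (τ' (Sum.inr true)) = Sum.inl x := by
            simp [τ', hσ', expandPerm_false hxy]
          rw [e, hx]
          exact hleaf x
        by_cases hy : Γ.σ k = y
        · rw [hσ', expandPerm_of_eq_right hy]
          refine Turn.cross (Γ := Δ) _ _ (by simp) ?_
          show Δ.Turn _ (σ' (τ' (Sum.inr false))) _
          have e : σ' (τ' (Sum.inr false)) = Sum.inl y := by
            simp [τ', hσ', expandPerm_true]
          rw [e, hy]
          exact hleaf y
        rw [hσ', expandPerm_of_ne hx hy]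
        exact hleaf _ }
  refine ⟨Δ, f, (Sum.inr false : Γ.H ⊕ Bool), ?_⟩
  have hτ0 : τ' (Sum.inr false) = Sum.inr true := by simp [τ']
  constructor
  · intro a
    show a ∉ Set.range (Sum.inl : Γ.H → Γ.H ⊕ Bool) ↔ a = Sum.inr false ∨ a = τ' (Sum.inr false)
    rw [hτ0]
    exact hrange a
  · show Δ.vert (Sum.inr false) ≠ Δ.vert (τ' (Sum.inr false))
    rw [hτ0]
    exact hne01
  · exact expandPerm_false hxy
  · show σ' (τ' (Sum.inr false)) = Sum.inl y
    rw [hτ0]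
    exact expandPerm_true

/-! ### Presentations by lists of cycles and the corresponding frames -/

/-- The list `𝒬` consists of enumerations of the cycles of half-edges at the vertices of `Γ`. -/
structure Presents (Γ : RibbonGraph) (𝒬 : List (List Γ.H)) : Prop where
  cycle : ∀ Q ∈ 𝒬, IsCycleList Γ.σ Q
  nodup : 𝒬.flatten.Nodup
  mem : ∀ h, h ∈ 𝒬.flatten

/-- The vertex of the first half-edge of a list. -/
def vtx (Γ : RibbonGraph) (Q : List Γ.H) : Γ.Vertex := Γ.vert (Q.headD (Classical.arbitrary Γ.H))

theorem vtx_eq {Γ : RibbonGraph} {Q : List Γ.H} (hQ : IsCycleList Γ.σ Q) {q : Γ.H} (hq : q ∈ Q) :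
    Γ.vtx Q = Γ.vert q := by
  obtain ⟨a, T, rfl, hc⟩ := hQ
  exact vert_eq_iff.2 (IsCycleList.sameCycle ⟨a, T, rfl, hc⟩ (by simp) hq)

/-- The list formed by a vertex and its half-edges. -/
def block (Γ : RibbonGraph) (Q : List Γ.H) : List Γ.Cell := Sum.inl (Γ.vtx Q) :: Q.map Sum.inr

/-- The list of vertices, each followed by its half-edges. -/
def frame (Γ : RibbonGraph) (𝒬 : List (List Γ.H)) : List Γ.Cell := 𝒬.flatMap Γ.block

theorem frame_append (Γ : RibbonGraph) (𝒬 𝒬' : List (List Γ.H)) :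
    Γ.frame (𝒬 ++ 𝒬') = Γ.frame 𝒬 ++ Γ.frame 𝒬' := List.flatMap_append

theorem frame_cons (Γ : RibbonGraph) (Q : List Γ.H) (𝒬 : List (List Γ.H)) :
    Γ.frame (Q :: 𝒬) = Γ.block Q ++ Γ.frame 𝒬 := rfl

theorem length_block (Γ : RibbonGraph) (Q : List Γ.H) : (Γ.block Q).length = Q.length + 1 := by
  simp [block]

theorem length_frame (Γ : RibbonGraph) (𝒬 : List (List Γ.H)) :
    (Γ.frame 𝒬).length = (𝒬.map fun Q => Q.length + 1).sum := by
  simp [frame, List.length_flatMap, length_block]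

theorem mem_frame_inr {Γ : RibbonGraph} {𝒬 : List (List Γ.H)} {h : Γ.H} :
    (Sum.inr h : Γ.Cell) ∈ Γ.frame 𝒬 ↔ h ∈ 𝒬.flatten := by
  simp [frame, block]

theorem mem_frame_inl {Γ : RibbonGraph} {𝒬 : List (List Γ.H)} {v : Γ.Vertex} :
    (Sum.inl v : Γ.Cell) ∈ Γ.frame 𝒬 ↔ v ∈ 𝒬.map Γ.vtx := by
  simp [frame, block, eq_comm]

theorem nodup_map_vtx {Γ : RibbonGraph} {𝒬 : List (List Γ.H)}
    (hc : ∀ Q ∈ 𝒬, IsCycleList Γ.σ Q) (hn : 𝒬.flatten.Nodup) : (𝒬.map Γ.vtx).Nodup := by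
  induction 𝒬 with
  | nil => simp
  | cons Q 𝒬 ih =>
    rw [List.flatten_cons, List.nodup_append] at hn
    rw [List.map_cons, List.nodup_cons]
    refine ⟨?_, ih (fun Q hQ => hc Q (by simp [hQ])) hn.2.1⟩
    intro hmem
    obtain ⟨Q', hQ', hv⟩ := List.mem_map.1 hmem
    have h1 := hc Q (by simp)
    have h2 := hc Q' (by simp [hQ'])
    obtain ⟨a, ha⟩ := List.exists_mem_of_ne_nil _ h1.ne_nil
    obtain ⟨b, hb⟩ := List.exists_mem_of_ne_nil _ h2.ne_nil
    rw [vtx_eq h1 ha, vtx_eq h2 hb, vert_eq_iff] at hv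
    have := h2.mem_of_sameCycle hb hv
    exact hn.2.2 a ha a (List.mem_flatten.2 ⟨Q', hQ', this⟩) rfl

theorem frame_nodup {Γ : RibbonGraph} {𝒬 : List (List Γ.H)}
    (hc : ∀ Q ∈ 𝒬, IsCycleList Γ.σ Q) (hn : 𝒬.flatten.Nodup) : (Γ.frame 𝒬).Nodup := by
  have hv := nodup_map_vtx hc hn
  induction 𝒬 with
  | nil => simp [frame]
  | cons Q 𝒬 ih =>
    rw [List.flatten_cons, List.nodup_append] at hn
    rw [List.map_cons, List.nodup_cons] at hv
    rw [frame_cons, List.nodup_append]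
    refine ⟨?_, ih (fun Q hQ => hc Q (by simp [hQ])) hn.2.1 hv.2, ?_⟩
    · rw [block, List.nodup_cons]
      exact ⟨by simp, hn.1.map Sum.inr_injective⟩
    · rintro a ha b hb rfl
      rcases a with v | h
      · rw [mem_frame_inl] at hb
        simp only [block, List.mem_cons, Sum.inl.injEq, List.mem_map, reduceCtorEq, and_false,
          exists_false, or_false] at ha
        exact hv.1 (ha ▸ hb)
      · rw [mem_frame_inr] at hb
        simp only [block, List.mem_cons, reduceCtorEq, List.mem_map, Sum.inr.injEq,
          exists_eq_right, false_or] at ha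
        exact hn.2.2 h ha h hb rfl

namespace Presents

variable {Γ : RibbonGraph} {𝒬 : List (List Γ.H)}

theorem mem_map_vtx (P : Presents Γ 𝒬) (v : Γ.Vertex) : v ∈ 𝒬.map Γ.vtx := by
  obtain ⟨h, rfl⟩ := Γ.vert_surjective v
  obtain ⟨Q, hQ, hh⟩ := List.mem_flatten.1 (P.mem h)
  exact List.mem_map.2 ⟨Q, hQ, vtx_eq (P.cycle Q hQ) hh⟩

theorem frame_nodup (P : Presents Γ 𝒬) : (Γ.frame 𝒬).Nodup :=
  RibbonGraph.frame_nodup P.cycle P.nodup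

theorem mem_frame (P : Presents Γ 𝒬) (a : Γ.Cell) : a ∈ Γ.frame 𝒬 := by
  rcases a with v | h
  · exact mem_frame_inl.2 (P.mem_map_vtx v)
  · exact mem_frame_inr.2 (P.mem h)

theorem nodup_of_mem (P : Presents Γ 𝒬) {Q : List Γ.H} (hQ : Q ∈ 𝒬) : Q.Nodup :=
  (List.nodup_flatten.1 P.nodup).1 Q hQ

theorem univ_val (P : Presents Γ 𝒬) :
    (Finset.univ : Finset Γ.Vertex).val = (𝒬.map Γ.vtx : List Γ.Vertex) := by
  refine (Multiset.Nodup.ext Finset.univ.nodup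
    (Multiset.coe_nodup.2 (nodup_map_vtx P.cycle P.nodup))).2 fun v => ?_
  simp only [Finset.mem_val, Finset.mem_univ, Multiset.mem_coe, true_iff]
  exact P.mem_map_vtx v

theorem sum_vertex (P : Presents Γ 𝒬) {M : Type*} [AddCommMonoid M] (F : Γ.Vertex → M) :
    ∑ v : Γ.Vertex, F v = (𝒬.map fun Q => F (Γ.vtx Q)).sum := by
  rw [Finset.sum_eq_multiset_sum, P.univ_val]
  simp [Function.comp_def]

theorem valence_vtx (P : Presents Γ 𝒬) {Q : List Γ.H} (hQ : Q ∈ 𝒬) :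
    Γ.valence (Γ.vtx Q) = Q.length := by
  obtain ⟨a, ha⟩ := List.exists_mem_of_ne_nil _ (P.cycle Q hQ).ne_nil
  rw [vtx_eq (P.cycle Q hQ) ha, ← (P.cycle Q hQ).card_eq (P.nodup_of_mem hQ) ha]
  refine Nat.card_congr (Equiv.subtypeEquivRight fun k => ?_)
  rw [eq_comm, vert_eq_iff]

theorem map_valence (P : Presents Γ 𝒬) :
    (Finset.univ : Finset Γ.Vertex).val.map Γ.valence = (𝒬.map List.length : List ℕ) := by
  rw [P.univ_val, Multiset.map_coe, List.map_map]
  congr 1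
  exact List.map_congr_left fun Q hQ => P.valence_vtx hQ

theorem three_le_length (P : Presents Γ 𝒬) {Q : List Γ.H} (hQ : Q ∈ 𝒬) : 3 ≤ Q.length := by
  rw [← P.valence_vtx hQ]
  exact Γ.three_le_valence _

end Presents

theorem exists_presents (Γ : RibbonGraph) : ∃ 𝒬, Presents Γ 𝒬 := by
  choose Q h1 h2 h3 using exists_isCycleList Γ.σ
  have hmem : ∀ v : Γ.Vertex, ∀ h, h ∈ Q v.out ↔ Γ.vert h = v := by
    intro v h
    rw [(h1 _).mem_iff (h3 _), ← vert_eq_iff]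
    conv_rhs => rw [eq_comm, ← v.out_eq]
    rfl
  refine ⟨(Finset.univ : Finset Γ.Vertex).toList.map fun v => Q v.out, ?_, ?_, ?_⟩
  · intro P hP
    obtain ⟨v, -, rfl⟩ := List.mem_map.1 hP
    exact h1 _
  · rw [List.nodup_flatten]
    constructor
    · intro P hP
      obtain ⟨v, -, rfl⟩ := List.mem_map.1 hP
      exact h2 _
    · rw [List.pairwise_map]
      refine List.Pairwise.imp ?_ (Finset.nodup_toList _)
      intro v w hvw a ha hb
      exact hvw (((hmem v a).1 ha).symm.trans ((hmem w a).1 hb))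
  · intro h
    refine List.mem_flatten.2 ⟨Q (Γ.vert h).out, List.mem_map.2 ⟨_, by simp, rfl⟩, ?_⟩
    rw [hmem]

/-- Frames of presentations with odd cycles define the same orientation. -/
theorem sgnL_frame_eq {Γ : RibbonGraph} (ω : Γ.GraphOrientation) (𝒬 : List (List Γ.H)) :
    ∀ (𝒬' : List (List Γ.H)) (A : List Γ.Cell), (∀ Q ∈ 𝒬, IsCycleList Γ.σ Q) →
    (∀ Q ∈ 𝒬', IsCycleList Γ.σ Q) → (∀ Q ∈ 𝒬', Odd Q.length) →
    𝒬.flatten.Perm 𝒬'.flatten → 𝒬.flatten.Nodup →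
    ω.sgnL (A ++ Γ.frame 𝒬) = ω.sgnL (A ++ Γ.frame 𝒬') := by
  induction 𝒬 with
  | nil =>
    intro 𝒬' A _ hc' _ hp _
    rcases 𝒬' with _ | ⟨Q, 𝒬'⟩
    · rfl
    · have := hp.symm.eq_nil
      simp only [List.flatten_cons, List.append_eq_nil_iff] at this
      exact absurd this.1 (hc' Q (by simp)).ne_nil
  | cons Q 𝒬 ih =>
    intro 𝒬' A hc hc' ho hp hn
    have hQ := hc Q (by simp)
    obtain ⟨a, T, rfl, -⟩ := id hQ
    have ha0 : a ∈ ((a :: T) :: 𝒬).flatten := by simp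
    obtain ⟨Q', hQ', ha⟩ := List.mem_flatten.1 (hp.subset ha0)
    obtain ⟨B, D, rfl⟩ := List.append_of_mem hQ'
    have hcQ' := hc' Q' hQ'
    have hoQ' := ho Q' hQ'
    have hn' := (hp.nodup_iff.1 hn)
    have hnQ' : Q'.Nodup := (List.nodup_flatten.1 hn').1 Q' hQ'
    obtain ⟨B', D', rfl⟩ := List.append_of_mem ha
    have hrot := hcQ'.rotate
    have hpr : (B' ++ a :: D').Perm (a :: D' ++ B') := List.perm_append_comm
    have hT : T = D' ++ B' := by
      refine hQ.eq_of_head hrot ?_ (hpr.nodup_iff.1 hnQ')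
      exact (List.nodup_flatten.1 hn).1 _ (by simp)
    have hv : Γ.vtx (B' ++ a :: D') = Γ.vtx (a :: T) := by
      rw [vtx_eq hcQ' ha, vtx_eq hQ (List.mem_cons_self)]
    -- The block of an odd cycle, vertex included, has even length, so it moves to the front without
    -- a sign.
    have step1 : ω.sgnL (A ++ Γ.frame (B ++ (B' ++ a :: D') :: D)) =
        ω.sgnL (A ++ Γ.block (B' ++ a :: D') ++ Γ.frame (B ++ D)) := by
      have := ω.sgnL_move (Γ.block (B' ++ a :: D')) A (Γ.frame B) (Γ.frame D)
      rw [frame_append, frame_cons, frame_append]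
      simp only [List.append_assoc] at this ⊢
      rw [this, Even.neg_one_pow, one_mul]
      rw [length_block]
      exact (hoQ'.add_odd odd_one).mul_left _
    -- Rotating an odd cycle is an even permutation: the two pieces exchanged have lengths of
    -- opposite parity.
    have step2 : ω.sgnL (A ++ Γ.block (B' ++ a :: D') ++ Γ.frame (B ++ D)) =
        ω.sgnL (A ++ Γ.block (a :: T) ++ Γ.frame (B ++ D)) := by
      have := ω.sgnL_move ((a :: D').map Sum.inr) (A ++ [Sum.inl (Γ.vtx (a :: T))])
        (B'.map Sum.inr) (Γ.frame (B ++ D))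
      rw [block, block, hv]
      have hT' : T.map (Sum.inr : Γ.H → Γ.Cell) = D'.map Sum.inr ++ B'.map Sum.inr := by
        rw [hT, List.map_append]
      simp only [List.append_assoc, List.map_append, List.cons_append, List.nil_append,
        List.map_cons, hT'] at this ⊢
      rw [this, Even.neg_one_pow, one_mul]
      simp only [List.length_append, List.length_cons, List.length_map] at hoQ' ⊢
      rw [Nat.even_mul]
      by_contra hcon
      push Not at hcon
      rw [Nat.not_even_iff_odd, Nat.not_even_iff_odd] at hcon
      exact (Nat.not_even_iff_odd.2 hoQ') (hcon.1.add_odd hcon.2)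
    rw [step1, step2, frame_cons, ← List.append_assoc]
    refine ih (B ++ D) _ (fun Q hQ => hc Q (by simp [hQ])) (fun Q hQ => hc' Q ?_)
      (fun Q hQ => ho Q ?_) ?_ ?_
    · simp only [List.mem_append, List.mem_cons] at hQ ⊢; tauto
    · simp only [List.mem_append, List.mem_cons] at hQ ⊢; tauto
    · have e1 : (((a :: T) :: 𝒬).flatten).Perm ((a :: T) ++ (B ++ D).flatten) := by
        refine hp.trans ?_
        rw [List.flatten_append, List.flatten_cons, List.flatten_append]
        refine (List.perm_append_comm_assoc _ _ _).trans (List.Perm.append_right _ ?_)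
        rw [hT]
        exact hpr
      rw [List.flatten_cons] at e1
      exact (List.perm_append_left_iff _).1 e1
    · rw [List.flatten_cons, List.nodup_append] at hn
      exact hn.2.1

/-- Naturality quantifies over all enumerations vertex by vertex. With odd cycles they all carry the
same sign by `sgnL_frame_eq`, so one frame decides. -/
theorem Presents.isNatural_iff {Γ : RibbonGraph} {𝒬 : List (List Γ.H)} (P : Presents Γ 𝒬)
    (ho : ∀ Q ∈ 𝒬, Odd Q.length) (ω : Γ.GraphOrientation) :
    IsNatural ω ↔ ω.sgnL (Γ.frame 𝒬) = 1 := by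
  have hval : ∀ h, Γ.valence (Γ.vert h) = Nat.card {k : Γ.H // Γ.σ.SameCycle h k} := by
    intro h
    refine Nat.card_congr (Equiv.subtypeEquivRight fun k => ?_)
    rw [eq_comm, vert_eq_iff]
  have hcyc : ∀ h, IsCycleList Γ.σ
      ((List.range (Γ.valence (Γ.vert h))).map fun j => (Γ.σ ^ j) h) ∧
      ((List.range (Γ.valence (Γ.vert h))).map fun j => (Γ.σ ^ j) h).Nodup := by
    intro h
    rw [hval]
    exact isCycleList_range Γ.σ h
  have hpos : ∀ h, 0 < Γ.valence (Γ.vert h) := fun h =>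
    lt_of_lt_of_le (by norm_num) (Γ.three_le_valence _)
  have hmem : ∀ h, h ∈ (List.range (Γ.valence (Γ.vert h))).map fun j => (Γ.σ ^ j) h := fun h =>
    List.mem_map.2 ⟨0, List.mem_range.2 (hpos h), rfl⟩
  have hframe : ∀ hs : List Γ.H, hs.flatMap (fun h => (Sum.inl (Γ.vert h) : Γ.Cell) ::
      (List.range (Γ.valence (Γ.vert h))).map (fun j => Sum.inr ((Γ.σ ^ j) h))) =
      Γ.frame (hs.map fun h => (List.range (Γ.valence (Γ.vert h))).map fun j => (Γ.σ ^ j) h) := by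
    intro hs
    rw [frame, List.flatMap_map]
    congr 1
    funext h
    rw [block, vtx_eq (hcyc h).1 (hmem h), List.map_map]
    rfl
  constructor
  · intro hω
    obtain ⟨e, he⟩ := SetOrientation.exists_ofFn_eq P.frame_nodup P.mem_frame
    rw [SetOrientation.sgnL_eq_of_ofFn he, hω _ e (𝒬.map fun Q => Q.headD (Classical.arbitrary _))]
    · rfl
    rw [he, hframe, List.map_map]
    congr 1
    conv_lhs => rw [← List.map_id 𝒬]
    refine List.map_congr_left fun Q hQ => ?_
    obtain ⟨a, T, rfl, -⟩ := id (P.cycle Q hQ)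
    show a :: T = (List.range (Γ.valence (Γ.vert a))).map fun j => (Γ.σ ^ j) a
    have h1 := hcyc a
    obtain ⟨n, hn⟩ : ∃ n, Γ.valence (Γ.vert a) = n + 1 := ⟨_, (Nat.succ_pred_eq_of_pos (hpos a)).symm⟩
    rw [hn, List.range_succ_eq_map, List.map_cons] at h1 ⊢
    have : T = _ := (P.cycle _ hQ).eq_of_head (a := a) h1.1 (P.nodup_of_mem hQ) h1.2
    rw [this]
    rfl
  · intro hω N e hs he
    rw [hframe] at he
    have hL := SetOrientation.nodup_of_ofFn he
    apply Units.ext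
    rw [← SetOrientation.sgnL_eq_of_ofFn he, Units.val_one, ← hω]
    set 𝒬' := hs.map fun h => (List.range (Γ.valence (Γ.vert h))).map fun j => (Γ.σ ^ j) h with h𝒬'
    have hc' : ∀ Q ∈ 𝒬', IsCycleList Γ.σ Q := by
      intro Q hQ
      obtain ⟨h, -, rfl⟩ := List.mem_map.1 hQ
      exact (hcyc h).1
    have hn' : 𝒬'.flatten.Nodup := by
      have hsub : (𝒬'.flatten.map (Sum.inr : Γ.H → Γ.Cell)).Sublist (Γ.frame 𝒬') := by
        clear_value 𝒬'
        clear hω he hL hc' h𝒬'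
        induction 𝒬' with
        | nil => simp [frame]
        | cons Q 𝒬' ih =>
          rw [List.flatten_cons, List.map_append, frame_cons, block]
          exact (List.Sublist.append (List.sublist_cons_self _ _) ih)
      exact (hL.1.sublist hsub).of_map
    have hm' : ∀ h, h ∈ 𝒬'.flatten := fun h => mem_frame_inr.1 (hL.2 (Sum.inr h))
    have := sgnL_frame_eq ω 𝒬' 𝒬 [] hc' P.cycle ho
      ((List.perm_ext_iff_of_nodup hn' P.nodup).2 fun h => by simp [hm' h, P.mem h]) hn'
    simpa using this

theorem Presents.map_iso {Γ Γ' : RibbonGraph} {𝒬 : List (List Γ.H)} (P : Presents Γ 𝒬)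
    (φ : Γ ≅ Γ') : Presents Γ' (𝒬.map (List.map (isoEquiv φ))) where
  cycle Q hQ := by
    obtain ⟨Q', hQ', rfl⟩ := List.mem_map.1 hQ
    exact (P.cycle Q' hQ').map_of_semiconj fun a _ => isoEquiv_σ φ a
  nodup := by
    rw [← List.map_flatten]
    exact P.nodup.map (isoEquiv φ).injective
  mem h := by
    rw [← List.map_flatten]
    exact List.mem_map.2 ⟨_, P.mem ((isoEquiv φ).symm h), by simp⟩

theorem Presents.frame_map_iso {Γ Γ' : RibbonGraph} {𝒬 : List (List Γ.H)} (P : Presents Γ 𝒬)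
    (φ : Γ ≅ Γ') :
    Γ'.frame (𝒬.map (List.map (isoEquiv φ))) = (Γ.frame 𝒬).map (cellEquiv φ) := by
  rw [frame, frame, List.flatMap_map, List.map_flatMap]
  refine List.flatMap_congr fun Q hQ => ?_
  obtain ⟨a, ha⟩ := List.exists_mem_of_ne_nil _ (P.cycle Q hQ).ne_nil
  have h1 : IsCycleList Γ'.σ (Q.map (isoEquiv φ)) :=
    (P.map_iso φ).cycle _ (List.mem_map.2 ⟨Q, hQ, rfl⟩)
  rw [block, block, vtx_eq (P.cycle Q hQ) ha, vtx_eq h1 (List.mem_map.2 ⟨a, ha, rfl⟩),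
    vert_isoEquiv, List.map_cons, List.map_map, List.map_map]
  rfl

theorem Presents.sgnL_map_iso {Γ Γ' : RibbonGraph} {𝒬 : List (List Γ.H)} (P : Presents Γ 𝒬)
    (φ : Γ ≅ Γ') (ω : Γ.GraphOrientation) :
    SetOrientation.sgnL (ω.map (cellEquiv φ)) (Γ'.frame (𝒬.map (List.map (isoEquiv φ)))) =
      ω.sgnL (Γ.frame 𝒬) := by
  rw [P.frame_map_iso φ, SetOrientation.sgnL_map]

/-! ### Orientations induced by collapsing one edge -/

/-- The sign relating the frames before and after expanding a vertex: `p` is the number of cells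
before the vertex in question, `i` and `d` are the numbers of half-edges before the cut-off part and
in this part. -/
def stepSign (p i d : ℕ) : ℤ := (-1) ^ (1 + p + i * d + i)

theorem exists_ofFn_eq' {S : Type} {L : List S} {N : ℕ} (hN : L.length = N) (hn : L.Nodup)
    (hL : ∀ s, s ∈ L) : ∃ e : Fin N ≃ S, List.ofFn e = L := by
  subst hN
  exact SetOrientation.exists_ofFn_eq hn hL

namespace OneEdge

variable {Γ Γ' : RibbonGraph} {f : Γ ⟶ Γ'} {h : Γ.H} {x y : Γ'.H}

/-- The map on cells given by collapsing one edge. -/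
def low (H : OneEdge f h x y) : Γ.Cell → Γ'.Cell := Sum.map (Hom.vmap f) H.corner

theorem low_inl (H : OneEdge f h x y) (v : Γ.Vertex) :
    H.low (Sum.inl v) = Sum.inl (Hom.vmap f v) := rfl

theorem low_inr_inv (H : OneEdge f h x y) (k : Γ'.H) :
    H.low (Sum.inr (Hom.inv f k)) = Sum.inr k := congrArg Sum.inr (H.corner_inv k)

/-- The cells which are collapsed to one vertex. -/
def pre (Γ : RibbonGraph) (h : Γ.H) : List Γ.Cell :=
  [Sum.inl (Γ.vert h), Sum.inl (Γ.vert (Γ.τ h)), Sum.inr h, Sum.inr (Γ.τ h)]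

/-- Renaming the halves of the edge is a product of two transpositions, one of the end vertices and
one of the halves. -/
theorem sgnL_pre_τ (ω : Γ.GraphOrientation) (h : Γ.H) (T : List Γ.Cell) :
    ω.sgnL (pre Γ (Γ.τ h) ++ T) = ω.sgnL (pre Γ h ++ T) := by
  simp only [pre, Γ.τ_τ, List.cons_append, List.nil_append]
  have h1 := ω.sgnL_swap [] (Sum.inr (Γ.τ h) :: Sum.inr h :: T) (Sum.inl (Γ.vert (Γ.τ h)))
    (Sum.inl (Γ.vert h))
  have h2 := ω.sgnL_swap [Sum.inl (Γ.vert h), Sum.inl (Γ.vert (Γ.τ h))] T (Sum.inr (Γ.τ h))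
    (Sum.inr h)
  simp only [List.cons_append, List.nil_append] at h1 h2
  rw [h1, h2, neg_neg]

/-- Any enumeration which witnesses `Induces` may be replaced by a chosen one: permuting the tail
changes the signs upstairs and downstairs equally (`sgnL_mul_sgnL_perm`), and the choice of half is
immaterial by `sgnL_pre_τ`. -/
theorem induces_iff (H : OneEdge f h x y) {ω : Γ.GraphOrientation} {ω' : Γ'.GraphOrientation}
    {T : List Γ.Cell} (hn : (pre Γ h ++ T).Nodup) (hm : ∀ a, a ∈ pre Γ h ++ T)
    (hn' : (Sum.inl (Γ'.vert x) :: T.map H.low).Nodup)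
    (hm' : ∀ a, a ∈ Sum.inl (Γ'.vert x) :: T.map H.low) :
    Induces f ω ω' ↔ ω.sgnL (pre Γ h ++ T) = ω'.sgnL (Sum.inl (Γ'.vert x) :: T.map H.low) := by
  constructor
  · rintro ⟨N, e, e', h0, e0, e1, e2, e3, e0', htail, hs⟩
    set T0 : List Γ.Cell := List.ofFn fun i : Fin N => e (Fin.natAdd 4 i) with hT0
    have he : List.ofFn e = pre Γ h0 ++ T0 := by
      rw [List.ofFn_add]
      congr 1
      simp only [pre, ← e0, ← e1, ← e2, ← e3]
      rfl
    have he' : List.ofFn e' = Sum.inl (Hom.vmap f (Γ.vert h0)) :: T0.map H.low := by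
      rw [List.ofFn_add]
      have : List.ofFn (fun i : Fin N => e' (Fin.natAdd 1 i)) = T0.map H.low := by
        rw [hT0, List.map_ofFn]
        congr 1
        funext i
        rcases htail i with ⟨v, h1, h2⟩ | ⟨k, h1, h2⟩
        · rw [h2, Function.comp_apply, h1, low_inl]
        · rw [h2, Function.comp_apply, h1, low_inr_inv]
      rw [this, ← e0']
      rfl
    have hfull := SetOrientation.nodup_of_ofFn he
    have hh0 : h0 = h ∨ h0 = Γ.τ h := by
      have := hfull.2 (Sum.inr h)
      rw [List.mem_append] at this
      rcases this with h1 | h1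
      · simp only [pre, List.mem_cons, reduceCtorEq, Sum.inr.injEq, List.not_mem_nil, or_false,
          false_or] at h1
        rcases h1 with h1 | h1
        · exact Or.inl h1.symm
        · right; rw [h1, Γ.τ_τ]
      · rw [hT0, List.mem_ofFn] at h1
        obtain ⟨i, hi⟩ := h1
        rcases htail i with ⟨v, h2, -⟩ | ⟨k, h2, -⟩
        · rw [h2] at hi; cases hi
        · rw [h2] at hi
          exact absurd (Sum.inr_injective hi) (H.inv_ne k)
    have hv : Hom.vmap f (Γ.vert h0) = Γ'.vert x := by
      rcases hh0 with rfl | rfl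
      · exact H.vmap_h
      · rw [H.symm.vmap_h, H.vert_eq]
    have h1 : ω.sgnL (pre Γ h ++ T0) = ω'.sgnL ([Sum.inl (Γ'.vert x)] ++ T0.map H.low) := by
      have h2 := SetOrientation.sgnL_eq_of_ofFn (ω := ω) he
      have h3 := SetOrientation.sgnL_eq_of_ofFn (ω := ω') he'
      rw [hv] at h3
      have h4 : ω.sgnL (pre Γ h0 ++ T0) = ω.sgnL (pre Γ h ++ T0) := by
        rcases hh0 with rfl | rfl
        · rfl
        · exact sgnL_pre_τ ω h T0
      rw [← h4, h2, hs]
      exact h3.symm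
    have hp : T0.Perm T := by
      have h2 : (pre Γ h0 ++ T0).Perm (pre Γ h ++ T) :=
        (List.perm_ext_iff_of_nodup hfull.1 hn).2 fun a => by simp only [hfull.2 a, hm a]
      have h3 : (pre Γ h0).Perm (pre Γ h) := by
        rcases hh0 with rfl | rfl
        · exact List.Perm.refl _
        · simp only [pre, Γ.τ_τ]
          exact (List.Perm.swap _ _ _).trans ((List.Perm.swap _ _ _).cons _ |>.cons _)
      exact (List.perm_append_left_iff _).1 ((h3.symm.append_right _).trans h2)
    exact SetOrientation.sgnL_mul_sgnL_perm ω ω' H.low hp _ _ h1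
  · intro hs
    obtain ⟨e, he⟩ := exists_ofFn_eq' (N := 4 + T.length) (by simp [pre]; omega) hn hm
    obtain ⟨e', he'⟩ := exists_ofFn_eq' (N := 1 + T.length) (by simp; omega) hn' hm'
    have hget : ∀ (i : ℕ) (hi : i < 4 + T.length),
        e ⟨i, hi⟩ = (pre Γ h ++ T)[i]'(by simp [pre]; omega) := by
      intro i hi
      have h1 : (List.ofFn e)[i]'(by rw [List.length_ofFn]; exact hi) =
          (pre Γ h ++ T)[i]'(by simp [pre]; omega) := by simp only [he]
      rwa [List.getElem_ofFn] at h1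
    have hget' : ∀ (i : ℕ) (hi : i < 1 + T.length),
        e' ⟨i, hi⟩ = (Sum.inl (Γ'.vert x) :: T.map H.low)[i]'(by simp; omega) := by
      intro i hi
      have h1 : (List.ofFn e')[i]'(by rw [List.length_ofFn]; exact hi) =
          (Sum.inl (Γ'.vert x) :: T.map H.low)[i]'(by simp; omega) := by simp only [he']
      rwa [List.getElem_ofFn] at h1
    refine ⟨T.length, e, e', h, hget 0 (by omega), hget 1 (by omega), hget 2 (by omega),
      hget 3 (by omega), ?_, ?_, ?_⟩
    · rw [H.vmap_h]
      exact hget' 0 (by omega)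
    · intro i
      have h1 : e (Fin.natAdd 4 i) = T[i] := by
        have := hget (4 + i) (by omega)
        refine Eq.trans this ?_
        rw [List.getElem_append_right (by simp [pre])]
        simp [pre]
      have h2 : e' (Fin.natAdd 1 i) = H.low T[i] := by
        have := hget' (1 + i) (by omega)
        refine Eq.trans this ?_
        simp [add_comm 1 i.1]
      rcases hTi : T[i] with v | a
      · exact Or.inl ⟨v, h1.trans hTi, by rw [h2, hTi, low_inl]⟩
      · rcases H.cases a with ⟨k, rfl⟩ | ha
        · exact Or.inr ⟨k, h1.trans hTi, by rw [h2, hTi, low_inr_inv]⟩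
        · have hmem : (Sum.inr a : Γ.Cell) ∈ T := hTi ▸ List.getElem_mem _
          have := (List.nodup_append.1 hn).2.2 (Sum.inr a) (by
            simp only [pre, List.mem_cons, reduceCtorEq, Sum.inr.injEq, List.not_mem_nil, or_false,
              false_or]
            exact ha) _ hmem
          exact absurd rfl this
    · rw [SetOrientation.sgnL_eq_of_ofFn he, SetOrientation.sgnL_eq_of_ofFn he'] at hs
      exact Units.ext hs

variable {𝒬₁ 𝒬₂ : List (List Γ'.H)} {u s t : List Γ'.H}

/-- The presentation of the expanded graph. -/
def lift (f : Γ ⟶ Γ') (h : Γ.H) (x y : Γ'.H) (𝒬₁ 𝒬₂ : List (List Γ'.H)) (u s t : List Γ'.H) :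
    List (List Γ.H) :=
  𝒬₁.map (List.map (Hom.inv f)) ++ (h :: (x :: s).map (Hom.inv f)) ::
    (u.map (Hom.inv f) ++ Γ.τ h :: (y :: t).map (Hom.inv f)) :: 𝒬₂.map (List.map (Hom.inv f))

theorem isCycleList_inv (H : OneEdge f h x y) {Q : List Γ'.H} (hQ : IsCycleList Γ'.σ Q)
    (hx : x ∉ Q) (hy : y ∉ Q) : IsCycleList Γ.σ (Q.map (Hom.inv f)) :=
  hQ.map_of_semiconj fun _ ha => (H.σ_inv
    (fun e => hx (e ▸ hQ.σ_mem ha)) (fun e => hy (e ▸ hQ.σ_mem ha))).symm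

/-- The cycles come from `IsCycleList.cut` and `IsCycleList.cut'`. The second one is rotated so that
`u` stays in front, which fits the order of `cutSnd`. -/
theorem presents_lift (H : OneEdge f h x y)
    (P : Presents Γ' (𝒬₁ ++ (u ++ x :: (s ++ y :: t)) :: 𝒬₂)) :
    Presents Γ (lift f h x y 𝒬₁ 𝒬₂ u s t) := by
  have hQ := P.cycle (u ++ x :: (s ++ y :: t)) (by simp)
  have hQn := P.nodup_of_mem (Q := u ++ x :: (s ++ y :: t)) (by simp)
  have hperm : (lift f h x y 𝒬₁ 𝒬₂ u s t).flatten.Perm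
      (h :: Γ.τ h :: (𝒬₁ ++ (u ++ x :: (s ++ y :: t)) :: 𝒬₂).flatten.map (Hom.inv f)) := by
    classical
    rw [List.perm_iff_count]
    intro a
    simp only [lift, List.flatten_append, List.flatten_cons, List.map_append, List.map_cons,
      List.count_append, List.count_cons, ← List.map_flatten, List.append_assoc]
    omega
  have hdisj : ∀ Q, Q ∈ 𝒬₁ ∨ Q ∈ 𝒬₂ → x ∉ Q ∧ y ∉ Q := by
    have hn := P.nodup
    rw [List.nodup_flatten] at hn
    have hp := hn.2
    rw [List.pairwise_append] at hp
    rintro Q (hQ | hQ)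
    · have := hp.2.2 Q hQ _ (List.mem_cons_self)
      exact ⟨fun hx => this hx (by simp), fun hy => this hy (by simp)⟩
    · have := (List.pairwise_cons.1 hp.2.1).1 Q hQ
      exact ⟨fun hx => this (by simp) hx, fun hy => this (by simp) hy⟩
  refine ⟨?_, ?_, ?_⟩
  · intro Q' hQ'
    simp only [lift, List.mem_append, List.mem_cons, List.mem_map] at hQ'
    rcases hQ' with ⟨Q, hQ, rfl⟩ | rfl | rfl | ⟨Q, hQ, rfl⟩
    · have := hdisj Q (Or.inl hQ)
      exact H.isCycleList_inv (P.cycle Q (by simp [hQ])) this.1 this.2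
    · exact hQ.cut hQn H.σ_h (fun k hk => (H.σ_inv_eq_h_iff k).2 hk)
        (fun k hx hy => H.σ_inv hx hy)
    · have := hQ.cut' hQn H.σ_τ_h (fun k hk => (H.σ_inv_eq_τ_h_iff k).2 hk)
        (fun k hy hx => H.σ_inv hx hy)
      have e : Γ.τ h :: (y :: (t ++ u)).map (Hom.inv f) =
        (Γ.τ h :: (y :: t).map (Hom.inv f)) ++ u.map (Hom.inv f) := by simp
      rw [e] at this
      exact this.rotate
    · have := hdisj Q (Or.inr hQ)
      exact H.isCycleList_inv (P.cycle Q (by simp [hQ])) this.1 this.2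
  · rw [hperm.nodup_iff, List.nodup_cons, List.nodup_cons]
    refine ⟨?_, ?_, P.nodup.map (Hom.inv_injective f)⟩
    · simp only [List.mem_cons, List.mem_map, not_or, not_exists, not_and]
      exact ⟨(Γ.τ_ne h).symm, fun k _ => H.inv_ne k⟩
    · simp only [List.mem_map, not_exists, not_and]
      exact fun k _ => H.symm.inv_ne k
  · intro a
    rw [hperm.mem_iff]
    rcases H.cases a with ⟨k, rfl⟩ | rfl | rfl
    · simp only [List.mem_cons]
      exact Or.inr (Or.inr (List.mem_map.2 ⟨k, P.mem k, rfl⟩))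
    · simp
    · simp

theorem frame_map_low (H : OneEdge f h x y) {𝒬 : List (List Γ'.H)}
    (hc : ∀ Q ∈ 𝒬, IsCycleList Γ'.σ Q) (hc' : ∀ Q ∈ 𝒬, IsCycleList Γ.σ (Q.map (Hom.inv f))) :
    (Γ.frame (𝒬.map (List.map (Hom.inv f)))).map H.low = Γ'.frame 𝒬 := by
  rw [frame, frame, List.flatMap_map, List.map_flatMap]
  refine List.flatMap_congr fun Q hQ => ?_
  obtain ⟨a, ha⟩ := List.exists_mem_of_ne_nil _ (hc Q hQ).ne_nil
  rw [block, block, vtx_eq (hc Q hQ) ha, vtx_eq (hc' Q hQ) (List.mem_map.2 ⟨a, ha, rfl⟩),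
    List.map_cons, low_inl, Hom.vmap_vert, List.map_map, List.map_map]
  congr 1
  refine List.map_congr_left fun k _ => ?_
  exact H.low_inr_inv k

/-- The cells other than those of the collapsed edge, in the order of the presentation. -/
theorem sgnL_frame_lift (H : OneEdge f h x y)
    (P : Presents Γ' (𝒬₁ ++ (u ++ x :: (s ++ y :: t)) :: 𝒬₂)) {ω : Γ.GraphOrientation}
    {ω' : Γ'.GraphOrientation} :
    Induces f ω ω' ↔
    ω.sgnL (Γ.frame (lift f h x y 𝒬₁ 𝒬₂ u s t)) =
      stepSign (Γ'.frame 𝒬₁).length u.length (s.length + 1) *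
        ω'.sgnL (Γ'.frame (𝒬₁ ++ (u ++ x :: (s ++ y :: t)) :: 𝒬₂)) := by
  have P' := H.presents_lift P
  have hQ := P.cycle (u ++ x :: (s ++ y :: t)) (by simp)
  have hQ0 := P'.cycle (h :: (x :: s).map (Hom.inv f)) (by simp [lift])
  have hQ1 := P'.cycle (u.map (Hom.inv f) ++ Γ.τ h :: (y :: t).map (Hom.inv f)) (by simp [lift])
  let i : List Γ'.H → List Γ.Cell := fun l => (l.map (Hom.inv f)).map Sum.inr
  set A := Γ.frame (𝒬₁.map (List.map (Hom.inv f))) with hA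
  set R := Γ.frame (𝒬₂.map (List.map (Hom.inv f))) with hR
  set T : List Γ.Cell := A ++ i u ++ i (x :: s) ++ i (y :: t) ++ R with hT
  have hil : ∀ l : List Γ'.H, (i l).map H.low = l.map Sum.inr := by
    intro l
    simp only [i, List.map_map]
    exact List.map_congr_left fun k _ => H.low_inr_inv k
  have hlA : A.map H.low = Γ'.frame 𝒬₁ := H.frame_map_low
    (fun Q hQ => P.cycle Q (by simp [hQ])) (fun Q hQ => P'.cycle _ (by
      simp only [lift, List.mem_append, List.mem_map]; exact Or.inl ⟨Q, hQ, rfl⟩))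
  have hlR : R.map H.low = Γ'.frame 𝒬₂ := H.frame_map_low
    (fun Q hQ => P.cycle Q (by simp [hQ])) (fun Q hQ => P'.cycle _ (by
      simp only [lift, List.mem_append, List.mem_cons, List.mem_map]
      exact Or.inr (Or.inr (Or.inr ⟨Q, hQ, rfl⟩))))
  have hlT : T.map H.low = Γ'.frame 𝒬₁ ++ u.map Sum.inr ++ (x :: s).map Sum.inr ++
      (y :: t).map Sum.inr ++ Γ'.frame 𝒬₂ := by
    rw [hT, List.map_append, List.map_append, List.map_append, List.map_append, hlA, hlR, hil, hil,
      hil]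
  have hlift : Γ.frame (lift f h x y 𝒬₁ 𝒬₂ u s t) =
      A ++ (Sum.inl (Γ.vert h) :: Sum.inr h :: i (x :: s)) ++
        (Sum.inl (Γ.vert (Γ.τ h)) :: (i u ++ Sum.inr (Γ.τ h) :: i (y :: t))) ++ R := by
    rw [lift, frame_append, frame_cons, frame_cons, block, block, vtx_eq hQ0 (q := h) (by simp),
      vtx_eq hQ1 (q := Γ.τ h) (by simp)]
    simp [i, hA, hR]
  have hbase : Γ'.frame (𝒬₁ ++ (u ++ x :: (s ++ y :: t)) :: 𝒬₂) =
      Γ'.frame 𝒬₁ ++ (Sum.inl (Γ'.vert x) :: (u.map Sum.inr ++ (x :: s).map Sum.inr ++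
        (y :: t).map Sum.inr)) ++ Γ'.frame 𝒬₂ := by
    rw [frame_append, frame_cons, block, vtx_eq hQ (q := x) (by simp)]
    simp
  -- Sources of the exponent: `pre` has four cells and passes `A` freely; exchanging the second
  -- vertex with `h` gives 1; moving `x :: s` past `u` and two further cells gives the product of
  -- the lengths modulo 2; moving `u` past `τ h` gives its length.
  have hsign : ∀ ω : Γ.GraphOrientation, ω.sgnL (pre Γ h ++ T) =
      (-1) ^ (1 + u.length * (s.length + 1) + u.length) *
        ω.sgnL (Γ.frame (lift f h x y 𝒬₁ 𝒬₂ u s t)) := by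
    intro ω
    have m1 := ω.sgnL_move A [] (pre Γ h) (i u ++ i (x :: s) ++ i (y :: t) ++ R)
    have m2 := ω.sgnL_swap (A ++ [Sum.inl (Γ.vert h)])
      (Sum.inr (Γ.τ h) :: (i u ++ i (x :: s) ++ i (y :: t) ++ R)) (Sum.inl (Γ.vert (Γ.τ h)))
      (Sum.inr h)
    have m3 := ω.sgnL_move (i (x :: s)) (A ++ [Sum.inl (Γ.vert h), Sum.inr h])
      ([Sum.inl (Γ.vert (Γ.τ h)), Sum.inr (Γ.τ h)] ++ i u) (i (y :: t) ++ R)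
    have m4 := ω.sgnL_move (i u) (A ++ [Sum.inl (Γ.vert h), Sum.inr h] ++ i (x :: s) ++
      [Sum.inl (Γ.vert (Γ.τ h))]) [Sum.inr (Γ.τ h)] (i (y :: t) ++ R)
    rw [hlift, hT]
    simp only [pre, List.append_assoc, List.cons_append, List.nil_append] at m1 m2 m3 m4 ⊢
    rw [m1, m2, m3, m4]
    have l1 : (i u).length = u.length := by simp [i]
    have l2 : (i (x :: s)).length = s.length + 1 := by simp [i]
    simp only [List.length_cons, List.length_nil, l1, l2]
    have e1 : ((-1 : ℤ)) ^ ((0 + 1 + 1 + 1 + 1) * A.length) = 1 :=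
      Even.neg_one_pow ⟨2 * A.length, by ring⟩
    have e2 : ((-1 : ℤ)) ^ ((u.length + 1 + 1) * (s.length + 1)) =
        (-1) ^ (u.length * (s.length + 1)) := by
      have : (u.length + 1 + 1) * (s.length + 1) =
        u.length * (s.length + 1) + 2 * (s.length + 1) := by ring
      rw [this, pow_add, pow_mul (-1 : ℤ) 2]; simp
    rw [e1, e2, pow_add, pow_add]
    simp only [zero_add, one_mul, pow_one]
    ring
  have hsign' : ω'.sgnL (Γ'.frame (𝒬₁ ++ (u ++ x :: (s ++ y :: t)) :: 𝒬₂)) =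
      (-1) ^ (Γ'.frame 𝒬₁).length * ω'.sgnL (Sum.inl (Γ'.vert x) :: T.map H.low) := by
    rw [hbase, hlT]
    have := ω'.sgnL_move_one (Γ'.frame 𝒬₁) [] (u.map Sum.inr ++ (x :: s).map Sum.inr ++
        (y :: t).map Sum.inr ++ Γ'.frame 𝒬₂) (Sum.inl (Γ'.vert x))
    simp only [List.append_assoc, List.cons_append, List.nil_append] at this ⊢
    rw [this]
  have hsq : ∀ n : ℕ, ((-1 : ℤ)) ^ n * (-1) ^ n = 1 := fun n => by
    rw [← mul_pow]; simp
  -- `sgnL` vanishes on lists which are not enumerations, so completeness of this list follows from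
  -- the sign identity instead of a count.
  have hfull : (pre Γ h ++ T).Nodup ∧ ∀ a, a ∈ pre Γ h ++ T := by
    by_contra hcon
    have h1 := hsign ω
    rw [SetOrientation.sgnL_of_not hcon] at h1
    have h2 := ω.sgnL_mul_self P'.frame_nodup P'.mem_frame
    rcases mul_eq_zero.1 h1.symm with h3 | h3
    · exact absurd h3 (pow_ne_zero _ (by norm_num))
    · rw [h3] at h2; norm_num at h2
  have hfull' : (Sum.inl (Γ'.vert x) :: T.map H.low).Nodup ∧
      ∀ a, a ∈ Sum.inl (Γ'.vert x) :: T.map H.low := by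
    by_contra hcon
    have h1 := hsign'
    rw [SetOrientation.sgnL_of_not hcon, mul_zero] at h1
    have h2 := ω'.sgnL_mul_self P.frame_nodup P.mem_frame
    rw [h1] at h2; norm_num at h2
  rw [H.induces_iff hfull.1 hfull.2 hfull'.1 hfull'.2, hsign, hsign', stepSign]
  have hpow : ((-1 : ℤ)) ^ (1 + (Γ'.frame 𝒬₁).length + u.length * (s.length + 1) + u.length) =
      (-1) ^ (1 + u.length * (s.length + 1) + u.length) * (-1) ^ (Γ'.frame 𝒬₁).length := by
    rw [← pow_add]; congr 1; ring
  rw [hpow]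
  set c := ((-1 : ℤ)) ^ (1 + u.length * (s.length + 1) + u.length) with hc
  have hcc : c * c = 1 := hsq _
  have hpp := hsq (Γ'.frame 𝒬₁).length
  set p := ((-1 : ℤ)) ^ (Γ'.frame 𝒬₁).length
  constructor
  · intro he
    rw [← he]
    linear_combination (-ω.sgnL (Γ.frame (lift f h x y 𝒬₁ 𝒬₂ u s t))) * (hcc + hpp * (c * c))
  · intro he
    rw [he]
    linear_combination ω'.sgnL (Sum.inl (Γ'.vert x) :: T.map H.low) * (hcc + hpp * (c * c))

theorem existsUnique_induces (H : OneEdge f h x y)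
    (P : Presents Γ' (𝒬₁ ++ (u ++ x :: (s ++ y :: t)) :: 𝒬₂)) (ω' : Γ'.GraphOrientation) :
    ∃! ω : Γ.GraphOrientation, Induces f ω ω' := by
  have P' := H.presents_lift P
  have hs : stepSign (Γ'.frame 𝒬₁).length u.length (s.length + 1) *
        ω'.sgnL (Γ'.frame (𝒬₁ ++ (u ++ x :: (s ++ y :: t)) :: 𝒬₂)) = 1 ∨
      stepSign (Γ'.frame 𝒬₁).length u.length (s.length + 1) *
        ω'.sgnL (Γ'.frame (𝒬₁ ++ (u ++ x :: (s ++ y :: t)) :: 𝒬₂)) = -1 := by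
    rcases ω'.sgnL_eq_one_or P.frame_nodup P.mem_frame with h1 | h1 <;> rw [h1, stepSign] <;>
      rcases neg_one_pow_eq_or ℤ (1 + (Γ'.frame 𝒬₁).length + u.length * (s.length + 1) + u.length)
        with h2 | h2 <;> rw [h2] <;> simp
  obtain ⟨ω, hω⟩ := SetOrientation.exists_sgnL_eq P'.frame_nodup P'.mem_frame hs
  refine ⟨ω, (H.sgnL_frame_lift P).2 hω, fun ω₂ hω₂ => ?_⟩
  exact SetOrientation.eq_of_sgnL_eq P'.frame_nodup P'.mem_frame
    (((H.sgnL_frame_lift P).1 hω₂).trans hω.symm)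

end OneEdge

/-! ### Sums over the positions of a list -/

section ZipSum

variable {E : Type*}

/-- The sum over all positions of a list of a function of the part before the position, the element
at the position and the part after it. -/
def zipSum (f : List E → E → List E → ℚ) : List E → List E → ℚ
  | _, [] => 0
  | A, e :: L => f A e L + zipSum f (A ++ [e]) L

theorem zipSum_congr {f g : List E → E → List E → ℚ} (L : List E) : ∀ A : List E,
    (∀ B e D, L = B ++ e :: D → f (A ++ B) e D = g (A ++ B) e D) →
    zipSum f A L = zipSum g A L := by
  induction L with
  | nil => exact fun _ _ => rfl
  | cons e L ih =>
    intro A h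
    have h1 := h [] e L rfl
    rw [List.append_nil] at h1
    have h2 := ih (A ++ [e]) fun B e' D hL => by
      have := h (e :: B) e' D (by rw [hL]; rfl)
      rwa [List.append_assoc]
    rw [zipSum, zipSum, h1, h2]

theorem zipSum_eq_zero {f : List E → E → List E → ℚ} {L A : List E}
    (h : ∀ B e D, L = B ++ e :: D → f (A ++ B) e D = 0) : zipSum f A L = 0 := by
  have : ∀ (L A : List E), zipSum (fun _ _ _ => 0) A L = 0 := by
    intro L
    induction L with
    | nil => exact fun _ => rfl
    | cons e L ih => intro A; rw [zipSum, ih, add_zero]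
  rw [zipSum_congr (g := fun _ _ _ => 0) L A h, this]

theorem zipSum_append (f : List E → E → List E → ℚ) (L L' : List E) : ∀ A : List E,
    zipSum f A (L ++ L') = zipSum (fun B e D => f B e (D ++ L')) A L + zipSum f (A ++ L) L' := by
  induction L with
  | nil => intro A; simp [zipSum]
  | cons e L ih =>
    intro A
    rw [List.cons_append, zipSum, zipSum, ih, add_assoc]
    simp

theorem zipSum_eq_sum_fin (f : List E → E → List E → ℚ) (L : List E) : ∀ A : List E,
    zipSum f A L = ∑ r : Fin L.length, f (A ++ L.take r) (L.get r) (L.drop (r + 1)) := by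
  induction L with
  | nil => intro A; simp [zipSum]
  | cons e L ih =>
    intro A
    rw [zipSum, ih]
    simp [Fin.sum_univ_succ]

theorem zipSum_map {E' : Type*} (φ : E' → E) (f : List E → E → List E → ℚ) (L : List E') :
    ∀ A : List E', zipSum f (A.map φ) (L.map φ) =
      zipSum (fun B e D => f (B.map φ) (φ e) (D.map φ)) A L := by
  induction L with
  | nil => exact fun _ => rfl
  | cons e L ih =>
    intro A
    rw [List.map_cons, zipSum, zipSum, ← ih]
    simp

end ZipSum

/-! ### Cutting polygons -/

/-- The pairs of positions of non-adjacent corners of an `m`-gon. -/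
def diagonals (m : ℕ) : Finset (ℕ × ℕ) :=
  (Finset.range m ×ˢ Finset.range m).filter fun ij => ij.1 + 2 ≤ ij.2 ∧ ¬ (ij.1 = 0 ∧ ij.2 + 1 = m)

theorem mem_diagonals {m i j : ℕ} :
    (i, j) ∈ diagonals m ↔ j < m ∧ i + 2 ≤ j ∧ ¬ (i = 0 ∧ j + 1 = m) := by
  simp only [diagonals, Finset.mem_filter, Finset.mem_product, Finset.mem_range]
  constructor
  · rintro ⟨⟨-, h1⟩, h2⟩; exact ⟨h1, h2⟩
  · rintro ⟨h1, h2⟩; exact ⟨⟨by omega, h1⟩, h2⟩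

section Cut

variable {X Y : Type}

/-- The polygon cut off by the diagonal `(i, j)`. -/
def cutFst (Q : List X) (ij : ℕ × ℕ) : List X :=
  (Q.drop ij.2).take 1 ++ (Q.drop ij.1).take (ij.2 - ij.1)

/-- The polygon on the other side of the diagonal `(i, j)`. -/
def cutSnd (Q : List X) (ij : ℕ × ℕ) : List X :=
  Q.take ij.1 ++ (Q.drop ij.1).take 1 ++ Q.drop ij.2

theorem cutFst_map (θ : X → Y) (Q : List X) (ij : ℕ × ℕ) :
    cutFst (Q.map θ) ij = (cutFst Q ij).map θ := by
  simp [cutFst, List.map_take, List.map_drop]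

theorem cutSnd_map (θ : X → Y) (Q : List X) (ij : ℕ × ℕ) :
    cutSnd (Q.map θ) ij = (cutSnd Q ij).map θ := by
  simp [cutSnd, List.map_take, List.map_drop]

theorem length_cutFst {Q : List X} {ij : ℕ × ℕ} (h : ij ∈ diagonals Q.length) :
    (cutFst Q ij).length = ij.2 - ij.1 + 1 := by
  obtain ⟨i, j⟩ := ij
  rw [mem_diagonals] at h
  simp [cutFst]
  omega

theorem length_cutSnd {Q : List X} {ij : ℕ × ℕ} (h : ij ∈ diagonals Q.length) :
    (cutSnd Q ij).length = ij.1 + 1 + (Q.length - ij.2) := by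
  obtain ⟨i, j⟩ := ij
  rw [mem_diagonals] at h
  simp [cutSnd]
  omega

/-- The two ends of the diagonal belong to both polygons. The parity and excess invariants rest on
this. -/
theorem length_cutFst_add_length_cutSnd {Q : List X} {ij : ℕ × ℕ} (h : ij ∈ diagonals Q.length) :
    (cutFst Q ij).length + (cutSnd Q ij).length = Q.length + 2 := by
  rw [length_cutFst h, length_cutSnd h]
  obtain ⟨i, j⟩ := ij
  rw [mem_diagonals] at h
  simp
  omega

/-- Here `y` stands first because the half-edge `h` which heads the corresponding cycle of
`OneEdge.lift` has `y` as its corner below. -/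
theorem cutFst_split (u s t : List X) (x y : X) :
    cutFst (u ++ x :: (s ++ y :: t)) (u.length, u.length + (s.length + 1)) = y :: x :: s := by
  have h1 : (u ++ x :: (s ++ y :: t)).drop (u.length + (s.length + 1)) = y :: t := by
    rw [← List.drop_drop, List.drop_left, List.drop_succ_cons, List.drop_left]
  have h2 : (u ++ x :: (s ++ y :: t)).drop u.length = x :: s ++ y :: t := by
    rw [List.drop_left]; rfl
  rw [cutFst, h1, h2]
  simp

/-- Here `x` stands in the place of `τ h`, whose corner below is `x`. -/
theorem cutSnd_split (u s t : List X) (x y : X) :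
    cutSnd (u ++ x :: (s ++ y :: t)) (u.length, u.length + (s.length + 1)) =
      u ++ x :: y :: t := by
  have h1 : (u ++ x :: (s ++ y :: t)).drop (u.length + (s.length + 1)) = y :: t := by
    rw [← List.drop_drop, List.drop_left, List.drop_succ_cons, List.drop_left]
  have h2 : (u ++ x :: (s ++ y :: t)).drop u.length = x :: s ++ y :: t := by
    rw [List.drop_left]; rfl
  rw [cutSnd, h1, h2]
  simp

/-- The set of elements of a list. -/
def setOf (Q : List X) : Set X := {a | a ∈ Q}

theorem setOf_map (θ : X → Y) (Q : List X) : setOf (Q.map θ) = θ '' setOf Q := by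
  ext a
  simp [setOf]

end Cut

/-! ### Sums over sequences of diagonals -/

section Cyc

variable {X Y : Type}

/-- The cyclic set cocycle on a sequence of subsets given as a list. -/
def cycValue (σ : Equiv.Perm X) (a : ℕ) (hs : List (Set X)) : ℚ :=
  cyclicSetCocycle σ a fun i => hs.getD i ∅

/-- An entry chosen from the second copy of `C` would have to avoid the first copy, so the sum is
empty. -/
theorem cycValue_eq_zero (σ : Equiv.Perm X) {a : ℕ} {hs : List (Set X)} (A B : List (Set X))
    (C : Set X) (hC : hs = A ++ C :: C :: B) (hl : hs.length = 2 * a + 1) :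
    cycValue σ a hs = 0 := by
  have hA : A.length + 1 < 2 * a + 1 := by rw [← hl, hC]; simp
  have h1 : hs.getD A.length ∅ = C := by rw [hC]; simp
  have h2 : hs.getD (A.length + 1) ∅ = C := by rw [hC]; simp
  have : IsEmpty {c : Fin (2 * a + 1) → X //
      ∀ i : Fin (2 * a + 1), c i ∈ hs.getD i ∅ ∧ ∀ j < i, c i ∉ hs.getD j ∅} := by
    refine ⟨fun c => ?_⟩
    have h3 := c.2 ⟨A.length + 1, hA⟩
    refine h3.2 ⟨A.length, by omega⟩ (by simp) ?_
    have h4 := h3.1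
    simp only [h1, h2] at h4 ⊢
    exact h4
  rw [cycValue, cyclicSetCocycle, finsum_of_isEmpty, zero_div]

theorem cyclicSign_map {σ : Equiv.Perm X} {ρ : Equiv.Perm Y} {θ : X → Y}
    (hθ : Function.Injective θ) (hσ : ∀ a, θ (σ a) = ρ (θ a)) {m : ℕ} (a : Fin (m + 1) → X) :
    cyclicSign ρ (fun i => θ (a i)) = cyclicSign σ a := by
  have hpow : ∀ (t : ℕ) b, (ρ ^ t) (θ b) = θ ((σ ^ t) b) := by
    intro t
    induction t with
    | zero => exact fun _ => rfl
    | succ t ih => intro b; rw [pow_succ', pow_succ', Equiv.Perm.mul_apply, ih, ← hσ]; rfl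
  simp only [cyclicSign, hpow, hθ.eq_iff]

theorem cyclicSetCocycle_map {σ : Equiv.Perm X} {ρ : Equiv.Perm Y} {θ : X → Y}
    (hθ : Function.Injective θ) (hσ : ∀ a, θ (σ a) = ρ (θ a)) (k : ℕ)
    (C : Fin (2 * k + 1) → Set X) :
    cyclicSetCocycle ρ k (fun i => θ '' C i) = cyclicSetCocycle σ k C := by
  rw [cyclicSetCocycle, cyclicSetCocycle]
  congr 1
  · let e : {a : Fin (2 * k + 1) → X // ∀ i, a i ∈ C i ∧ ∀ j < i, a i ∉ C j} ≃
        {b : Fin (2 * k + 1) → Y // ∀ i, b i ∈ θ '' C i ∧ ∀ j < i, b i ∉ θ '' C j} :=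
      Equiv.ofBijective (fun a => ⟨fun i => θ (a.1 i), fun i => by
          rw [hθ.mem_set_image]
          refine ⟨(a.2 i).1, fun j hj => ?_⟩
          rw [hθ.mem_set_image]
          exact (a.2 i).2 j hj⟩) (by
        constructor
        · intro a a' h
          apply Subtype.ext
          funext i
          exact hθ (congrFun (congrArg Subtype.val h) i)
        · rintro ⟨b, hb⟩
          choose a ha hab using fun i => (hb i).1
          obtain rfl : b = fun i => θ (a i) := funext fun i => (hab i).symm
          refine ⟨⟨a, fun i => ⟨ha i, fun j hj hC => (hb i).2 j hj ⟨_, hC, rfl⟩⟩⟩, rfl⟩)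
    refine (finsum_eq_of_bijective e e.bijective fun a => ?_).symm
    rw [← cyclicSign_map hθ hσ]
    rfl
  · simp only [Set.ncard_image_of_injective _ hθ]

theorem cycValue_map {σ : Equiv.Perm X} {ρ : Equiv.Perm Y} {θ : X → Y}
    (hθ : Function.Injective θ) (hσ : ∀ a, θ (σ a) = ρ (θ a)) (k : ℕ) (hs : List (Set X)) :
    cycValue ρ k (hs.map (θ '' ·)) = cycValue σ k hs := by
  rw [cycValue, cycValue, ← cyclicSetCocycle_map hθ hσ]
  congr 1
  funext i
  have := List.getD_map (n := i.1) hs ∅ (θ '' ·)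
  simpa only [Set.image_empty] using this

/-- The signed sum over all ways of drawing `k` diagonals, each one in the polygon
which is tracked (at first `Q`, and then one of the two polygons into which it is cut).  The
sequence of the tracked polygons is recorded in `hs`, `M` is the multiset of the sizes of the other
polygons, `p` is the number of cells before the tracked polygon. -/
def trackedSum (G : Multiset ℕ → ℚ) (σ : Equiv.Perm X) (a : ℕ) :
    ℕ → ℕ → Multiset ℕ → List X → List (Set X) → ℚ
  | 0, _, M, Q, hs => ((Q.length : ℚ) - 2) * cycValue σ a hs * G (Q.length ::ₘ M)
  | k + 1, p, M, Q, hs => ∑ ij ∈ diagonals Q.length, (stepSign p ij.1 (ij.2 - ij.1) : ℚ) *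
      (trackedSum G σ a k p ((cutSnd Q ij).length ::ₘ M) (cutFst Q ij)
          (setOf (cutFst Q ij) :: hs) +
        trackedSum G σ a k (p + ((cutFst Q ij).length + 1)) ((cutFst Q ij).length ::ₘ M)
          (cutSnd Q ij) (setOf (cutSnd Q ij) :: hs))

variable {σ : Equiv.Perm X} {a : ℕ}

/-- A repetition in the history survives all further cuts, which only prepend sets. -/
theorem trackedSum_eq_zero_of_eq {G : Multiset ℕ → ℚ} {k : ℕ} :
    ∀ {p : ℕ} {M : Multiset ℕ} {Q : List X} {hs : List (Set X)} (A B : List (Set X)) (C : Set X),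
      hs = A ++ C :: C :: B → hs.length + k = 2 * a + 1 → trackedSum G σ a k p M Q hs = 0 := by
  induction k with
  | zero =>
    intro p M Q hs A B C hC hl
    rw [trackedSum, cycValue_eq_zero σ A B C hC hl, mul_zero, zero_mul]
  | succ k ih =>
    intro p M Q hs A B C hC hl
    rw [trackedSum]
    refine Finset.sum_eq_zero fun ij _ => ?_
    rw [ih (setOf (cutFst Q ij) :: A) B C (by rw [hC]; rfl) (by simp; omega),
      ih (setOf (cutSnd Q ij) :: A) B C (by rw [hC]; rfl) (by simp; omega)]
    simp

/-- Polygons which are not tracked are never cut again, so they can be absorbed into `G`. -/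
theorem trackedSum_add (G : Multiset ℕ → ℚ) (N : Multiset ℕ) (k : ℕ) :
    ∀ (p : ℕ) (M : Multiset ℕ) (Q : List X) (hs : List (Set X)),
      trackedSum G σ a k p (M + N) Q hs = trackedSum (fun K => G (K + N)) σ a k p M Q hs := by
  induction k with
  | zero => intro p M Q hs; rw [trackedSum, trackedSum, Multiset.cons_add]
  | succ k ih =>
    intro p M Q hs
    rw [trackedSum, trackedSum]
    refine Finset.sum_congr rfl fun ij _ => ?_
    rw [← ih, ← ih, Multiset.cons_add, Multiset.cons_add]

/-- The number of preceding cells enters only through its parity in `stepSign`. -/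
theorem trackedSum_add_even (G : Multiset ℕ → ℚ) {q : ℕ} (hq : Even q) (k : ℕ) :
    ∀ (p : ℕ) (M : Multiset ℕ) (Q : List X) (hs : List (Set X)),
      trackedSum G σ a k (p + q) M Q hs = trackedSum G σ a k p M Q hs := by
  induction k with
  | zero => intro p M Q hs; rfl
  | succ k ih =>
    intro p M Q hs
    rw [trackedSum, trackedSum]
    refine Finset.sum_congr rfl fun ij _ => ?_
    have h1 : stepSign (p + q) ij.1 (ij.2 - ij.1) = stepSign p ij.1 (ij.2 - ij.1) := by
      have e : 1 + (p + q) + ij.1 * (ij.2 - ij.1) + ij.1 =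
        (1 + p + ij.1 * (ij.2 - ij.1) + ij.1) + q := by ring
      rw [stepSign, stepSign, e, pow_add, hq.neg_one_pow, mul_one]
    rw [ih, h1, add_right_comm p q, ih]

theorem trackedSum_sum {ι : Type*} (s : Finset ι) (c : ι → ℚ) (G : ι → Multiset ℕ → ℚ) (k : ℕ) :
    ∀ (p : ℕ) (M : Multiset ℕ) (Q : List X) (hs : List (Set X)),
      trackedSum (fun K => ∑ i ∈ s, c i * G i K) σ a k p M Q hs =
        ∑ i ∈ s, c i * trackedSum (G i) σ a k p M Q hs := by
  induction k with
  | zero =>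
    intro p M Q hs
    simp only [trackedSum, Finset.mul_sum]
    refine Finset.sum_congr rfl fun i _ => ?_
    ring
  | succ k ih =>
    intro p M Q hs
    simp only [trackedSum, ih, ← Finset.sum_add_distrib, Finset.mul_sum]
    rw [Finset.sum_comm]
    refine Finset.sum_congr rfl fun i _ => Finset.sum_congr rfl fun ij _ => ?_
    ring

theorem trackedSum_zero (k : ℕ) (p : ℕ) (M : Multiset ℕ) (Q : List X) (hs : List (Set X)) :
    trackedSum (fun _ => 0) σ a k p M Q hs = 0 := by
  have := trackedSum_sum (σ := σ) (a := a) (∅ : Finset ℕ) (fun _ => 0) (fun _ _ => 0) k p M Q hs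
  simpa using this

theorem trackedSum_eq_zero_of_even {G : Multiset ℕ → ℚ} (hG : ∀ K, (∃ m ∈ K, Even m) → G K = 0)
    {k : ℕ} {p : ℕ} {M : Multiset ℕ} (hM : ∃ m ∈ M, Even m) (Q : List X) (hs : List (Set X)) :
    trackedSum G σ a k p M Q hs = 0 := by
  have := trackedSum_add (σ := σ) (a := a) G M k p 0 Q hs
  rw [zero_add] at this
  rw [this]
  obtain ⟨m, hm, he⟩ := hM
  have h2 : (fun K => G (K + M)) = fun _ => 0 := by
    funext K
    exact hG _ ⟨m, Multiset.mem_add.2 (Or.inr hm), he⟩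
  rw [h2, trackedSum_zero]

/-- A diagonal adds 2 to the sum of the sizes and 1 to their number, so the parity of the sum of
(size + 1) plus the number of diagonals still to be drawn is invariant. If it is odd, some final
polygon is even. -/
theorem trackedSum_eq_zero_of_parity {G : Multiset ℕ → ℚ}
    (hG : ∀ K, (∃ m ∈ K, Even m) → G K = 0) (k : ℕ) :
    ∀ (p : ℕ) (M : Multiset ℕ) (Q : List X) (hs : List (Set X)),
      Odd ((Q.length + 1) + (M.map (· + 1)).sum + k) → trackedSum G σ a k p M Q hs = 0 := by
  induction k with
  | zero =>
    intro p M Q hs ho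
    rw [trackedSum, hG, mul_zero]
    by_contra hcon
    push Not at hcon
    have hev : ∀ N : Multiset ℕ, (∀ m ∈ N, ¬ Even m) → Even (N.map (· + 1)).sum := by
      intro N
      induction N using Multiset.induction_on with
      | empty => simp
      | cons m N ih =>
        intro h
        rw [Multiset.map_cons, Multiset.sum_cons]
        refine Even.add ?_ (ih fun m hm => h m (Multiset.mem_cons_of_mem hm))
        exact (Nat.not_even_iff_odd.1 (h m (Multiset.mem_cons_self _ _))).add_odd odd_one
    have := hev _ hcon
    rw [Multiset.map_cons, Multiset.sum_cons] at this
    exact (Nat.not_even_iff_odd.2 ho) (by simpa using this)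
  | succ k ih =>
    intro p M Q hs ho
    rw [trackedSum]
    refine Finset.sum_eq_zero fun ij hij => ?_
    have hl := length_cutFst_add_length_cutSnd hij
    rw [ih, ih]
    · simp
    · rw [Multiset.map_cons, Multiset.sum_cons]
      rw [Nat.odd_iff] at ho ⊢
      omega
    · rw [Multiset.map_cons, Multiset.sum_cons]
      rw [Nat.odd_iff] at ho ⊢
      omega

theorem trackedSum_map {ρ : Equiv.Perm Y} {θ : X → Y} (hθ : Function.Injective θ)
    (hσ : ∀ a, θ (σ a) = ρ (θ a)) (G : Multiset ℕ → ℚ) (k : ℕ) :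
    ∀ (p : ℕ) (M : Multiset ℕ) (Q : List X) (hs : List (Set X)),
      trackedSum G ρ a k p M (Q.map θ) (hs.map (θ '' ·)) = trackedSum G σ a k p M Q hs := by
  induction k with
  | zero =>
    intro p M Q hs
    rw [trackedSum, trackedSum, cycValue_map hθ hσ, List.length_map]
  | succ k ih =>
    intro p M Q hs
    rw [trackedSum, trackedSum, List.length_map]
    refine Finset.sum_congr rfl fun ij _ => ?_
    rw [← ih, ← ih, cutFst_map, cutSnd_map, List.length_map, List.length_map, setOf_map, setOf_map,
      List.map_cons, List.map_cons]

/-- The sizes of the polygons of a subdivision. -/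
def sizes (S : List (List X × List (Set X))) : Multiset ℕ := (S.map fun e => e.1.length : List ℕ)

/-- The number of cells of a subdivision. -/
def cells (S : List (List X × List (Set X))) : ℕ := (S.map fun e => e.1.length + 1).sum

/-- Recording a polygon once more. -/
def record (e : List X × List (Set X)) : List X × List (Set X) := (e.1, setOf e.1 :: e.2)

/-- The signed sum over all ways of drawing `k` diagonals in a list of polygons, of the sum of the
values of the cyclic set cocycle on the resulting polygons. -/
def diagonalSum (G : Multiset ℕ → ℚ) (σ : Equiv.Perm X) (a : ℕ) :
    ℕ → List (List X × List (Set X)) → ℚ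
  | 0, S => (S.map fun e => ((e.1.length : ℚ) - 2) * cycValue σ a e.2).sum * G (sizes S)
  | k + 1, S => zipSum (fun A e B => ∑ ij ∈ diagonals e.1.length,
      (stepSign (cells A) ij.1 (ij.2 - ij.1) : ℚ) *
        diagonalSum G σ a k (A.map record ++ (cutFst e.1 ij, setOf (cutFst e.1 ij) :: e.2) ::
          (cutSnd e.1 ij, setOf (cutSnd e.1 ij) :: e.2) :: B.map record)) [] S

theorem sizes_map_record (S : List (List X × List (Set X))) :
    sizes (S.map record) = sizes S := by
  simp [sizes, record, Function.comp_def]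

theorem cells_map_record (S : List (List X × List (Set X))) :
    cells (S.map record) = cells S := by
  simp [cells, record, Function.comp_def]

theorem sizes_append (S S' : List (List X × List (Set X))) :
    sizes (S ++ S') = sizes S + sizes S' := by
  simp [sizes]

theorem sizes_cons (e : List X × List (Set X)) (S : List (List X × List (Set X))) :
    sizes (e :: S) = e.1.length ::ₘ sizes S := by
  simp [sizes]

/-- Cutting one polygon records every other polygon twice in succession, and this kills their
cocycle values. Of the sum over all polygons there remain the terms in which every diagonal cuts the
polygon tracked so far, sorted by the polygon one starts from. -/
theorem diagonalSum_eq (G : Multiset ℕ → ℚ) (k : ℕ) : ∀ S : List (List X × List (Set X)),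
    (∀ e ∈ S, e.2.length + k = 2 * a + 1 ∧ ∃ hs, e.2 = setOf e.1 :: hs) →
    diagonalSum G σ a k S =
      zipSum (fun A e B => trackedSum G σ a k (cells A) (sizes A + sizes B) e.1 e.2) [] S := by
  induction k with
  | zero =>
    intro S _
    have key : ∀ (S A : List (List X × List (Set X))),
        zipSum (fun A e B => trackedSum G σ a 0 (cells A) (sizes A + sizes B) e.1 e.2) A S =
          (S.map fun e => ((e.1.length : ℚ) - 2) * cycValue σ a e.2).sum * G (sizes A + sizes S) := by
      intro S
      induction S with
      | nil => intro A; simp [zipSum]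
      | cons e S ih =>
        intro A
        rw [zipSum, ih, trackedSum, List.map_cons, List.sum_cons, add_mul, sizes_append,
          sizes_cons e S, sizes_cons e [], Multiset.add_cons, Multiset.add_cons,
          Multiset.cons_add, show sizes ([] : List (List X × List (Set X))) = 0 from rfl, add_zero]
    rw [diagonalSum, key]
    simp [sizes]
  | succ k ih =>
    intro S hS
    rw [diagonalSum]
    refine zipSum_congr S [] fun A e B hAB => ?_
    -- The history of each polygon already begins with its own corner set, so recording it again
    -- produces the repetition.
    have hrec : ∀ e' ∈ S, (record e').2.length + k = 2 * a + 1 ∧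
        ∃ hs, (record e').2 = setOf (record e').1 :: setOf (record e').1 :: hs := by
      intro e' he'
      obtain ⟨h1, hs, h2⟩ := hS e' he'
      refine ⟨by simp [record]; omega, hs, by rw [record, ← h2]⟩
    have hA : ∀ e' ∈ A, e' ∈ S := fun e' he' => by rw [hAB]; simp [he']
    have hB : ∀ e' ∈ B, e' ∈ S := fun e' he' => by rw [hAB]; simp [he']
    have he := (hS e (by rw [hAB]; simp)).1
    rw [trackedSum, List.nil_append]
    refine Finset.sum_congr rfl fun ij _ => ?_
    congr 1
    rw [ih, zipSum_append, zipSum_eq_zero, zero_add, zipSum, zipSum, zipSum_eq_zero, add_zero,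
      List.nil_append]
    · rw [sizes_map_record, cells_map_record]
      congr 1
      · rw [sizes_cons, sizes_map_record, Multiset.add_cons]
      · rw [sizes_append, sizes_map_record, sizes_map_record, sizes_cons]
        have h1 : cells (A.map record ++ [(cutFst e.1 ij, setOf (cutFst e.1 ij) :: e.2)]) =
            cells A + ((cutFst e.1 ij).length + 1) := by
          rw [← cells_map_record A]
          simp [cells]
        rw [h1, Multiset.add_cons, Multiset.cons_add,
          show sizes ([] : List (List X × List (Set X))) = 0 from rfl, add_zero]
    · intro C e' D hCD
      have : e' ∈ B.map record := by rw [hCD]; simp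
      obtain ⟨e0, he0, rfl⟩ := List.mem_map.1 this
      obtain ⟨h1, hs, h2⟩ := hrec e0 (hB e0 he0)
      exact trackedSum_eq_zero_of_eq [] hs _ h2 h1
    · intro C e' D hCD
      have : e' ∈ A.map record := by rw [hCD]; simp
      obtain ⟨e0, he0, rfl⟩ := List.mem_map.1 this
      obtain ⟨h1, hs, h2⟩ := hrec e0 (hA e0 he0)
      exact trackedSum_eq_zero_of_eq [] hs _ h2 h1
    · intro e' he'
      simp only [List.mem_append, List.mem_cons, List.mem_map] at he'
      rcases he' with ⟨e0, he0, rfl⟩ | rfl | rfl | ⟨e0, he0, rfl⟩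
      · obtain ⟨h1, hs, h2⟩ := hrec e0 (hA e0 he0)
        exact ⟨h1, _, h2⟩
      · exact ⟨by simp; omega, _, rfl⟩
      · exact ⟨by simp; omega, _, rfl⟩
      · obtain ⟨h1, hs, h2⟩ := hrec e0 (hB e0 he0)
        exact ⟨h1, _, h2⟩

end Cyc

/-! ### The values on dual cells -/

/-- The value of a product of cyclic set cocycles (the last factor being the head of the list) on
the dual cell of a graph with vertices of given valences, up to sign. -/
def cellValue : List ℕ → Multiset ℕ → ℚ
  | [], M => if ∀ m ∈ M, m = 3 then 1 else 0
  | a :: l, M => (M.map fun m => trackedSum (fun K => cellValue l (K + M.erase m)) (finRotate m) a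
      (2 * a) 0 0 (List.finRange m) [Set.univ]).sum

/-- If an even polygon is tracked, the 2a diagonals preserve parity and leave an even one; otherwise
it stays as it is. At the end all polygons must be triangles. -/
theorem cellValue_eq_zero_of_even (l : List ℕ) : ∀ M : Multiset ℕ, (∃ m ∈ M, Even m) →
    cellValue l M = 0 := by
  induction l with
  | nil =>
    rintro M ⟨m, hm, he⟩
    rw [cellValue, if_neg]
    intro h
    rw [h m hm] at he
    exact absurd he (by decide)
  | cons a l ih =>
    rintro M ⟨m, hm, he⟩
    rw [cellValue]
    refine Multiset.sum_eq_zero fun r hr => ?_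
    obtain ⟨m', hm', rfl⟩ := Multiset.mem_map.1 hr
    by_cases hmm : m' = m
    · subst hmm
      refine trackedSum_eq_zero_of_parity (fun K hK => ih _ ?_) _ _ _ _ _ ?_
      · obtain ⟨n, hn, hne⟩ := hK
        exact ⟨n, Multiset.mem_add.2 (Or.inl hn), hne⟩
      · rw [List.length_finRange]
        simp only [Multiset.map_zero, Multiset.sum_zero, add_zero]
        exact (he.add_odd odd_one).add_even (even_two_mul a)
    · have h1 : (fun K => cellValue l (K + M.erase m')) = fun _ => 0 := by
        funext K
        refine ih _ ⟨m, Multiset.mem_add.2 (Or.inr ?_), he⟩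
        exact (Multiset.mem_erase_of_ne (Ne.symm hmm)).2 hm
      rw [h1, trackedSum_zero]

/-- A triangle has no diagonal and every factor needs at least two of them, so triangles are never
tracked. This is where positivity of the entries is used. -/
theorem cellValue_cons_three {l : List ℕ} (hl : ∀ a ∈ l, 0 < a) : ∀ M : Multiset ℕ,
    cellValue l (3 ::ₘ M) = cellValue l M := by
  induction l with
  | nil =>
    intro M
    rw [cellValue, cellValue]
    simp
  | cons a l ih =>
    intro M
    rw [cellValue, cellValue, Multiset.map_cons, Multiset.sum_cons]
    have ha : 2 * a = (2 * a - 1) + 1 := by have := hl a (by simp); omega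
    have h0 : trackedSum (fun K => cellValue l (K + (3 ::ₘ M).erase 3)) (finRotate 3) a
        (2 * a) 0 0 (List.finRange 3) [Set.univ] = 0 := by
      rw [ha, trackedSum]
      refine Finset.sum_eq_zero fun ij hij => ?_
      obtain ⟨i, j⟩ := ij
      rw [List.length_finRange, mem_diagonals] at hij
      omega
    rw [h0, zero_add]
    congr 1
    refine Multiset.map_congr rfl fun m hm => ?_
    have h1 : (3 ::ₘ M).erase m = 3 ::ₘ M.erase m := by
      by_cases h3 : m = 3
      · subst h3
        rw [Multiset.erase_cons_head, Multiset.cons_erase hm]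
      · rw [Multiset.erase_cons_tail _ (Ne.symm h3)]
    congr 1
    funext K
    rw [h1, Multiset.add_cons, ih fun a ha => hl a (by simp [ha])]

/-- The subsequence of a list with indices in one part of a partition of the set of indices. -/
def subList {r : ℕ} (l : List ℕ) (f : Fin l.length → Fin r) (i : Fin r) : List ℕ :=
  ((List.finRange l.length).filter fun j => f j = i).map l.get

theorem subList_cons {r : ℕ} (a : ℕ) (l : List ℕ) (c : Fin r) (f : Fin l.length → Fin r)
    (i : Fin r) : subList (a :: l) (Fin.cons c f : Fin (l.length + 1) → Fin r) i =
      if c = i then a :: subList l f i else subList l f i := by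
  have h : List.finRange (a :: l).length = 0 :: (List.finRange l.length).map Fin.succ :=
    List.finRange_succ
  rw [subList, h, List.filter_cons]
  simp only [Fin.cons_zero, decide_eq_true_eq]
  have h2 : (((List.finRange l.length).map Fin.succ).filter fun j =>
      (Fin.cons c f : Fin (l.length + 1) → Fin r) j = i).map (a :: l).get = subList l f i := by
    rw [List.filter_map, List.map_map, subList]
    congr 1
  split_ifs
  · rw [List.map_cons]
    exact congrArg (List.cons a) h2
  · exact h2

/-- The values on dual cells are multiplicative. -/
theorem cellValue_sum {r : ℕ} (l : List ℕ) : ∀ M : Fin r → Multiset ℕ,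
    cellValue l (∑ i, M i) = ∑ f : Fin l.length → Fin r, ∏ i, cellValue (subList l f i) (M i) := by
  induction l with
  | nil =>
    intro M
    have h0 : ∀ F : (Fin ([] : List ℕ).length → Fin r) → ℚ, ∑ f, F f = F Fin.elim0 := fun F =>
      Fintype.sum_eq_single (M := ℚ) _ fun f hf => absurd (funext fun i => i.elim0) hf
    rw [h0]
    simp only [subList, List.length_nil, List.finRange_zero, List.filter_nil, List.map_nil,
      cellValue]
    rw [Finset.prod_ite_zero]
    simp only [Finset.prod_const_one]
    congr 1
    simp only [Multiset.mem_sum, Finset.mem_univ, true_and, eq_iff_iff]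
    constructor
    · exact fun h i _ m hm => h m ⟨i, hm⟩
    · rintro h m ⟨i, hm⟩
      exact h i trivial m hm
  | cons a l ih =>
    intro M
    have e : ∑ f : Fin (a :: l).length → Fin r, ∏ i, cellValue (subList (a :: l) f i) (M i) =
        ∑ c : Fin r, ∑ f : Fin l.length → Fin r,
          ∏ i, cellValue (subList (a :: l) (Fin.cons c f : Fin (l.length + 1) → Fin r) i) (M i) := by
      rw [← Fintype.sum_prod_type']
      exact (Fintype.sum_equiv (Fin.consEquiv fun _ => Fin r) _ _ fun p => rfl).symm
    rw [e, cellValue]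
    have h1 : ∀ F : ℕ → ℚ, ((∑ i, M i).map F).sum = ∑ i, ((M i).map F).sum := by
      intro F
      have := map_sum (Multiset.sumAddMonoidHom.comp (Multiset.mapAddMonoidHom F)) M Finset.univ
      exact this
    rw [h1]
    refine Finset.sum_congr rfl fun c _ => ?_
    -- Cutting a polygon of `M c` changes only this summand. The induction hypothesis is applied to
    -- `M` updated at `c`, and linearity of `trackedSum` in `G` extracts the factors at the other
    -- indices.
    have h2 : ∀ m ∈ M c, trackedSum (fun K => cellValue l (K + (∑ i, M i).erase m)) (finRotate m) a
        (2 * a) 0 0 (List.finRange m) [Set.univ] =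
        ∑ f : Fin l.length → Fin r, (∏ i ∈ Finset.univ.erase c, cellValue (subList l f i) (M i)) *
          trackedSum (fun K => cellValue (subList l f c) (K + (M c).erase m)) (finRotate m) a
            (2 * a) 0 0 (List.finRange m) [Set.univ] := by
      intro m hm
      rw [← trackedSum_sum]
      congr 1
      funext K
      have h3 : K + (∑ i, M i).erase m =
          ∑ i, Function.update M c (K + (M c).erase m) i := by
        rw [Finset.sum_update_of_mem (Finset.mem_univ c), ← Finset.add_sum_erase _ _ (Finset.mem_univ c),
          Multiset.erase_add_left_pos _ hm, add_assoc, Finset.sdiff_singleton_eq_erase]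
      rw [h3, ih]
      refine Finset.sum_congr rfl fun f _ => ?_
      rw [← Finset.mul_prod_erase _ _ (Finset.mem_univ c), Function.update_self, mul_comm]
      congr 1
      refine Finset.prod_congr rfl fun i hi => ?_
      rw [Function.update_of_ne (Finset.ne_of_mem_erase hi)]
    have h4 : ∀ (N : Multiset ℕ) (F : (Fin l.length → Fin r) → ℕ → ℚ),
        (N.map fun m => ∑ f, F f m).sum = ∑ f, (N.map (F f)).sum := by
      intro N F
      induction N using Multiset.induction_on with
      | empty => simp
      | cons m N ih => simp [ih, Finset.sum_add_distrib]
    rw [Multiset.map_congr rfl h2, h4]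
    refine Finset.sum_congr rfl fun f _ => ?_
    rw [Multiset.sum_map_mul_left, ← Finset.mul_prod_erase _ _ (Finset.mem_univ c), mul_comm,
      subList_cons, if_pos rfl, cellValue]
    congr 1
    refine Finset.prod_congr rfl fun i hi => ?_
    rw [subList_cons, if_neg (Finset.ne_of_mem_erase hi).symm]

theorem zipSum_sizes {X : Type} (F : ℕ → Multiset ℕ → ℚ) (S : List (List X × List (Set X))) :
    ∀ A : List (List X × List (Set X)),
      zipSum (fun A e B => F e.1.length (sizes A + sizes B)) A S =
        ((sizes S).map fun m => F m ((sizes A + sizes S).erase m)).sum := by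
  induction S with
  | nil => intro A; simp [zipSum, sizes]
  | cons e S ih =>
    intro A
    rw [zipSum, ih, sizes_cons, Multiset.map_cons, Multiset.sum_cons, Multiset.add_cons,
      Multiset.erase_cons_head, sizes_append, sizes_cons, Multiset.add_cons, Multiset.cons_add,
      show sizes ([] : List (List X × List (Set X))) = 0 from rfl, add_zero]

/-- The sum over all ways of drawing diagonals in the cycles of a permutation depends only on the
lengths of the cycles. -/
theorem diagonalSum_cycles {X : Type} {σ : Equiv.Perm X} (l : List ℕ) (a : ℕ) {𝒬 : List (List X)}
    (hc : ∀ Q ∈ 𝒬, IsCycleList σ Q) (hn : ∀ Q ∈ 𝒬, Q.Nodup) :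
    diagonalSum (cellValue l) σ a (2 * a) (𝒬.map fun Q => (Q, [setOf Q])) =
      cellValue (a :: l) (𝒬.map List.length : List ℕ) := by
  set S := 𝒬.map fun Q => (Q, [setOf Q]) with hS
  rw [diagonalSum_eq]
  swap
  · intro e he
    obtain ⟨Q, -, rfl⟩ := List.mem_map.1 he
    exact ⟨by simp; omega, [], rfl⟩
  have hsz : sizes S = (𝒬.map List.length : List ℕ) := by simp [sizes, hS, Function.comp_def]
  rw [cellValue, ← hsz]
  have key := zipSum_sizes (fun m N => trackedSum (fun K => cellValue l (K + N)) (finRotate m) a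
      (2 * a) 0 0 (List.finRange m) [Set.univ]) S []
  rw [show sizes ([] : List (List X × List (Set X))) = 0 from rfl, zero_add] at key
  rw [← key]
  refine zipSum_congr S [] fun A e B hAB => ?_
  rw [List.nil_append]
  have he : e ∈ S := by rw [hAB]; simp
  obtain ⟨Q, hQ, rfl⟩ := List.mem_map.1 he
  have hcQ := hc Q hQ
  have hnQ := hn Q hQ
  simp only
  have hev : ∀ K, (∃ m ∈ K, Even m) → cellValue l K = 0 := cellValue_eq_zero_of_even l
  -- If the preceding polygons are all odd, they have an even number of cells and do not affect the
  -- signs; if one of them is even, both sides vanish.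
  have step1 : trackedSum (cellValue l) σ a (2 * a) (cells A) (sizes A + sizes B) Q [setOf Q] =
      trackedSum (fun K => cellValue l (K + (sizes A + sizes B))) σ a (2 * a) 0 0 Q [setOf Q] := by
    by_cases hA : ∃ m ∈ sizes A, Even m
    · obtain ⟨m, hm, hme⟩ := hA
      rw [trackedSum_eq_zero_of_even hev ⟨m, Multiset.mem_add.2 (Or.inl hm), hme⟩]
      have : (fun K => cellValue l (K + (sizes A + sizes B))) = fun _ => 0 := by
        funext K
        exact hev _ ⟨m, by simp [hm], hme⟩
      rw [this, trackedSum_zero]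
    · have hcell : Even (cells A) := by
        push Not at hA
        clear hAB key
        induction A with
        | nil => simp [cells]
        | cons e A ih =>
          have e1 : cells (e :: A) = (e.1.length + 1) + cells A := by simp [cells]
          rw [sizes_cons] at hA
          rw [e1]
          refine Even.add ?_ (ih fun m hm => hA m (Multiset.mem_cons_of_mem hm))
          exact (Nat.not_even_iff_odd.1 (hA _ (Multiset.mem_cons_self _ _))).add_odd odd_one
      have h1 := trackedSum_add_even (σ := σ) (a := a) (cellValue l) hcell (2 * a) 0
        (sizes A + sizes B) Q [setOf Q]
      rw [zero_add] at h1
      rw [h1]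
      have h2 := trackedSum_add (σ := σ) (a := a) (cellValue l) (sizes A + sizes B) (2 * a) 0 0 Q
        [setOf Q]
      rwa [zero_add] at h2
  rw [step1]
  set G := fun K => cellValue l (K + (sizes A + sizes B))
  -- The cycle is identified with the standard one, so that only its length remains.
  let θ : Fin Q.length → X := fun i => Q.get i
  have hθ : Function.Injective θ := List.nodup_iff_injective_get.1 hnQ
  have hσ : ∀ i, θ (finRotate Q.length i) = σ (θ i) := by
    obtain ⟨c, T, rfl, hch⟩ := hcQ
    intro i
    have hi := i.2
    rw [List.isChain_iff_getElem] at hch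
    have h1 := hch i.1 (by simp at hi ⊢; omega)
    have e1 : (c :: T ++ [c])[i.1]'(by rw [List.length_append]; omega) = θ i := by
      rw [List.getElem_append_left hi]; rfl
    rw [e1] at h1
    rw [h1]
    by_cases hlast : i.1 = T.length
    · have hi2 : i = Fin.last T.length := Fin.ext hlast
      have h3 : finRotate (c :: T).length i = (0 : Fin (T.length + 1)) := by
        rw [hi2]; exact finRotate_last
      rw [h3]
      simp [θ, hlast]
    · have hlt : i.1 < T.length := by simp at hi; omega
      have h3 : finRotate (c :: T).length i = (⟨i.1 + 1, by simp; omega⟩ : Fin (c :: T).length) := by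
        exact finRotate_of_lt hlt
      rw [h3, List.getElem_append_left (by simp; omega)]
      rfl
  have hQ1 : Q = (List.finRange Q.length).map θ := by
    simp [θ]
  have hset : setOf Q = θ '' Set.univ := by
    rw [Set.image_univ]
    ext b
    simp only [setOf, Set.mem_ofPred_eq, Set.mem_range, θ]
    exact List.mem_iff_get
  have := trackedSum_map (a := a) hθ hσ G (2 * a) 0 0 (List.finRange Q.length) [Set.univ]
  rw [← this, ← hQ1, List.map_singleton, ← hset]

/-! ### Composable arrows with a given last arrow -/

section Snoc

universe u v

variable {C : Type u} [Category.{v} C]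

/-- A sequence of composable arrows without the last one. -/
def dropLast {n : ℕ} (Y : ComposableArrows C (n + 1)) : ComposableArrows C n :=
  Monotone.functor (f := fun i : Fin (n + 1) => i.castSucc) (fun _ _ h => h) ⋙ Y

theorem exists_dropLast_eq {n : ℕ} (Y' : ComposableArrows C n) {X : C}
    (m : Y'.obj (Fin.last n) ⟶ X) : ∃ Y : ComposableArrows C (n + 1), dropLast Y = Y' ∧
      Y.obj (Fin.last (n + 1)) = X ∧ HEq (Y.map (homOfLE (Fin.last n).castSucc_lt_succ.le)) m := by
  let obj : Fin (n + 2) → C := fun i => if h : i.1 < n + 1 then Y'.obj ⟨i.1, h⟩ else X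
  have h1 : ∀ i : Fin (n + 2), ∀ h : i.1 < n + 1, obj i = Y'.obj ⟨i.1, h⟩ := fun i h => dif_pos h
  have h2 : obj (Fin.last (n + 1)) = X := dif_neg (by simp)
  let mapSucc : ∀ i : Fin (n + 1), obj i.castSucc ⟶ obj i.succ := fun i =>
    if h : i.1 < n then eqToHom (h1 i.castSucc i.2) ≫
      Y'.map (homOfLE (show (⟨i.1, i.2⟩ : Fin (n + 1)) ≤ ⟨i.1 + 1, by omega⟩ from
        Fin.mk_le_mk.2 (Nat.le_succ _))) ≫ eqToHom (h1 i.succ (by simp; omega)).symm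
    else eqToHom (by
        have : i = Fin.last n := Fin.ext (by simp; omega)
        subst this
        exact h1 (Fin.last n).castSucc (by simp)) ≫ m ≫ eqToHom (by
        have : i = Fin.last n := Fin.ext (by simp; omega)
        subst this
        exact h2.symm)
  -- Hiding the construction behind equalities of objects leaves only `eqToHom` terms to cancel.
  obtain ⟨Y, e, he⟩ : ∃ (Y : ComposableArrows C (n + 1)) (e : ∀ i, Y.obj i = obj i),
      ∀ i : Fin (n + 1), Y.map (homOfLE i.castSucc_lt_succ.le) =
        eqToHom (e _) ≫ mapSucc i ≫ eqToHom (e _).symm := by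
    refine ⟨ComposableArrows.mkOfObjOfMapSucc obj mapSucc, fun _ => rfl, fun i => ?_⟩
    exact (ComposableArrows.mkOfObjOfMapSucc_map_succ obj mapSucc i.1 i.2).trans
      ((Category.id_comp _).trans (Category.comp_id _)).symm
  refine ⟨Y, ComposableArrows.ext (fun i => (e i.castSucc).trans (h1 i.castSucc i.2)) ?_,
    (e _).trans h2, ?_⟩
  · intro i hi
    have := he ⟨i, by omega⟩
    refine this.trans ?_
    simp only [mapSucc, dif_pos hi, Category.assoc, eqToHom_trans, eqToHom_trans_assoc]
    rfl
  · rw [he]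
    have hn : ¬ (Fin.last n).1 < n := by simp
    simp only [mapSucc, dif_neg hn, Category.assoc, eqToHom_trans, eqToHom_trans_assoc]
    rw [eqToHom_comp_heq_iff, comp_eqToHom_heq_iff]

end Snoc

/-! ### Sequences of graphs over a graph -/

section Sequences

variable {Γ : RibbonGraph} {K : Set (Over Γ)}

/-- The sequences `Γ₀ → ⋯ → Γ_n = X` over `Γ` such that `Γ_i` is in `K` and has codimension `i` for
`i < n`. -/
def Below (K : Set (Over Γ)) : ℕ → Over Γ → Type 1
  | 0, _ => PUnit
  | n + 1, X => Σ Z : {Z : Over Γ // Z ∈ K ∧ Z.left.codim = n}, (Z.1 ⟶ X) × Below K n Z.1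

namespace OverFlag

variable {N : ℕ}

/-- The initial part of a sequence of graphs. -/
def below (Y : OverFlag Γ K N) : (q : ℕ) → (hq : q < N + 1) → Below K q (Y.1.obj ⟨q, hq⟩)
  | 0, _ => PUnit.unit
  | q + 1, hq => ⟨⟨Y.1.obj ⟨q, by omega⟩, Y.2 ⟨q, by omega⟩⟩,
      Y.1.map (homOfLE (Fin.mk_le_mk.2 (Nat.le_succ q))), Y.below q (by omega)⟩

/-- The last graph of a sequence and the sequence below it. -/
def top (Y : OverFlag Γ K N) : Σ X : {X : Over Γ // X ∈ K ∧ X.left.codim = N}, Below K N X.1 :=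
  ⟨⟨Y.1.obj ⟨N, by omega⟩, Y.2 ⟨N, by omega⟩⟩, Y.below N (by omega)⟩

theorem below_dropLast {n : ℕ} (Y : OverFlag Γ K (n + 1))
    (Y' : OverFlag Γ K n) (h : dropLast Y.1 = Y'.1) (q : ℕ) (hq : q < n + 1) :
    HEq (Y.below q (by omega)) (Y'.below q hq) := by
  obtain ⟨Y', h'⟩ := Y'
  simp only at h
  subst h
  induction q with
  | zero => exact HEq.rfl
  | succ q ih =>
    have := eq_of_heq (ih (by omega))
    exact heq_of_eq (congrArg (fun c => (⟨⟨Y.1.obj ⟨q, by omega⟩, Y.2 ⟨q, by omega⟩⟩,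
      Y.1.map (homOfLE (Fin.mk_le_mk.2 (Nat.le_succ q))), c⟩ :
        Below K (q + 1) (Y.1.obj ⟨q + 1, by omega⟩))) this)

/-- The surjectivity half of `top_bijective`. The pair of top object and lower part is kept in one
sigma type, so that equalities of objects can be eliminated. -/
theorem exists_below_eq (n : ℕ) : ∀ (X : Over Γ), X ∈ K → X.left.codim = n → ∀ c : Below K n X,
    ∃ Y : OverFlag Γ K n, (⟨Y.1.obj ⟨n, by omega⟩, Y.below n (by omega)⟩ : Σ X, Below K n X) =
      ⟨X, c⟩ := by
  induction n with
  | zero =>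
    intro X hX hc c
    refine ⟨⟨ComposableArrows.mk₀ X, fun i => ?_⟩, rfl⟩
    obtain rfl : i = 0 := Fin.eq_zero i
    exact ⟨hX, hc⟩
  | succ n ih =>
    rintro X hX hc ⟨⟨Z, hZ⟩, m, c⟩
    obtain ⟨Y', hY'⟩ := ih Z hZ.1 hZ.2 c
    cases hY'
    obtain ⟨Y, h1, h2, h3⟩ := exists_dropLast_eq Y'.1 m
    subst h2
    obtain ⟨Y', hY'⟩ := Y'
    change dropLast Y = Y' at h1
    subst h1
    have h4 : Y.map (homOfLE (Fin.last n).castSucc_lt_succ.le) = m := eq_of_heq h3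
    subst h4
    have hY : ∀ i, Y.obj i ∈ K ∧ (Y.obj i).left.codim = i := by
      intro i
      induction i using Fin.lastCases with
      | last => exact ⟨hX, hc⟩
      | cast i => exact hY' i
    refine ⟨⟨Y, hY⟩, ?_⟩
    have := eq_of_heq (below_dropLast ⟨Y, hY⟩ ⟨_, hY'⟩ rfl n (by omega))
    exact congrArg (fun c => (⟨Y.obj ⟨n + 1, by omega⟩, ⟨⟨Y.obj ⟨n, by omega⟩, hY ⟨n, by omega⟩⟩,
      Y.map (homOfLE (Fin.mk_le_mk.2 (Nat.le_succ n))), c⟩⟩ : Σ X, Below K (n + 1) X)) this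

theorem below_succ_inj {n : ℕ} {X X' : Over Γ} {c : Below K (n + 1) X} {c' : Below K (n + 1) X'}
    (h : (⟨X, c⟩ : Σ X, Below K (n + 1) X) = ⟨X', c'⟩) :
    X = X' ∧ c.1.1 = c'.1.1 ∧ HEq c.2.1 c'.2.1 ∧
      (⟨c.1.1, c.2.2⟩ : Σ X, Below K n X) = ⟨c'.1.1, c'.2.2⟩ := by
  cases h
  exact ⟨rfl, rfl, HEq.rfl, rfl⟩

/-- A functor out of a finite chain is determined by its objects and its successive arrows. Sums
over sequences can thus be computed by repeatedly splitting off the last collapse. -/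
theorem top_bijective : Function.Bijective (top : OverFlag Γ K N → _) := by
  constructor
  · intro Y Y' h
    have key : ∀ (q : ℕ) (hq : q < N + 1),
        (⟨Y.1.obj ⟨q, hq⟩, Y.below q hq⟩ : Σ X, Below K q X) =
          ⟨Y'.1.obj ⟨q, hq⟩, Y'.below q hq⟩ →
        (∀ i (hi : i ≤ q), Y.1.obj ⟨i, by omega⟩ = Y'.1.obj ⟨i, by omega⟩) ∧
        ∀ i (hi : i < q), HEq (Y.1.map (homOfLE (show (⟨i, by omega⟩ : Fin (N + 1)) ≤
          ⟨i + 1, by omega⟩ from Fin.mk_le_mk.2 (Nat.le_succ i))))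
          (Y'.1.map (homOfLE (show (⟨i, by omega⟩ : Fin (N + 1)) ≤
          ⟨i + 1, by omega⟩ from Fin.mk_le_mk.2 (Nat.le_succ i)))) := by
      intro q
      induction q with
      | zero =>
        intro hq h
        refine ⟨fun i hi => ?_, fun i hi => absurd hi (by omega)⟩
        obtain rfl : i = 0 := by omega
        exact congrArg Sigma.fst h
      | succ q ih =>
        intro hq h
        obtain ⟨h1, h2, h3, h4⟩ := below_succ_inj h
        obtain ⟨h5, h6⟩ := ih (by omega) h4
        refine ⟨fun i hi => ?_, fun i hi => ?_⟩
        · rcases Nat.lt_or_ge i (q + 1) with hi' | hi'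
          · exact h5 i (by omega)
          · obtain rfl : i = q + 1 := by omega
            exact h1
        · rcases Nat.lt_or_ge i q with hi' | hi'
          · exact h6 i hi'
          · obtain rfl : i = q := by omega
            exact h3
    have h' : (⟨Y.1.obj ⟨N, by omega⟩, Y.below N (by omega)⟩ : Σ X, Below K N X) =
        ⟨Y'.1.obj ⟨N, by omega⟩, Y'.below N (by omega)⟩ :=
      congrArg (fun s : Σ X : {X : Over Γ // X ∈ K ∧ X.left.codim = N}, Below K N X.1 =>
        (⟨s.1.1, s.2⟩ : Σ X, Below K N X)) h
    obtain ⟨h1, h2⟩ := key N (by omega) h'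
    refine Subtype.ext (ComposableArrows.ext (fun i => h1 i (by omega)) fun i hi => ?_)
    have := h2 i hi
    refine eq_of_heq (this.trans ?_)
    rw [heq_eqToHom_comp_iff, heq_comp_eqToHom_iff]
  · rintro ⟨⟨X, hX⟩, c⟩
    obtain ⟨Y, hY⟩ := exists_below_eq N X hX.1 hX.2 c
    refine ⟨Y, ?_⟩
    cases hY
    rfl

end OverFlag

/-! ### Cup products of cyclic set cocycles -/

/-- The cup product of cyclic set cocycles on the part of a simplex beginning at a given vertex. -/
def cFatFrom {N : ℕ} (X : Simplex N) : List ℕ → ℕ → ℚ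
  | [], _ => 1
  -- The value zero outside the range is a dummy, which is not reached when the degrees of the list
  -- fit into the part of the simplex from `p` on.
  | a :: l, p => (if h : p + 2 * a ≤ N then cFat a (face p (2 * a) h X) else 0) *
      cFatFrom X l (p + 2 * a)

theorem functor_comp_congr {m n : ℕ} {f g : Fin (m + 1) → Fin (n + 1)} (hf : Monotone f)
    (hg : Monotone g) (h : f = g) (X : Simplex n) : hf.functor ⋙ X = hg.functor ⋙ X := by
  subst h
  rfl

theorem face_face {N m m' p p' q : ℕ} (hp : p + m ≤ N) (hp' : p' + m' ≤ m) (hq : q = p + p')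
    (X : Simplex N) : face p' m' hp' (face p m hp X) = face q m' (by omega) X := by
  refine functor_comp_congr (f := fun i : Fin (m' + 1) => (⟨p + (p' + i), by omega⟩ : Fin (N + 1)))
    (fun i j hij => ?_) _ ?_ X
  · have : (i : ℕ) ≤ j := hij
    simp only [Fin.mk_le_mk]
    omega
  · funext i
    ext
    simp
    omega

theorem face_self {N : ℕ} (X : Simplex N) : face 0 N (by omega) X = X :=
  functor_comp_congr (g := id) _ monotone_id (by funext i; ext; simp) X

theorem cFatList_face {N : ℕ} (X : Simplex N) (l : List ℕ) : ∀ {n : ℕ} (h : l.sum = n) (p : ℕ)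
    (hp : p + 2 * n ≤ N), cFatList l h (face p (2 * n) hp X) = cFatFrom X l p := by
  induction l with
  | nil => intro n h p hp; rfl
  | cons a l ih =>
    intro n h p hp
    rw [List.sum_cons] at h
    rw [cFatList, cFatFrom, cup, face_face hp _ rfl, face_face hp _ rfl, ih, dif_pos (by omega)]
    rfl

theorem cFatList_eq {n : ℕ} {l : List ℕ} (h : l.sum = n) (X : Simplex (2 * n)) :
    cFatList l h X = cFatFrom X l 0 := by
  rw [← cFatList_face X l h 0 (by omega), face_self]

theorem cFatFrom_append {N : ℕ} (X : Simplex N) (l l' : List ℕ) : ∀ p : ℕ,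
    cFatFrom X (l ++ l') p = cFatFrom X l p * cFatFrom X l' (p + 2 * l.sum) := by
  induction l with
  | nil => intro p; simp [cFatFrom]
  | cons a l ih =>
    intro p
    rw [List.cons_append, cFatFrom, cFatFrom, ih, List.sum_cons, mul_assoc]
    congr 3
    ring

/-! ### Histories of corner sets seen from the end of a block. -/

section History

variable {N : ℕ} (X : Simplex N)

/-- The image in `Γ_q` of the corners at the image in `Γ_j` of a vertex of `Γ_i`. -/
def imageAt {i j q : Fin (N + 1)} (hij : i ≤ j) (hjq : j ≤ q) (v : (X.obj i).Vertex) :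
    Set (X.obj q).H :=
  cornerImage (X.map (homOfLE hjq)) (Hom.vmap (X.map (homOfLE hij)) v)

/-- The images in `Γ_q` of the corners at the images of a vertex of `Γ_i` in `Γ_i, …, Γ_q`. -/
def imagesAt (q : Fin (N + 1)) : (j i : ℕ) → (h : i + j = q) →
    (X.obj ⟨i, by omega⟩).Vertex → List (Set (X.obj q).H)
  | 0, i, h, v => [cornerImage (X.map (homOfLE (Fin.mk_le_of_le_val (by omega)))) v]
  | j + 1, i, h, v => cornerImage (X.map (homOfLE (Fin.mk_le_of_le_val (by omega)))) v ::
      imagesAt q j (i + 1) (by omega)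
        (Hom.vmap (X.map (homOfLE (show (⟨i, by omega⟩ : Fin (N + 1)) ≤ ⟨i + 1, by omega⟩ from
          Fin.mk_le_mk.2 (Nat.le_succ i)))) v)

theorem imageAt_self {i q : Fin (N + 1)} (h : i ≤ q) (v : (X.obj i).Vertex) :
    imageAt X le_rfl h v = cornerImage (X.map (homOfLE h)) v := by
  have : X.map (homOfLE (le_refl i)) = 𝟙 _ := X.map_id i
  rw [imageAt, this, vmap_id]

theorem imageAt_trans {i j k q : Fin (N + 1)} (hij : i ≤ j) (hjk : j ≤ k) (h : k ≤ q)
    (v : (X.obj i).Vertex) :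
    imageAt X hjk h (Hom.vmap (X.map (homOfLE hij)) v) = imageAt X (hij.trans hjk) h v := by
  have : X.map (homOfLE (hij.trans hjk)) = X.map (homOfLE hij) ≫ X.map (homOfLE hjk) := by
    rw [← X.map_comp]; rfl
  rw [imageAt, imageAt, this, vmap_comp]

theorem getD_imagesAt (q : Fin (N + 1)) (j : ℕ) : ∀ (i : ℕ) (h : i + j = q)
    (v : (X.obj ⟨i, by omega⟩).Vertex) (t : ℕ) (k : Fin (N + 1)) (hk : k.1 = i + t) (ht : t ≤ j),
    (imagesAt X q j i h v).getD t ∅ = imageAt X (Fin.mk_le_of_le_val (by omega))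
      (show k ≤ q from Fin.le_def.2 (by omega)) v := by
  induction j with
  | zero =>
    intro i h v t k hk ht
    obtain rfl : t = 0 := by omega
    have hi : i < N + 1 := by omega
    obtain rfl : k = ⟨i, hi⟩ := Fin.ext hk
    rw [imageAt_self]
    rfl
  | succ j ih =>
    intro i h v t k hk ht
    cases t with
    | zero =>
      have hi : i < N + 1 := by omega
      obtain rfl : k = ⟨i, hi⟩ := Fin.ext hk
      rw [imageAt_self]
      rfl
    | succ t =>
      rw [imagesAt, List.getD_cons_succ, ih (i + 1) (by omega) _ t k (by omega) (by omega),
        imageAt_trans]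

/-- All corner sets are placed in the last graph of the block, where the list can be built from the
top: each earlier graph contributes one more entry at the front. -/
theorem cFat_face {p a : ℕ} (q : Fin (N + 1)) (h : p + 2 * a = q) :
    cFat a (face p (2 * a) (by omega) X) =
      ∑ v : (X.obj ⟨p, by omega⟩).Vertex, (((X.obj ⟨p, by omega⟩).valence v : ℚ) - 2) *
        cycValue (X.obj q).σ a (imagesAt X q (2 * a) p h v) := by
  have hp : p + 2 * a < N + 1 := by omega
  obtain rfl : q = ⟨p + 2 * a, hp⟩ := Fin.ext h.symm
  have : ∀ v : (X.obj ⟨p, by omega⟩).Vertex,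
      cycValue (X.obj ⟨p + 2 * a, by omega⟩).σ a (imagesAt X _ (2 * a) p h v) =
      cyclicSetCocycle (X.obj ⟨p + 2 * a, by omega⟩).σ a fun i : Fin (2 * a + 1) =>
        imageAt X (i := ⟨p, by omega⟩) (j := ⟨p + i, by omega⟩) (q := ⟨p + 2 * a, by omega⟩)
          (Fin.mk_le_mk.2 (by omega)) (Fin.mk_le_mk.2 (by omega)) v := by
    intro v
    rw [cycValue]
    congr 1
    funext i
    exact getD_imagesAt X _ _ _ h v i ⟨p + i, by omega⟩ rfl (by omega)
  simp only [this]
  rfl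

end History

/-- Twice the sum of a list, by a recursion which follows that of `Below`. -/
def twiceSum : List ℕ → ℕ
  | [] => 0
  | a :: l => twiceSum l + 2 * a

theorem twiceSum_eq (l : List ℕ) : twiceSum l = 2 * l.sum := by
  induction l with
  | nil => rfl
  | cons a l ih => rw [twiceSum, ih, List.sum_cons]; ring

/-- The product of the cyclic set cocycle on the last part of a sequence of graphs and a function
`G` of the first part. -/
def blockValue (a : ℕ) {p : ℕ} (G : ∀ X : Over Γ, Below K p X → ℚ) {Δ : RibbonGraph} :
    (k : ℕ) → (X : Over Γ) → (g : X.left ⟶ Δ) → (X.left.Vertex → List (Set Δ.H)) →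
      Below K (p + k) X → ℚ
  | 0, X, _, hist, c =>
    (∑ v, ((X.left.valence v : ℚ) - 2) * cycValue Δ.σ a (hist v)) * G X c
  | k + 1, _, g, hist, ⟨Z, m, c⟩ => blockValue a G k Z.1 (m.left ≫ g)
      (fun v => cornerImage (m.left ≫ g) v :: hist (Hom.vmap m.left v)) c

/-- The cup product of cyclic set cocycles (the head of the list being the last factor) on
a sequence of graphs. -/
def chainValue : (l : List ℕ) → (X : Over Γ) → Below K (twiceSum l) X → ℚ
  | [], _, _ => 1
  | a :: l, X, c => blockValue a (chainValue l) (2 * a) X (𝟙 X.left)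
      (fun v => [cornerImage (𝟙 X.left) v]) c

/-- Descending one graph lowers `k` and lengthens the history by one entry; at `k = 0` the recursion
has reached the vertices of the lowest graph of the block. -/
theorem blockValue_below {N : ℕ} (Y : OverFlag Γ K N) (a : ℕ) {p : ℕ}
    (G : ∀ X : Over Γ, Below K p X → ℚ) (q : Fin (N + 1)) (k : ℕ) : ∀ (j n : ℕ) (h : p + k + j = q)
    (hn : k + j = n),
    blockValue a G k (Y.1.obj ⟨p + k, by omega⟩)
      (Y.1.map (homOfLE (Fin.mk_le_of_le_val (by omega) : (⟨p + k, by omega⟩ : Fin (N + 1)) ≤ q))).left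
      (imagesAt (Y.1 ⋙ Over.forget Γ) q j (p + k) h) (Y.below (p + k) (by omega)) =
    (∑ v : (Y.1.obj ⟨p, by omega⟩).left.Vertex,
      (((Y.1.obj ⟨p, by omega⟩).left.valence v : ℚ) - 2) *
        cycValue (Y.1.obj q).left.σ a
          (imagesAt (Y.1 ⋙ Over.forget Γ) q n p (by omega) v)) *
      G (Y.1.obj ⟨p, by omega⟩) (Y.below p (by omega)) := by
  induction k with
  | zero =>
    intro j n h hn
    obtain rfl : j = n := by omega
    rfl
  | succ k ih =>
    intro j n h hn
    have hm : (Y.1.map (homOfLE (show (⟨p + k, by omega⟩ : Fin (N + 1)) ≤ ⟨p + k + 1, by omega⟩ from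
        Fin.mk_le_mk.2 (Nat.le_succ _)))).left ≫ (Y.1.map (homOfLE (Fin.mk_le_of_le_val (by omega) :
          (⟨p + (k + 1), by omega⟩ : Fin (N + 1)) ≤ q))).left = (Y.1.map (homOfLE
            (Fin.mk_le_of_le_val (by omega) : (⟨p + k, by omega⟩ : Fin (N + 1)) ≤ q))).left := by
      rw [← Over.comp_left, ← Y.1.map_comp]
      rfl
    rw [← ih (j + 1) n (by omega) (by omega)]
    change blockValue a G k _ (_ ≫ _) _ _ = _
    rw [hm]
    rfl

/-- The recursion descends from the top and meets the last cup factor first, hence the reversed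
list. -/
theorem chainValue_below {N : ℕ} (Y : OverFlag Γ K N) (l : List ℕ) (h : twiceSum l < N + 1) :
    chainValue l (Y.1.obj ⟨twiceSum l, h⟩) (Y.below (twiceSum l) h) =
      cFatFrom (Y.1 ⋙ Over.forget Γ) l.reverse 0 := by
  induction l with
  | nil => rfl
  | cons a l ih =>
    have h' : twiceSum l + 2 * a < N + 1 := h
    rw [List.reverse_cons, cFatFrom_append, ← ih (by omega), cFatFrom, cFatFrom, mul_one,
      List.sum_reverse, zero_add, ← twiceSum_eq, dif_pos (by omega),
      cFat_face (Y.1 ⋙ Over.forget Γ) ⟨twiceSum l + 2 * a, by omega⟩ rfl, mul_comm]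
    have e := blockValue_below Y a (chainValue l) ⟨twiceSum l + 2 * a, h'⟩ (2 * a) 0 (2 * a) rfl rfl
    refine Eq.trans ?_ e
    have hid : (Y.1.map (homOfLE (le_refl (⟨twiceSum l + 2 * a, h'⟩ : Fin (N + 1))))).left = 𝟙 _ := by
      have : Y.1.map (homOfLE (le_refl (⟨twiceSum l + 2 * a, h'⟩ : Fin (N + 1)))) = 𝟙 _ :=
        Y.1.map_id _
      rw [this]
      rfl
    change blockValue a (chainValue l) (2 * a) _ (𝟙 _) (fun v => [cornerImage (𝟙 _) v]) _ = 
      blockValue a (chainValue l) (2 * a) _ (Y.1.map (homOfLE (le_refl _))).left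
        (fun v => [cornerImage (Y.1.map (homOfLE (le_refl _))).left v]) _
    rw [hid]
    rfl

end Sequences

/-! ### Weights on sets of graphs over a graph -/

section Weights

variable {Γ : RibbonGraph}

/-- A weight on a set `K` of graphs over `Γ` for which each isomorphism class has total weight one. -/
structure IsWeight (K : Set (Over Γ)) (w : Over Γ → ℚ) : Prop where
  finite : ∀ E : Over Γ, Finite {Y : Over Γ // Y ∈ K ∧ Nonempty (E ≅ Y)}
  mass : ∀ E : Over Γ, ∑ᶠ Y : {Y : Over Γ // Y ∈ K ∧ Nonempty (E ≅ Y)}, w Y.1 = 1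

theorem isWeight_one {K : Set (Over Γ)} (hK : ∀ X : Over Γ, ∃! Y, Y ∈ K ∧ Nonempty (X ≅ Y)) :
    IsWeight K fun _ => 1 := by
  have h : ∀ E : Over Γ, Nonempty (Unique {Y : Over Γ // Y ∈ K ∧ Nonempty (E ≅ Y)}) := by
    intro E
    obtain ⟨Y, hY, hu⟩ := hK E
    exact ⟨⟨⟨⟨Y, hY⟩⟩, fun Z => Subtype.ext (hu Z.1 Z.2)⟩⟩
  constructor
  · intro E
    obtain ⟨i⟩ := h E
    infer_instance
  · intro E
    obtain ⟨i⟩ := h E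
    exact finsum_unique _

/-- Isomorphisms which agree after composition with a morphism are equal. -/
theorem iso_eq_of_comp_eq {Δ Δ' : RibbonGraph} {φ ψ : Δ ≅ Δ'} {f : Δ ⟶ Γ}
    (h : φ.inv ≫ f = ψ.inv ≫ f) : φ = ψ := by
  refine iso_ext (k := Hom.inv f Γ.nonempty_H.some) ?_
  exact congrFun (congrArg Hom.inv h) Γ.nonempty_H.some

/-- If `S₀` is the model of `E.left`, the objects over `Γ` isomorphic to `E` with source in `S`
correspond to the isomorphisms `φ : E.left ≅ S₀`, with structure map `φ.inv ≫ E.hom`. Different `φ`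
give different maps by `iso_eq_of_comp_eq`, so there are |Aut S₀| of them, each of weight 1/|Aut
S₀|. -/
theorem isWeight_finiteModel {S : Set RibbonGraph} (hS : IsFiniteModel S) :
    IsWeight {X : Over Γ | X.left ∈ S} fun X => 1 / (autCard X.left : ℚ) := by
  have key : ∀ E : Over Γ, ∃ (S₀ : RibbonGraph)
      (e : (E.left ≅ S₀) ≃ {Y : Over Γ // Y ∈ {X : Over Γ | X.left ∈ S} ∧ Nonempty (E ≅ Y)}),
      Nonempty (E.left ≅ S₀) ∧ ∀ φ, (e φ).1.left = S₀ := by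
    intro E
    obtain ⟨S₀, ⟨h0, hn⟩, hu⟩ := hS E.left
    refine ⟨S₀, Equiv.ofBijective (fun φ => ⟨Over.mk (φ.inv ≫ E.hom), h0,
      ⟨Over.isoMk φ (by simp)⟩⟩) ⟨?_, ?_⟩, hn, fun φ => rfl⟩
    · intro φ ψ h
      have h1 : Over.mk (φ.inv ≫ E.hom) = Over.mk (ψ.inv ≫ E.hom) := congrArg Subtype.val h
      have h2 : φ.inv ≫ E.hom = ψ.inv ≫ E.hom := by
        have h3 := congr_arg_heq (fun X : Over Γ => X.hom) h1
        exact eq_of_heq h3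
      exact iso_eq_of_comp_eq h2
    · rintro ⟨Y, hY, ⟨ψ⟩⟩
      have hl : Y.left = S₀ := hu Y.left ⟨hY, ⟨(Over.forget Γ).mapIso ψ⟩⟩
      subst hl
      refine ⟨(Over.forget Γ).mapIso ψ, Subtype.ext ?_⟩
      have h1 : ((Over.forget Γ).mapIso ψ).inv ≫ E.hom = Y.hom := Over.w ψ.inv
      exact congrArg (fun f => (Over.mk f : Over Γ)) h1
  constructor
  · intro E
    obtain ⟨S₀, e, -⟩ := key E
    exact Finite.of_equiv _ e
  · intro E
    obtain ⟨S₀, e, ⟨φ₀⟩, he⟩ := key E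
    rw [← finsum_comp_equiv e]
    simp only [he]
    have := Fintype.ofFinite (E.left ≅ S₀)
    have hc : autCard S₀ = Fintype.card (E.left ≅ S₀) := by
      rw [autCard, ← Nat.card_eq_fintype_card]
      exact Nat.card_congr
        { toFun := fun α => φ₀ ≪≫ α
          invFun := fun β => φ₀.symm ≪≫ β
          left_inv := fun α => φ₀.symm_self_id_assoc α
          right_inv := fun β => φ₀.self_symm_id_assoc β }
    rw [finsum_eq_sum_of_fintype, Finset.sum_const, Finset.card_univ, ← hc, nsmul_eq_mul]
    have h0 : (autCard S₀ : ℚ) ≠ 0 := by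
      rw [hc, Nat.cast_ne_zero]
      have : Nonempty (E.left ≅ S₀) := ⟨φ₀⟩
      exact Fintype.card_ne_zero
    field_simp

end Weights

/-! ### Collapses of one edge -/

section Diagonals

/-- A diagonal of one of the polygons in a list. -/
abbrev Diagonal {A : Type} (𝒬 : List (List A)) : Type :=
  Σ r : Fin 𝒬.length, {ij : ℕ × ℕ // ij ∈ diagonals (𝒬.get r).length}

/-- The corners joined by a diagonal. -/
def Diagonal.Joins {A : Type} {𝒬 : List (List A)} (d : Diagonal 𝒬) (x y : A) : Prop :=
  (𝒬.get d.1)[d.2.1.1]? = some x ∧ (𝒬.get d.1)[d.2.1.2]? = some y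

namespace Diagonal

variable {A : Type} {𝒬 : List (List A)}

theorem exists_joins (d : Diagonal 𝒬) : ∃ x y, d.Joins x y := by
  obtain ⟨r, ⟨i, j⟩, hij⟩ := d
  have h := mem_diagonals.1 hij
  exact ⟨(𝒬.get r)[i]'(by omega), (𝒬.get r)[j]'(by omega), by simp, by simp⟩

/-- The two conditions which exclude adjacent corners become `s ≠ []` and `u ≠ [] ∨ t ≠ []`, the
form in which `exists_expansion` needs them. -/
theorem Joins.split {d : Diagonal 𝒬} {x y : A} (h : d.Joins x y) : ∃ u s t : List A,
    𝒬.get d.1 = u ++ x :: (s ++ y :: t) ∧ u.length = d.2.1.1 ∧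
      u.length + (s.length + 1) = d.2.1.2 ∧ s ≠ [] ∧ (u ≠ [] ∨ t ≠ []) := by
  obtain ⟨r, ⟨i, j⟩, hij⟩ := d
  obtain ⟨hx, hy⟩ := h
  simp only at hx hy ⊢
  set Q := 𝒬.get r
  obtain ⟨h1, h2, h3⟩ := mem_diagonals.1 hij
  obtain ⟨hi, rfl⟩ := List.getElem?_eq_some_iff.1 hx
  obtain ⟨hj, rfl⟩ := List.getElem?_eq_some_iff.1 hy
  refine ⟨Q.take i, (Q.drop (i + 1)).take (j - i - 1), Q.drop (j + 1), ?_, ?_, ?_, ?_, ?_⟩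
  · have e2 : (Q.drop (i + 1)).drop (j - i - 1) = Q[j] :: Q.drop (j + 1) := by
      rw [List.drop_drop, show i + 1 + (j - i - 1) = j by omega, List.drop_eq_getElem_cons hj]
    rw [← e2, List.take_append_drop, ← List.drop_eq_getElem_cons hi, List.take_append_drop]
  · simp; omega
  · simp; omega
  · rw [← List.length_pos_iff_ne_nil]; simp; omega
  · rw [← List.length_pos_iff_ne_nil, ← List.length_pos_iff_ne_nil]; simp; omega

theorem eq_of_joins (hn : 𝒬.flatten.Nodup) {d d' : Diagonal 𝒬} {x y : A} (h : d.Joins x y)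
    (h' : d'.Joins x y) : d = d' := by
  obtain ⟨r, ⟨i, j⟩, hij⟩ := d
  obtain ⟨r', ⟨i', j'⟩, hij'⟩ := d'
  obtain ⟨hx, hy⟩ := h
  obtain ⟨hx', hy'⟩ := h'
  simp only at hx hy hx' hy'
  rw [List.nodup_flatten] at hn
  have hr : r = r' := by
    by_contra hne
    rcases lt_or_gt_of_ne hne with hlt | hlt
    · have := List.pairwise_iff_get.1 hn.2 r r' hlt
      exact this (List.mem_of_getElem? hx) (List.mem_of_getElem? hx')
    · have := List.pairwise_iff_get.1 hn.2 r' r hlt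
      exact this (List.mem_of_getElem? hx') (List.mem_of_getElem? hx)
  subst hr
  have hQ := hn.1 (𝒬.get r) (List.get_mem _ _)
  obtain ⟨hi, e1⟩ := List.getElem?_eq_some_iff.1 hx
  obtain ⟨hj, e2⟩ := List.getElem?_eq_some_iff.1 hy
  obtain ⟨hi', e1'⟩ := List.getElem?_eq_some_iff.1 hx'
  obtain ⟨hj', e2'⟩ := List.getElem?_eq_some_iff.1 hy'
  obtain rfl : i = i' := (hQ.getElem_inj_iff).1 (e1.trans e1'.symm)
  obtain rfl : j = j' := (hQ.getElem_inj_iff).1 (e2.trans e2'.symm)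
  rfl

/-- A diagonal lists its ends by increasing position, so the unordered pair of successors of a
collapsed edge fixes it. -/
theorem not_joins_symm (hn : 𝒬.flatten.Nodup) {d d' : Diagonal 𝒬} {x y : A} (h : d.Joins x y)
    (h' : d'.Joins y x) : False := by
  obtain ⟨r, ⟨i, j⟩, hij⟩ := d
  obtain ⟨r', ⟨i', j'⟩, hij'⟩ := d'
  obtain ⟨hx, hy⟩ := h
  obtain ⟨hy', hx'⟩ := h'
  simp only at hx hy hx' hy'
  rw [List.nodup_flatten] at hn
  have hr : r = r' := by
    by_contra hne
    rcases lt_or_gt_of_ne hne with hlt | hlt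
    · have := List.pairwise_iff_get.1 hn.2 r r' hlt
      exact this (List.mem_of_getElem? hx) (List.mem_of_getElem? hx')
    · have := List.pairwise_iff_get.1 hn.2 r' r hlt
      exact this (List.mem_of_getElem? hx') (List.mem_of_getElem? hx)
  subst hr
  have hQ := hn.1 (𝒬.get r) (List.get_mem _ _)
  obtain ⟨hi, e1⟩ := List.getElem?_eq_some_iff.1 hx
  obtain ⟨hj, e2⟩ := List.getElem?_eq_some_iff.1 hy
  obtain ⟨hi', e1'⟩ := List.getElem?_eq_some_iff.1 hx'
  obtain ⟨hj', e2'⟩ := List.getElem?_eq_some_iff.1 hy'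
  have h1 : i = j' := (hQ.getElem_inj_iff).1 (e1.trans e1'.symm)
  have h2 : j = i' := (hQ.getElem_inj_iff).1 (e2.trans e2'.symm)
  have h3 := mem_diagonals.1 hij
  have h4 := mem_diagonals.1 hij'
  omega

end Diagonal

variable {Γ Δ : RibbonGraph} {𝒬 : List (List Γ.H)}

/-- The two halves of the collapsed edge are named so that the successors appear in increasing
position. `σ_x_ne` excludes consecutive corners, and its symmetric version excludes the pair of
first and last corner. -/
theorem Presents.exists_diagonal (P : Presents Γ 𝒬) {f : Δ ⟶ Γ} (hc : Δ.codim + 1 = Γ.codim) :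
    ∃ (d : Diagonal 𝒬) (h : Δ.H) (x y : Γ.H), d.Joins x y ∧ OneEdge f h x y := by
  obtain ⟨h, x, y, H⟩ := exists_oneEdge f hc
  obtain ⟨Q, hQ, hx⟩ := List.mem_flatten.1 (P.mem x)
  have hcQ := P.cycle Q hQ
  have hy : y ∈ Q := hcQ.mem_of_sameCycle hx (vert_eq_iff.1 H.vert_eq)
  obtain ⟨r, rfl⟩ := List.get_of_mem hQ
  have key : ∀ (h : Δ.H) (x y : Γ.H), OneEdge f h x y → ∀ i j, (𝒬.get r)[i]? = some x →
      (𝒬.get r)[j]? = some y → i < j → (i, j) ∈ diagonals (𝒬.get r).length := by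
    intro h x y H i j hi hj hij
    obtain ⟨hi', e1⟩ := List.getElem?_eq_some_iff.1 hi
    obtain ⟨hj', e2⟩ := List.getElem?_eq_some_iff.1 hj
    set Q := 𝒬.get r
    rw [mem_diagonals]
    refine ⟨hj', ?_, ?_⟩
    · by_contra hlt
      obtain rfl : j = i + 1 := by omega
      refine H.σ_x_ne (hcQ.σ_eq_of_split (B := Q.take i) (D := Q.drop (i + 2)) ?_)
      rw [← e1, ← e2, ← List.drop_eq_getElem_cons hj', ← List.drop_eq_getElem_cons hi',
        List.take_append_drop]
    · rintro ⟨rfl, hl⟩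
      refine H.symm.σ_x_ne ?_
      have e : Q = x :: (Q.drop 1).take (j - 1) ++ [y] := by
        have e3 : (Q.drop 1).drop (j - 1) = [y] := by
          rw [List.drop_drop, show 1 + (j - 1) = j by omega, List.drop_eq_getElem_cons hj', e2,
            List.drop_eq_nil_of_le (by omega)]
        rw [List.cons_append, ← e3, List.take_append_drop, ← e1, ← List.drop_eq_getElem_cons hi',
          List.drop_zero]
      rw [e] at hcQ
      exact hcQ.σ_last
  obtain ⟨i, hi⟩ := List.mem_iff_getElem?.1 hx
  obtain ⟨j, hj⟩ := List.mem_iff_getElem?.1 hy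
  rcases lt_trichotomy i j with hij | rfl | hij
  · exact ⟨⟨r, (i, j), key h x y H i j hi hj hij⟩, h, x, y, ⟨hi, hj⟩, H⟩
  · exact absurd (Option.some.inj (hi.symm.trans hj)) H.ne
  · exact ⟨⟨r, (j, i), key _ y x H.symm j i hj hi hij⟩, _, y, x, ⟨hj, hi⟩, H.symm⟩

theorem Presents.diagonal_unique (P : Presents Γ 𝒬) {f : Δ ⟶ Γ} {d d' : Diagonal 𝒬} {h h' : Δ.H}
    {x y x' y' : Γ.H} (hd : d.Joins x y) (H : OneEdge f h x y) (hd' : d'.Joins x' y')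
    (H' : OneEdge f h' x' y') : d = d' := by
  rcases H.eq_or_eq H' with ⟨rfl, rfl⟩ | ⟨rfl, rfl⟩
  · exact Diagonal.eq_of_joins P.nodup hd hd'
  · exact (Diagonal.not_joins_symm P.nodup hd hd').elim

theorem Presents.exists_expansion (P : Presents Γ 𝒬) {d : Diagonal 𝒬} {x y : Γ.H}
    (hd : d.Joins x y) : ∃ (E : RibbonGraph) (f : E ⟶ Γ) (h : E.H), OneEdge f h x y := by
  obtain ⟨u, s, t, hQ, -, -, hs, hut⟩ := hd.split
  have hm : 𝒬.get d.1 ∈ 𝒬 := List.get_mem _ _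
  have h1 := P.cycle _ hm
  have h2 := P.nodup_of_mem hm
  rw [hQ] at h1 h2
  exact RibbonGraph.exists_expansion Γ h1 h2 hs hut

end Diagonals

/-! ### Sums over one-edge collapses as sums over diagonals. -/

section OneStep

variable {Γ : RibbonGraph} {K : Set (Over Γ)} {w : Over Γ → ℚ}

/-- The collapses of one edge over `Γ` from a graph in `K` to `X`. -/
abbrev Step (K : Set (Over Γ)) (n : ℕ) (X : Over Γ) : Type 1 :=
  Σ Z : {Z : Over Γ // Z ∈ K ∧ Z.left.codim = n}, (Z.1 ⟶ X)

variable {n : ℕ} {X : Over Γ} {𝒬 : List (List X.left.H)}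

theorem exists_diagonal_map (hX : X.left.codim = n + 1) (P : Presents X.left 𝒬) :
    ∃ κ : Step K n X → Diagonal 𝒬, ∀ (p : Step K n X) (d : Diagonal 𝒬), κ p = d ↔
      ∃ h x y, d.Joins x y ∧ OneEdge p.2.left h x y := by
  have h : ∀ p : Step K n X, ∃ (d : Diagonal 𝒬) (h : p.1.1.left.H) (x y : X.left.H),
      d.Joins x y ∧ OneEdge p.2.left h x y := fun p =>
    P.exists_diagonal (by rw [p.1.2.2, hX])
  choose κ h x y hd H using h
  refine ⟨κ, fun p d => ⟨?_, ?_⟩⟩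
  · rintro rfl
    exact ⟨_, _, _, hd p, H p⟩
  · rintro ⟨h', x', y', hd', H'⟩
    exact P.diagonal_unique (hd p) (H p) hd' H'

/-- The fibre consists of the objects of `K` isomorphic to the expansion `E` along `d`. The source
determines the arrow, because isomorphisms over `Γ` are unique. -/
theorem exists_fiber_equiv (hX : X.left.codim = n + 1) (P : Presents X.left 𝒬)
    {κ : Step K n X → Diagonal 𝒬}
    (hκ : ∀ (p : Step K n X) (d : Diagonal 𝒬), κ p = d ↔
      ∃ h x y, d.Joins x y ∧ OneEdge p.2.left h x y) (d : Diagonal 𝒬) :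
    ∃ (E : Over Γ) (e : {p : Step K n X // κ p = d} ≃ {Y : Over Γ // Y ∈ K ∧ Nonempty (E ≅ Y)}),
      ∀ p, (e p).1 = p.1.1.1 := by
  obtain ⟨x, y, hd⟩ := d.exists_joins
  obtain ⟨E, f, h, H⟩ := P.exists_expansion hd
  have hE : E.codim = n := by have := H.codim_eq; omega
  have hiso : ∀ p : Step K n X, κ p = d → ∃ φ : E ≅ p.1.1.left, φ.hom ≫ p.2.left = f := by
    intro p hp
    obtain ⟨h', x', y', hd', H'⟩ := (hκ p d).1 hp
    obtain rfl : x = x' := Option.some.inj (hd.1.symm.trans hd'.1)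
    obtain rfl : y = y' := Option.some.inj (hd.2.symm.trans hd'.2)
    exact H.exists_iso H'
  refine ⟨Over.mk (f ≫ X.hom), Equiv.ofBijective (fun p => ⟨p.1.1.1, p.1.1.2.1, ?_⟩) ⟨?_, ?_⟩,
    fun p => rfl⟩
  · obtain ⟨φ, hφ⟩ := hiso p.1 p.2
    refine ⟨Over.isoMk φ ?_⟩
    simp only [Over.mk_hom, Over.mk_left]
    rw [← Over.w p.1.2, ← Category.assoc, hφ]
  · rintro ⟨⟨⟨Z, hZ⟩, m⟩, hp⟩ ⟨⟨⟨Z', hZ'⟩, m'⟩, hp'⟩ hZZ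
    obtain rfl : Z = Z' := congrArg Subtype.val hZZ
    obtain ⟨φ, hφ⟩ := hiso _ hp
    obtain ⟨φ', hφ'⟩ := hiso _ hp'
    simp only at φ φ' hφ hφ'
    have h1 : m.left = φ.inv ≫ f := by rw [← hφ, Iso.inv_hom_id_assoc]
    have h2 : m'.left = φ'.inv ≫ f := by rw [← hφ', Iso.inv_hom_id_assoc]
    have h3 : φ = φ' := by
      refine iso_eq_of_comp_eq (f := f ≫ X.hom) ?_
      rw [← Category.assoc, ← Category.assoc, ← h1, ← h2, Over.w, Over.w]
    have h4 : m = m' := Over.OverMorphism.ext (by rw [h1, h2, h3])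
    subst h4
    rfl
  · rintro ⟨Y, hY, ⟨ψ⟩⟩
    let φ : E ≅ Y.left := (Over.forget Γ).mapIso ψ
    have hc : Y.left.codim = n := by
      have h1 := codim_collapse φ.hom
      have h2 := codim_collapse φ.inv
      omega
    have hw : (φ.inv ≫ f) ≫ X.hom = Y.hom := by
      rw [Category.assoc]
      exact Over.w ψ.inv
    refine ⟨⟨⟨⟨Y, hY, hc⟩, Over.homMk (φ.inv ≫ f) hw⟩, ?_⟩, rfl⟩
    exact (hκ _ _).2 ⟨_, x, y, hd, H.iso_comp φ.symm⟩

/-- There are finitely many diagonals, with finitely many collapses over each; without finiteness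
`∑ᶠ` could default to zero. -/
theorem IsWeight.finite_step (hK : IsWeight K w) (hX : X.left.codim = n + 1) :
    Finite (Step K n X) := by
  obtain ⟨𝒬, P⟩ := X.left.exists_presents
  obtain ⟨κ, hκ⟩ := exists_diagonal_map (K := K) hX P
  have : ∀ d, Finite {p : Step K n X // κ p = d} := by
    intro d
    obtain ⟨E, e, -⟩ := exists_fiber_equiv hX P hκ d
    have := hK.finite E
    exact Finite.of_equiv _ e.symm
  exact Finite.of_equiv _ (Equiv.sigmaFiberEquiv κ)

/-- The sum over all collapses of one edge is a sum over diagonals. -/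
theorem IsWeight.sum_step (hK : IsWeight K w) (hX : X.left.codim = n + 1)
    (P : Presents X.left 𝒬) (F : Step K n X → ℚ) (u : Diagonal 𝒬 → ℚ)
    (hu : ∀ (p : Step K n X) (d : Diagonal 𝒬) h x y, d.Joins x y → OneEdge p.2.left h x y →
      F p = u d) :
    ∑ᶠ p : Step K n X, w p.1.1 * F p = ∑ d, u d := by
  classical
  obtain ⟨κ, hκ⟩ := exists_diagonal_map (K := K) hX P
  have hfin := hK.finite_step hX
  have := Fintype.ofFinite (Step K n X)
  rw [finsum_eq_sum_of_fintype, ← (Equiv.sigmaFiberEquiv κ).sum_comp, Fintype.sum_sigma]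
  refine Finset.sum_congr rfl fun d _ => ?_
  obtain ⟨E, e, he⟩ := exists_fiber_equiv hX P hκ d
  have h1 : ∀ p : {p : Step K n X // κ p = d}, F p.1 = u d := by
    intro p
    obtain ⟨h, x, y, hd, H⟩ := (hκ p.1 d).1 p.2
    exact hu p.1 d h x y hd H
  -- Each diagonal has total weight one, whatever representatives `K` contains.
  have h2 : ∑ p : {p : Step K n X // κ p = d}, w p.1.1.1 = 1 := by
    rw [← finsum_eq_sum_of_fintype, ← hK.mass E, ← finsum_comp_equiv e]
    simp only [he]
  simp only [Equiv.sigmaFiberEquiv_apply, h1]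
  rw [← Finset.sum_mul, h2, one_mul]

end OneStep

/-! ### Sums over sequences of collapses -/

theorem existsUnique_induces {Δ Δ' : RibbonGraph} (f : Δ ⟶ Δ') (hc : Δ.codim + 1 = Δ'.codim)
    (ω' : Δ'.GraphOrientation) : ∃! ω : Δ.GraphOrientation, Induces f ω ω' := by
  obtain ⟨𝒬, P⟩ := Δ'.exists_presents
  obtain ⟨d, h, x, y, hd, H⟩ := P.exists_diagonal (f := f) hc
  obtain ⟨u, s, t, hQ, -⟩ := hd.split
  have e : 𝒬 = 𝒬.take d.1 ++ 𝒬.get d.1 :: 𝒬.drop (d.1 + 1) := by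
    rw [List.get_eq_getElem, ← List.drop_eq_getElem_cons, List.take_append_drop]
  rw [e, hQ] at P
  exact H.existsUnique_induces P ω'

namespace Below

variable {Γ : RibbonGraph} {K : Set (Over Γ)} {w : Over Γ → ℚ}

/-- The product of the weights of the graphs below the last one. -/
def weight (w : Over Γ → ℚ) : (n : ℕ) → (X : Over Γ) → Below K n X → ℚ
  | 0, _, _ => 1
  | n + 1, _, ⟨Z, _, c⟩ => w Z.1 * weight w n Z.1 c

/-- An orientation is induced from the natural one of the first graph. -/
def IsInduced : (n : ℕ) → (X : Over Γ) → X.left.GraphOrientation → Below K n X → Prop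
  | 0, _, ω, _ => IsNatural ω
  | n + 1, _, ω, ⟨Z, m, c⟩ => ∃ ω', Induces m.left ω' ω ∧ IsInduced n Z.1 ω' c

open Classical in
/-- The sign of an orientation with respect to the one induced from the first graph. -/
def sign (n : ℕ) (X : Over Γ) (ω : X.left.GraphOrientation) (c : Below K n X) : ℚ :=
  if IsInduced n X ω c then 1 else -1

/-- The weighted and signed sum of a function over all sequences below a graph. -/
def total (w : Over Γ → ℚ) (n : ℕ) (X : Over Γ) (ω : X.left.GraphOrientation)
    (F : Below K n X → ℚ) : ℚ :=
  ∑ᶠ c : Below K n X, weight w n X c * sign n X ω c * F c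

/-- A sequence is given by its last arrow and the sequence below the source of this arrow. -/
def succEquiv (n : ℕ) (X : Over Γ) : Below K (n + 1) X ≃ Σ p : Step K n X, Below K n p.1.1 where
  toFun c := ⟨⟨c.1, c.2.1⟩, c.2.2⟩
  invFun c := ⟨c.1.1, c.1.2, c.2⟩
  left_inv _ := rfl
  right_inv _ := rfl

theorem finite (hK : IsWeight K w) (n : ℕ) : ∀ X : Over Γ, X.left.codim = n →
    Finite (Below K n X) := by
  induction n with
  | zero => intro X _; exact inferInstanceAs (Finite PUnit)
  | succ n ih =>
    intro X hX
    have := hK.finite_step hX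
    have : ∀ p : Step K n X, Finite (Below K n p.1.1) := fun p => ih _ p.1.2.2
    exact Finite.of_equiv _ (succEquiv n X).symm

theorem total_zero (X : Over Γ) (ω : X.left.GraphOrientation) (F : Below K 0 X → ℚ) :
    total w 0 X ω F = naturalSign ω * F PUnit.unit := by
  classical
  have : total w 0 X ω F = ∑ᶠ c : PUnit, 1 * sign 0 X ω c * F c := rfl
  rw [this, finsum_unique, one_mul]
  by_cases h : IsNatural ω
  · rw [show sign 0 X ω (default : PUnit) = 1 from if_pos h, naturalSign, if_pos h, Int.cast_one]
  · rw [show sign 0 X ω (default : PUnit) = -1 from if_neg h, naturalSign, if_neg h, Int.cast_neg,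
      Int.cast_one]

/-- An orientation of the target is induced by exactly one orientation of the source, so the sign of
a longer sequence is the sign of the shorter one for the pulled-back orientation `o p`. -/
theorem total_succ (hK : IsWeight K w) {n : ℕ} {X : Over Γ} (hX : X.left.codim = n + 1)
    (ω : X.left.GraphOrientation) (o : ∀ p : Step K n X, p.1.1.left.GraphOrientation)
    (ho : ∀ p, Induces p.2.left (o p) ω) (F : Below K (n + 1) X → ℚ) :
    total w (n + 1) X ω F =
      ∑ᶠ p : Step K n X, w p.1.1 * total w n p.1.1 (o p) fun c => F ⟨p.1, p.2, c⟩ := by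
  have := hK.finite_step hX
  have h2 : ∀ p : Step K n X, Finite (Below K n p.1.1) := fun p => finite hK n _ p.1.2.2
  have := Fintype.ofFinite (Step K n X)
  have := fun p => Fintype.ofFinite (Below K n (p : Step K n X).1.1)
  rw [total, ← finsum_comp_equiv (succEquiv n X).symm, finsum_eq_sum_of_fintype, Fintype.sum_sigma,
    finsum_eq_sum_of_fintype]
  refine Finset.sum_congr rfl fun p _ => ?_
  rw [total, finsum_eq_sum_of_fintype, Finset.mul_sum]
  refine Finset.sum_congr rfl fun c _ => ?_
  have hs : sign (n + 1) X ω ((succEquiv n X).symm ⟨p, c⟩) = sign n p.1.1 (o p) c := by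
    have : IsInduced (n + 1) X ω ((succEquiv n X).symm ⟨p, c⟩) ↔ IsInduced n p.1.1 (o p) c := by
      constructor
      · rintro ⟨ω', h1, h3⟩
        have hu := existsUnique_induces p.2.left (by rw [p.1.2.2, hX]) ω
        rwa [hu.unique h1 (ho p)] at h3
      · exact fun h => ⟨o p, ho p, h⟩
    by_cases h : IsInduced n p.1.1 (o p) c
    · rw [sign, sign, if_pos h, if_pos (this.2 h)]
    · rw [sign, sign, if_neg h, if_neg fun h' => h (this.1 h')]
  rw [hs, ← mul_assoc, ← mul_assoc]
  rfl

theorem total_const_mul (w : Over Γ → ℚ) (n : ℕ) (X : Over Γ) (ω : X.left.GraphOrientation)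
    (r : ℚ) (F : Below K n X → ℚ) : total w n X ω (fun c => r * F c) = r * total w n X ω F := by
  rw [total, total, ← smul_eq_mul, smul_finsum]
  refine finsum_congr fun c => ?_
  rw [smul_eq_mul]
  ring

end Below

theorem cornerImage_vtx {Δ Δ' : RibbonGraph} {g : Δ ⟶ Δ'} {ρ : Δ.H → Δ'.H}
    (hρ : ∀ a, Δ.Turn (Set.range (Hom.inv g))ᶜ a (Hom.inv g (ρ a))) {Q : List Δ.H}
    (hQ : IsCycleList Δ.σ Q) : cornerImage g (Δ.vtx Q) = setOf (Q.map ρ) := by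
  obtain ⟨q, hq⟩ := List.exists_mem_of_ne_nil _ hQ.ne_nil
  ext k
  simp only [cornerImage, setOf, Set.mem_ofPred_eq, List.mem_map]
  constructor
  · rintro ⟨h, hv, ht⟩
    refine ⟨h, ?_, Hom.inv_injective g ((hρ h).unique ht)⟩
    rw [hQ.mem_iff hq, ← vert_eq_iff, hv, vtx_eq hQ hq]
  · rintro ⟨h, hh, rfl⟩
    exact ⟨h, (vtx_eq hQ hh).symm, hρ h⟩

/-! ### From sums over collapses to sums over diagonals. -/

section Block

variable {Γ : RibbonGraph} {K : Set (Over Γ)} {w : Over Γ → ℚ}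

theorem OneEdge.turn_corner_comp {Δ Δ' Δ'' : RibbonGraph} {f : Δ ⟶ Δ'} {h : Δ.H} {x y : Δ'.H}
    (H : OneEdge f h x y) {g : Δ' ⟶ Δ''} {ρ : Δ'.H → Δ''.H}
    (hρ : ∀ a, Δ'.Turn (Set.range (Hom.inv g))ᶜ a (Hom.inv g (ρ a))) (a : Δ.H) :
    Δ.Turn (Set.range (Hom.inv (f ≫ g)))ᶜ a (Hom.inv (f ≫ g) (ρ (H.corner a))) :=
  Hom.turn_comp f (Hom.compl_range_comp f g) (Hom.inv_mem_compl_range_comp f g)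
    (hρ (H.corner a)) a (H.turn_corner a)

/-- The polygons after a collapse is undone. -/
theorem OneEdge.map_lift {Δ Δ' Δ'' : RibbonGraph} {f : Δ ⟶ Δ'} {h : Δ.H} {x y : Δ'.H}
    (H : OneEdge f h x y) {g : Δ' ⟶ Δ''} {ρ : Δ'.H → Δ''.H}
    (hρ : ∀ a, Δ'.Turn (Set.range (Hom.inv g))ᶜ a (Hom.inv g (ρ a)))
    (hist : Δ'.Vertex → List (Set Δ''.H)) {𝒬₁ 𝒬₂ : List (List Δ'.H)} {u s t : List Δ'.H}
    (P : Presents Δ' (𝒬₁ ++ (u ++ x :: (s ++ y :: t)) :: 𝒬₂)) :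
    ((lift f h x y 𝒬₁ 𝒬₂ u s t).map fun Q => (Q.map fun a => ρ (H.corner a),
      cornerImage (f ≫ g) (Δ.vtx Q) :: hist (Hom.vmap f (Δ.vtx Q)))) =
    (𝒬₁.map fun Q => record (Q.map ρ, hist (Δ'.vtx Q))) ++
      (cutFst ((u ++ x :: (s ++ y :: t)).map ρ) (u.length, u.length + (s.length + 1)),
        setOf (cutFst ((u ++ x :: (s ++ y :: t)).map ρ) (u.length, u.length + (s.length + 1))) ::
          hist (Δ'.vtx (u ++ x :: (s ++ y :: t)))) ::
      (cutSnd ((u ++ x :: (s ++ y :: t)).map ρ) (u.length, u.length + (s.length + 1)),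
        setOf (cutSnd ((u ++ x :: (s ++ y :: t)).map ρ) (u.length, u.length + (s.length + 1))) ::
          hist (Δ'.vtx (u ++ x :: (s ++ y :: t)))) ::
      (𝒬₂.map fun Q => record (Q.map ρ, hist (Δ'.vtx Q))) := by
  have P' := H.presents_lift P
  have hρ' := H.turn_corner_comp hρ
  have hcor : ∀ Q : List Δ'.H, (Q.map (Hom.inv f)).map (fun a => ρ (H.corner a)) = Q.map ρ := by
    intro Q
    rw [List.map_map]
    refine List.map_congr_left fun a _ => ?_
    simp only [Function.comp_apply, H.corner_inv]
  have hQc := P.cycle (u ++ x :: (s ++ y :: t)) (by simp)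
  have hother : ∀ Q, IsCycleList Δ'.σ Q → IsCycleList Δ.σ (Q.map (Hom.inv f)) →
      ((Q.map (Hom.inv f)).map (fun a => ρ (H.corner a)),
        cornerImage (f ≫ g) (Δ.vtx (Q.map (Hom.inv f))) ::
          hist (Hom.vmap f (Δ.vtx (Q.map (Hom.inv f))))) =
      record (Q.map ρ, hist (Δ'.vtx Q)) := by
    intro Q hQ hQ'
    obtain ⟨q, hq⟩ := List.exists_mem_of_ne_nil _ hQ.ne_nil
    rw [cornerImage_vtx hρ' hQ', hcor, record, vtx_eq hQ hq,
      vtx_eq hQ' (List.mem_map.2 ⟨q, hq, rfl⟩), Hom.vmap_vert]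
  rw [lift] at P' ⊢
  rw [List.map_append]
  refine congrArg₂ (· ++ ·) ?_ (congrArg₂ List.cons ?_ (congrArg₂ List.cons ?_ ?_))
  · rw [List.map_map]
    exact List.map_congr_left fun Q hQ => hother Q (P.cycle Q (by simp [hQ]))
      (P'.cycle _ (List.mem_append.2 (Or.inl (List.mem_map.2 ⟨Q, hQ, rfl⟩))))
  · have hc := P'.cycle (h :: (x :: s).map (Hom.inv f)) (by simp)
    have e : (h :: (x :: s).map (Hom.inv f)).map (fun a => ρ (H.corner a)) =
        cutFst ((u ++ x :: (s ++ y :: t)).map ρ) (u.length, u.length + (s.length + 1)) := by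
      rw [cutFst_map, cutFst_split, List.map_cons, hcor, H.corner_h]
      rfl
    refine Prod.ext e ?_
    change cornerImage (f ≫ g) (Δ.vtx (h :: (x :: s).map (Hom.inv f))) ::
      hist (Hom.vmap f (Δ.vtx (h :: (x :: s).map (Hom.inv f)))) = _
    rw [cornerImage_vtx hρ' hc, e, vtx_eq hc (q := Hom.inv f x) (by simp), Hom.vmap_vert,
      vtx_eq hQc (q := x) (by simp)]
  · have hc := P'.cycle (u.map (Hom.inv f) ++ Δ.τ h :: (y :: t).map (Hom.inv f)) (by simp)
    have e : (u.map (Hom.inv f) ++ Δ.τ h :: (y :: t).map (Hom.inv f)).map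
        (fun a => ρ (H.corner a)) =
        cutSnd ((u ++ x :: (s ++ y :: t)).map ρ) (u.length, u.length + (s.length + 1)) := by
      rw [cutSnd_map, cutSnd_split, List.map_append, List.map_cons, hcor, hcor, H.corner_τ_h]
      simp
    refine Prod.ext e ?_
    change cornerImage (f ≫ g) (Δ.vtx (u.map (Hom.inv f) ++ Δ.τ h :: (y :: t).map (Hom.inv f))) ::
      hist (Hom.vmap f (Δ.vtx (u.map (Hom.inv f) ++ Δ.τ h :: (y :: t).map (Hom.inv f)))) = _
    rw [cornerImage_vtx hρ' hc, e, vtx_eq hc (q := Hom.inv f y) (by simp), Hom.vmap_vert,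
      vtx_eq hQc (q := y) (by simp)]
  · rw [List.map_map]
    refine List.map_congr_left fun Q hQ => hother Q (P.cycle Q (by simp [hQ])) (P'.cycle _ ?_)
    simp only [List.mem_append, List.mem_cons]
    exact Or.inr (Or.inr (Or.inr (List.mem_map.2 ⟨Q, hQ, rfl⟩)))

/-- Splitting off the top collapse reproduces the recursion of `diagonalSum`: `IsWeight.sum_step`
turns collapses into diagonals, `OneEdge.sgnL_frame_lift` supplies the sign and `OneEdge.map_lift`
the cut polygons with their histories. The map `g` to the end of the block and the history are
arbitrary, so that the induction goes through. -/
theorem total_blockValue (hK : IsWeight K w) (a : ℕ) {p : ℕ} {G : ∀ X : Over Γ, Below K p X → ℚ}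
    {G' : Multiset ℕ → ℚ}
    (hG : ∀ (X : Over Γ), X.left.codim = p → ∀ 𝒬, Presents X.left 𝒬 → ∀ ω,
      Below.total w p X ω (G X) = ω.sgnL (X.left.frame 𝒬) * G' (𝒬.map List.length : List ℕ))
    {Δ : RibbonGraph} (k : ℕ) :
    ∀ (X : Over Γ), X.left.codim = p + k → ∀ 𝒬, Presents X.left 𝒬 →
      ∀ (ω : X.left.GraphOrientation) (g : X.left ⟶ Δ) (ρ : X.left.H → Δ.H)
      (_ : ∀ a, X.left.Turn (Set.range (Hom.inv g))ᶜ a (Hom.inv g (ρ a)))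
      (hist : X.left.Vertex → List (Set Δ.H)),
      Below.total w (p + k) X ω (blockValue a G k X g hist) = ω.sgnL (X.left.frame 𝒬) *
        diagonalSum G' Δ.σ a k (𝒬.map fun Q => (Q.map ρ, hist (X.left.vtx Q))) := by
  induction k with
  | zero =>
    intro X hX 𝒬 P ω g ρ hρ hist
    have e1 : Below.total w (p + 0) X ω (blockValue a G 0 X g hist) =
        (∑ v, ((X.left.valence v : ℚ) - 2) * cycValue Δ.σ a (hist v)) * Below.total w p X ω (G X) :=
      Below.total_const_mul w p X ω _ (G X)
    rw [e1, hG X hX 𝒬 P ω, diagonalSum, P.sum_vertex, List.map_map]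
    have e2 : sizes (𝒬.map fun Q => (Q.map ρ, hist (X.left.vtx Q))) =
        (𝒬.map List.length : List ℕ) := by
      simp [sizes, Function.comp_def]
    have e3 : (𝒬.map fun Q => ((X.left.valence (X.left.vtx Q) : ℚ) - 2) *
        cycValue Δ.σ a (hist (X.left.vtx Q))) =
        𝒬.map ((fun e : List Δ.H × List (Set Δ.H) => ((e.1.length : ℚ) - 2) * cycValue Δ.σ a e.2) ∘
          fun Q => (Q.map ρ, hist (X.left.vtx Q))) := by
      refine List.map_congr_left fun Q hQ => ?_
      rw [P.valence_vtx hQ]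
      simp
    rw [e2, e3]
    ring
  | succ k ih =>
    intro X hX 𝒬 P ω g ρ hρ hist
    have hX' : X.left.codim = (p + k) + 1 := hX
    -- The orientation of the source of each collapse, pulled back from `ω`.
    choose o ho _ using fun q : Step K (p + k) X =>
      existsUnique_induces q.2.left (by rw [q.1.2.2, hX']) ω
    rw [show Below.total w (p + (k + 1)) X ω (blockValue a G (k + 1) X g hist) = _ from
      Below.total_succ hK hX' ω o ho _]
    set st : List X.left.H → List Δ.H × List (Set Δ.H) :=
      fun Q => (Q.map ρ, hist (X.left.vtx Q)) with hst
    let S : Diagonal 𝒬 → List (List Δ.H × List (Set Δ.H)) := fun d =>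
      (((𝒬.take d.1).map st).map record ++
        (cutFst (st (𝒬.get d.1)).1 d.2.1, setOf (cutFst (st (𝒬.get d.1)).1 d.2.1) ::
          (st (𝒬.get d.1)).2) ::
        (cutSnd (st (𝒬.get d.1)).1 d.2.1, setOf (cutSnd (st (𝒬.get d.1)).1 d.2.1) ::
          (st (𝒬.get d.1)).2) :: ((𝒬.drop (d.1 + 1)).map st).map record)
    rw [hK.sum_step hX' P _ fun d => ω.sgnL (X.left.frame 𝒬) *
      ((stepSign (cells ((𝒬.take d.1).map st)) d.2.1.1 (d.2.1.2 - d.2.1.1) : ℚ) *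
        diagonalSum G' Δ.σ a k (S d))]
    · rw [← Finset.mul_sum, diagonalSum]
      have hz := zipSum_map st (fun A e B => ∑ ij ∈ diagonals e.1.length,
        (stepSign (cells A) ij.1 (ij.2 - ij.1) : ℚ) *
          diagonalSum G' Δ.σ a k (A.map record ++ (cutFst e.1 ij, setOf (cutFst e.1 ij) :: e.2) ::
            (cutSnd e.1 ij, setOf (cutSnd e.1 ij) :: e.2) :: B.map record)) 𝒬 []
      rw [List.map_nil] at hz
      rw [hz, zipSum_eq_sum_fin, Fintype.sum_sigma]
      congr 1
      refine Finset.sum_congr rfl fun r _ => ?_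
      rw [List.nil_append, show (st (𝒬.get r)).1.length = (𝒬.get r).length from List.length_map _]
      exact Finset.sum_coe_sort (diagonals (𝒬.get r).length) fun ij =>
        (stepSign (cells ((𝒬.take r).map st)) ij.1 (ij.2 - ij.1) : ℚ) *
          diagonalSum G' Δ.σ a k (((𝒬.take r).map st).map record ++
            (cutFst (st (𝒬.get r)).1 ij, setOf (cutFst (st (𝒬.get r)).1 ij) ::
              (st (𝒬.get r)).2) ::
            (cutSnd (st (𝒬.get r)).1 ij, setOf (cutSnd (st (𝒬.get r)).1 ij) ::
              (st (𝒬.get r)).2) :: ((𝒬.drop (r + 1)).map st).map record)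
    · intro q d h x y hd H
      obtain ⟨u, s, t, hQ, hi, hj, -, -⟩ := hd.split
      have e : 𝒬 = 𝒬.take d.1 ++ (u ++ x :: (s ++ y :: t)) :: 𝒬.drop (d.1 + 1) := by
        rw [← hQ, List.get_eq_getElem, ← List.drop_eq_getElem_cons, List.take_append_drop]
      have P₁ := P
      rw [e] at P₁
      have P' := H.presents_lift P₁
      have hij : d.2.1 = (u.length, u.length + (s.length + 1)) := Prod.ext hi.symm hj.symm
      have hsg := (H.sgnL_frame_lift P₁).1 (ho q)
      have hlift := H.map_lift hρ hist P₁
      refine (ih q.1.1 q.1.2.2 _ P' (o q) (q.2.left ≫ g) _ (H.turn_corner_comp hρ) _).trans ?_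
      rw [hsg, hlift, ← e]
      have hcells : cells ((𝒬.take d.1).map st) = (X.left.frame (𝒬.take d.1)).length := by
        rw [length_frame]
        simp [cells, hst, Function.comp_def]
      have hS : S d = (𝒬.take d.1).map (fun Q => record (Q.map ρ, hist (X.left.vtx Q))) ++
          (cutFst ((u ++ x :: (s ++ y :: t)).map ρ) (u.length, u.length + (s.length + 1)),
            setOf (cutFst ((u ++ x :: (s ++ y :: t)).map ρ) (u.length, u.length + (s.length + 1))) ::
              hist (X.left.vtx (u ++ x :: (s ++ y :: t)))) ::
          (cutSnd ((u ++ x :: (s ++ y :: t)).map ρ) (u.length, u.length + (s.length + 1)),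
            setOf (cutSnd ((u ++ x :: (s ++ y :: t)).map ρ) (u.length, u.length + (s.length + 1))) ::
              hist (X.left.vtx (u ++ x :: (s ++ y :: t)))) ::
          (𝒬.drop (d.1 + 1)).map (fun Q => record (Q.map ρ, hist (X.left.vtx Q))) := by
        simp only [S, hij, hQ, List.map_map, hst]
        rfl
      rw [hcells, hS, hij]
      simp only [add_tsub_cancel_left]
      push_cast
      ring

/-- The weighted and signed sum of a cup product of cyclic set cocycles over all sequences below
a graph. -/
theorem total_chainValue (hK : IsWeight K w) (l : List ℕ) :
    ∀ (X : Over Γ), X.left.codim = twiceSum l → ∀ 𝒬, Presents X.left 𝒬 → ∀ ω,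
      Below.total w (twiceSum l) X ω (chainValue (K := K) l X) =
        ω.sgnL (X.left.frame 𝒬) * cellValue l (𝒬.map List.length : List ℕ) := by
  induction l with
  | nil =>
    intro X hX 𝒬 P ω
    have h3 : ∀ Q ∈ 𝒬, Q.length = 3 := by
      intro Q hQ
      have h1 : ∀ v ∈ Finset.univ, X.left.valence v - 3 = 0 := Finset.sum_eq_zero_iff.1 hX
      have h2 := h1 (X.left.vtx Q) (Finset.mem_univ _)
      rw [P.valence_vtx hQ] at h2
      have := P.three_le_length hQ
      omega
    have e : Below.total w (twiceSum []) X ω (chainValue (K := K) [] X) = naturalSign ω * 1 :=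
      Below.total_zero X ω _
    rw [e, cellValue, if_pos, naturalSign]
    · have hn := P.isNatural_iff (fun Q hQ => by rw [h3 Q hQ]; decide) ω
      rcases ω.sgnL_eq_one_or P.frame_nodup P.mem_frame with h | h
      · rw [if_pos (hn.2 h), h]
      · rw [if_neg (fun h' => by rw [hn.1 h'] at h; exact absurd h (by decide)), h]
    · simpa using h3
  | cons a l ih =>
    intro X hX 𝒬 P ω
    have hid : ∀ b, X.left.Turn (Set.range (Hom.inv (𝟙 X.left)))ᶜ b (Hom.inv (𝟙 X.left) (_root_.id b)) :=
      fun b => Turn.leaf _ fun h => h ⟨b, rfl⟩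
    have := total_blockValue hK a ih (2 * a) X hX 𝒬 P ω (𝟙 X.left) _root_.id hid
      fun v => [cornerImage (𝟙 X.left) v]
    refine this.trans ?_
    rw [← diagonalSum_cycles l a P.cycle fun Q hQ => P.nodup_of_mem hQ]
    congr 2
    refine List.map_congr_left fun Q hQ => ?_
    rw [cornerImage_vtx hid (P.cycle Q hQ), List.map_id]

end Block

/-! ### Sums over all sequences of graphs over a graph -/

section Flags

variable {Γ : RibbonGraph} {K : Set (Over Γ)} {w : Over Γ → ℚ}

theorem OverFlag.codim_succ {N : ℕ} (Y : OverFlag Γ K N) (i : Fin N) :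
    (Y.1.obj i.castSucc).left.codim + 1 = (Y.1.obj i.succ).left.codim := by
  rw [(Y.2 _).2, (Y.2 _).2]
  simp

/-- A compatible family of orientations is natural at the first graph if and only if the given
orientations are induced from the natural one. -/
theorem OverFlag.isInduced_below_iff {N : ℕ} (Y : OverFlag Γ K N)
    (o : ∀ i : Fin (N + 1), (Y.1.obj i).left.GraphOrientation) (q : ℕ) (hq : q < N + 1)
    (ho : ∀ i : Fin N, i.1 < q →
      Induces (Y.1.map (homOfLE i.castSucc_lt_succ.le)).left (o i.castSucc) (o i.succ)) :
    Below.IsInduced q _ (o ⟨q, hq⟩) (Y.below q hq) ↔ IsNatural (o 0) := by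
  induction q with
  | zero => exact Iff.rfl
  | succ q ih =>
    have h1 := ho ⟨q, by omega⟩ (Nat.lt_succ_self q)
    have h2 := ih (by omega) fun i hi => ho i (by omega)
    rw [← h2]
    constructor
    · rintro ⟨ω', h3, h4⟩
      have hu := existsUnique_induces
        (Y.1.map (homOfLE (⟨q, by omega⟩ : Fin N).castSucc_lt_succ.le)).left
        (Y.codim_succ ⟨q, by omega⟩) (o ⟨q + 1, hq⟩)
      have e : ω' = o ⟨q, by omega⟩ := hu.unique h3 h1
      rwa [e] at h4
    · exact fun h => ⟨_, h1, h⟩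

/-- The orientation is pulled back one collapse at a time. Graphs above `q` receive arbitrary
orientations, about which nothing is claimed. -/
theorem OverFlag.exists_orientations {N : ℕ} (Y : OverFlag Γ K N) (q : ℕ) : ∀ (hq : q < N + 1)
    (ω : (Y.1.obj ⟨q, hq⟩).left.GraphOrientation),
    ∃ o : ∀ i : Fin (N + 1), (Y.1.obj i).left.GraphOrientation, o ⟨q, hq⟩ = ω ∧
      ∀ i : Fin N, i.1 < q →
        Induces (Y.1.map (homOfLE i.castSucc_lt_succ.le)).left (o i.castSucc) (o i.succ) := by
  classical
  induction q with
  | zero =>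
    intro hq ω
    have hne : ∀ i : Fin (N + 1), Nonempty (Y.1.obj i).left.GraphOrientation := by
      intro i
      obtain ⟨𝒬, P⟩ := (Y.1.obj i).left.exists_presents
      obtain ⟨ω, -⟩ := SetOrientation.exists_sgnL_eq P.frame_nodup P.mem_frame (Or.inl rfl)
      exact ⟨ω⟩
    exact ⟨Function.update (fun i => (hne i).some) ⟨0, hq⟩ ω, Function.update_self _ _ _,
      fun i hi => absurd hi (by omega)⟩
  | succ q ih =>
    intro hq ω
    obtain ⟨ω', hω', -⟩ := existsUnique_induces
      (Y.1.map (homOfLE (⟨q, by omega⟩ : Fin N).castSucc_lt_succ.le)).left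
      (Y.codim_succ ⟨q, by omega⟩) ω
    obtain ⟨o, ho, hi⟩ := ih (by omega) ω'
    refine ⟨Function.update o ⟨q + 1, hq⟩ ω, Function.update_self _ _ _, fun i hiq => ?_⟩
    have hne : i.castSucc ≠ ⟨q + 1, hq⟩ := by
      intro h
      have := congrArg Fin.val h
      simp at this
      omega
    rw [Function.update_of_ne hne]
    by_cases h : i.1 = q
    · have hqN : q < N := by omega
      obtain rfl : i = ⟨q, hqN⟩ := Fin.ext h
      have e : o (Fin.castSucc ⟨q, by omega⟩) = ω' := ho
      rw [e]
      have e2 : Function.update o ⟨q + 1, hq⟩ ω (Fin.succ ⟨q, by omega⟩) = ω :=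
        Function.update_self _ _ _
      rw [e2]
      exact hω'
    · have hne' : i.succ ≠ ⟨q + 1, hq⟩ := by
        intro h'
        have := congrArg Fin.val h'
        simp at this
        exact h this
      rw [Function.update_of_ne hne']
      exact hi i (by omega)

theorem SetOrientation.map_injective {S S' : Type} (c : S ≃ S') :
    Function.Injective (SetOrientation.map c) := by
  intro ω ω' h
  refine SetOrientation.ext ?_
  funext N e
  have h1 := congrArg (fun ω : SetOrientation S' => ω.sgn (e.trans c)) h
  have e1 : (e.trans c).trans c.symm = e := by ext; simp
  simpa only [SetOrientation.map, e1] using h1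

/-- A chain of induced orientations is the same as the recursive condition from the top; the
isomorphism to `Γ` is unique because its underlying morphism is prescribed. -/
theorem OverFlag.flagSign_eq {N : ℕ} (Y : OverFlag Γ K N)
    (φ : (Y.1.obj (Fin.last N)).left ≅ Γ) (hφ : φ.hom = (Y.1.obj (Fin.last N)).hom)
    (ω : (Y.1.obj (Fin.last N)).left.GraphOrientation) :
    flagSign Y.1 (ω.map (cellEquiv φ)) = Below.sign N _ ω (Y.below N (Nat.lt_succ_self N)) := by
  have key : InducedFromStart Y.1 (ω.map (cellEquiv φ)) ↔
      Below.IsInduced N _ ω (Y.below N (Nat.lt_succ_self N)) := by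
    constructor
    · rintro ⟨o, φ', h1, h2, h3, h4⟩
      obtain rfl : φ' = φ := Iso.ext (h3.trans hφ.symm)
      have h5 : o (Fin.last N) = ω := SetOrientation.map_injective _ h4
      have h6 := (Y.isInduced_below_iff o N (Nat.lt_succ_self N) fun i _ => h2 i).2 h1
      rw [← h5]
      exact h6
    · intro h
      obtain ⟨o, ho, hi⟩ := Y.exists_orientations N (Nat.lt_succ_self N) ω
      refine ⟨o, φ, (Y.isInduced_below_iff o N (Nat.lt_succ_self N) hi).1 (by rw [ho]; exact h),
        fun i => hi i i.2, hφ, ?_⟩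
      exact congrArg _ ho
  by_cases h : Below.IsInduced N _ ω (Y.below N (Nat.lt_succ_self N))
  · rw [flagSign, if_pos (key.2 h), Below.sign, if_pos h]
  · rw [flagSign, if_neg fun h' => h (key.1 h'), Below.sign, if_neg h]

theorem OverFlag.weight_below {N : ℕ} (Y : OverFlag Γ K N) (q : ℕ) (hq : q < N + 1) :
    ∏ i : Fin (q + 1), w (Y.1.obj ⟨i, by omega⟩) =
      w (Y.1.obj ⟨q, hq⟩) * Below.weight w q _ (Y.below q hq) := by
  induction q with
  | zero => simp [Below.weight]
  | succ q ih =>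
    rw [Fin.prod_univ_castSucc]
    have := ih (by omega)
    simp only [Fin.val_castSucc, this]
    rw [mul_comm]
    rfl

/-- The graphs over `Γ` of the same codimension are the isomorphisms to `Γ`. -/
def topEquiv (K : Set (Over Γ)) {N : ℕ} (hN : Γ.codim = N) :
    {X : Over Γ // X ∈ K ∧ X.left.codim = N} ≃
      {Y : Over Γ // Y ∈ K ∧ Nonempty (Over.mk (𝟙 Γ) ≅ Y)} :=
  Equiv.subtypeEquivRight fun X => and_congr_right fun _ => by
    constructor
    · intro h
      obtain ⟨φ, hφ⟩ := exists_iso_of_codim_eq X.hom (h.trans hN.symm)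
      exact ⟨(Over.isoMk φ (by simpa using hφ)).symm⟩
    · rintro ⟨ψ⟩
      have h1 := codim_collapse ψ.hom.left
      have h2 := codim_collapse ψ.inv.left
      simp only [Over.mk_left] at h1 h2
      omega

theorem finite_overFlag (hK : IsWeight K w) {N : ℕ} (hN : Γ.codim = N) :
    Finite (OverFlag Γ K N) := by
  have := hK.finite (Over.mk (𝟙 Γ))
  have : Finite {X : Over Γ // X ∈ K ∧ X.left.codim = N} := Finite.of_equiv _ (topEquiv K hN).symm
  have : ∀ X : {X : Over Γ // X ∈ K ∧ X.left.codim = N}, Finite (Below K N X.1) :=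
    fun X => Below.finite hK N X.1 X.2.2
  exact Finite.of_injective _ OverFlag.top_bijective.1

theorem map_cellEquiv_symm {Δ : RibbonGraph} (φ : Δ ≅ Γ) (ω : Γ.GraphOrientation) :
    SetOrientation.map (cellEquiv φ) (SetOrientation.map (cellEquiv φ.symm) ω) = ω := by
  refine SetOrientation.ext ?_
  funext N e
  change ω.sgn ((e.trans (cellEquiv φ).symm).trans (cellEquiv φ.symm).symm) = _
  congr 1
  ext a
  exact (cellEquiv φ).apply_symm_apply (e a)

/-- The sequences are grouped by their last graph. Each last graph is an isomorphic copy of `Γ` and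
contributes the same value after transport of the orientation, and the copies have total weight one.
-/
theorem sum_overFlag_cFatFrom (hK : IsWeight K w) {N : ℕ} (hN : Γ.codim = N) {L : List ℕ}
    (hL : N = twiceSum L) {𝒬 : List (List Γ.H)} (P : Presents Γ 𝒬) (ω : Γ.GraphOrientation) :
    ∑ᶠ Y : OverFlag Γ K N, (∏ i, w (Y.1.obj i)) * flagSign Y.1 ω *
        cFatFrom (Y.1 ⋙ Over.forget Γ) L.reverse 0 =
      ω.sgnL (Γ.frame 𝒬) * cellValue L (𝒬.map List.length : List ℕ) := by
  subst hL
  have hiso : ∀ X : {X : Over Γ // X ∈ K ∧ X.left.codim = twiceSum L},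
      ∃ φ : X.1.left ≅ Γ, φ.hom = X.1.hom := fun X =>
    exists_iso_of_codim_eq X.1.hom (X.2.2.trans hN.symm)
  choose φ hφ using hiso
  let o : ∀ X : {X : Over Γ // X ∈ K ∧ X.left.codim = twiceSum L}, X.1.left.GraphOrientation :=
    fun X => SetOrientation.map (cellEquiv (φ X).symm) ω
  have h1 : ∀ Y : OverFlag Γ K (twiceSum L), (∏ i, w (Y.1.obj i)) * flagSign Y.1 ω *
      cFatFrom (Y.1 ⋙ Over.forget Γ) L.reverse 0 = w Y.top.1.1 *
        (Below.weight w _ _ Y.top.2 * Below.sign _ _ (o Y.top.1) Y.top.2 *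
          chainValue L Y.top.1.1 Y.top.2) := by
    intro Y
    have e1 := Y.weight_below (w := w) (twiceSum L) (Nat.lt_succ_self _)
    have e2 := Y.flagSign_eq (φ Y.top.1) (hφ Y.top.1) (o Y.top.1)
    have e3 := chainValue_below Y L (Nat.lt_succ_self _)
    have e0 := congrArg (flagSign Y.1) (map_cellEquiv_symm (φ Y.top.1) ω)
    rw [e0.symm.trans e2, ← e3]
    refine (congrArg (· * _ * _) e1).trans ?_
    simp only [mul_assoc]
    rfl
  rw [finsum_congr h1, finsum_eq_of_bijective _ OverFlag.top_bijective (g := fun s =>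
    w s.1.1 * (Below.weight w _ _ s.2 * Below.sign _ _ (o s.1) s.2 * chainValue L s.1.1 s.2))
    fun Y => rfl]
  have := hK.finite (Over.mk (𝟙 Γ))
  have : Finite {X : Over Γ // X ∈ K ∧ X.left.codim = twiceSum L} :=
    Finite.of_equiv _ (topEquiv K hN).symm
  have : ∀ X : {X : Over Γ // X ∈ K ∧ X.left.codim = twiceSum L}, Finite (Below K (twiceSum L) X.1) :=
    fun X => Below.finite hK _ X.1 X.2.2
  have := Fintype.ofFinite {X : Over Γ // X ∈ K ∧ X.left.codim = twiceSum L}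
  have := fun X : {X : Over Γ // X ∈ K ∧ X.left.codim = twiceSum L} =>
    Fintype.ofFinite (Below K (twiceSum L) X.1)
  rw [finsum_eq_sum_of_fintype, Fintype.sum_sigma]
  have h2 : ∀ X : {X : Over Γ // X ∈ K ∧ X.left.codim = twiceSum L},
      ∑ c : Below K (twiceSum L) X.1, w X.1 * (Below.weight w _ _ c * Below.sign _ _ (o X) c *
        chainValue L X.1 c) = w X.1 *
          (ω.sgnL (Γ.frame 𝒬) * cellValue L (𝒬.map List.length : List ℕ)) := by
    intro X
    have e := total_chainValue hK L X.1 X.2.2 _ (P.map_iso (φ X).symm) (o X)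
    rw [Below.total, finsum_eq_sum_of_fintype, P.sgnL_map_iso (φ X).symm ω, List.map_map] at e
    rw [← Finset.mul_sum, e]
    congr 4
    exact List.map_congr_left fun Q _ => List.length_map _
  simp only [h2]
  rw [← Finset.sum_mul]
  have h3 : ∑ X : {X : Over Γ // X ∈ K ∧ X.left.codim = twiceSum L}, w X.1 = 1 := by
    rw [← finsum_eq_sum_of_fintype, ← hK.mass (Over.mk (𝟙 Γ)), ← finsum_comp_equiv (topEquiv K hN)]
    rfl
  rw [h3, one_mul]

/-- The weighted and signed sum of a cup product of cyclic set cocycles over all sequences of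
graphs over `Γ`. -/
theorem sum_overFlag (hK : IsWeight K w) {n : ℕ} (hn : Γ.codim = 2 * n) {l : List ℕ}
    (hl : l.sum = n) {𝒬 : List (List Γ.H)} (P : Presents Γ 𝒬) (ω : Γ.GraphOrientation) :
    ∑ᶠ Y : OverFlag Γ K (2 * n), (∏ i, w (Y.1.obj i)) * flagSign Y.1 ω *
        cFatList l hl (Y.1 ⋙ Over.forget Γ) =
      ω.sgnL (Γ.frame 𝒬) * cellValue l.reverse (𝒬.map List.length : List ℕ) := by
  have hL : 2 * n = twiceSum l.reverse := by rw [twiceSum_eq, List.sum_reverse, hl]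
  rw [← sum_overFlag_cFatFrom hK hn hL P ω]
  simp only [cFatList_eq, List.reverse_reverse]

end Flags

/-! ### Graphs with given odd valences -/

theorem isCycleList_finRange (n : ℕ) : IsCycleList (finRotate (n + 1)) (List.finRange (n + 1)) := by
  refine ⟨0, (List.finRange n).map Fin.succ, List.finRange_succ, ?_⟩
  rw [← List.finRange_succ, List.isChain_iff_getElem]
  intro i hi
  simp only [List.length_append, List.length_finRange, List.length_singleton] at hi
  rw [List.getElem_append_left (by simp; omega), List.getElem_finRange]
  by_cases h : i = n
  · subst h
    rw [List.getElem_append_right (by simp)]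
    simp only [List.length_finRange, Nat.sub_self, List.getElem_cons_zero]
    exact finRotate_last
  · rw [List.getElem_append_left (by simp; omega), List.getElem_finRange]
    have hlt : i < n := by omega
    exact finRotate_of_lt hlt

section Ring

variable {r : ℕ} (m : Fin r → ℕ)

/-- The half-edges of a ring of trivalent vertices, to each of which is attached a vertex
of odd valence. -/
abbrev RingHalfEdge : Type := (Σ i : Fin r, Fin (2 * m i + 2 + 1)) ⊕ (Fin r × Fin 3)

/-- The cyclic order at the vertices. -/
def ringσ : Equiv.Perm (RingHalfEdge m) :=
  Equiv.sumCongr (Equiv.sigmaCongrRight fun i => finRotate (2 * m i + 2 + 1))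
    (Equiv.prodCongr (Equiv.refl _) (finRotate 3))

/-- The edges: each vertex of odd valence is joined to a trivalent vertex of the ring, its other
half-edges form loops. -/
def ringτFun : RingHalfEdge m → RingHalfEdge m
  | Sum.inl ⟨i, a⟩ => Fin.cases (motive := fun _ => RingHalfEdge m) (Sum.inr (i, 0))
      (fun k => Sum.inl ⟨i, k.rev.succ⟩) a
  | Sum.inr (i, 0) => Sum.inl ⟨i, 0⟩
  | Sum.inr (i, 1) => Sum.inr (finRotate r i, 2)
  | Sum.inr (i, 2) => Sum.inr ((finRotate r).symm i, 1)

theorem ringτFun_involutive : Function.Involutive (ringτFun m) := by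
  rintro (⟨i, a⟩ | ⟨i, b⟩)
  · induction a using Fin.cases with
    | zero => rfl
    | succ k => simp [ringτFun]
  · fin_cases b
    · rfl
    · exact congrArg (fun j => (Sum.inr (j, 1) : RingHalfEdge m)) ((finRotate r).symm_apply_apply i)
    · exact congrArg (fun j => (Sum.inr (j, 2) : RingHalfEdge m)) ((finRotate r).apply_symm_apply i)

/-- The involution which exchanges the two halves of each edge. -/
def ringτ : Equiv.Perm (RingHalfEdge m) := Function.Involutive.toPerm _ (ringτFun_involutive m)

theorem ringτFun_ne (h : RingHalfEdge m) : ringτFun m h ≠ h := by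
  rcases h with ⟨i, a⟩ | ⟨i, b⟩
  · induction a using Fin.cases with
    | zero => simp [ringτFun]
    | succ k =>
      simp only [ringτFun, Fin.cases_succ, ne_eq, Sum.inl.injEq, Sigma.mk.injEq, heq_eq_eq,
        Fin.succ_inj, true_and]
      -- Reversal of the 2m + 2 positions other than 0 has no fixed point, their number being even.
      intro h
      have := congrArg Fin.val h
      rw [Fin.val_rev] at this
      omega
  · fin_cases b <;> simp [ringτFun]

/-- The cycles of the cyclic order. -/
def ringCycles : List (List (RingHalfEdge m)) :=
  (List.finRange r).map (fun i => (List.finRange (2 * m i + 2 + 1)).map fun a => Sum.inl ⟨i, a⟩) ++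
    (List.finRange r).map (fun i => (List.finRange 3).map fun b => Sum.inr (i, b))

theorem isCycleList_ringCycles (Q : List (RingHalfEdge m)) (hQ : Q ∈ ringCycles m) :
    IsCycleList (ringσ m) Q := by
  rcases List.mem_append.1 hQ with h | h
  · obtain ⟨i, -, rfl⟩ := List.mem_map.1 h
    exact (isCycleList_finRange _).map_of_semiconj fun a _ => rfl
  · obtain ⟨i, -, rfl⟩ := List.mem_map.1 h
    exact (isCycleList_finRange _).map_of_semiconj fun a _ => rfl

theorem mem_flatten_ringCycles (h : RingHalfEdge m) : h ∈ (ringCycles m).flatten := by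
  rw [ringCycles, List.flatten_append, List.mem_append]
  rcases h with ⟨i, a⟩ | ⟨i, b⟩
  · left
    refine List.mem_flatten.2 ⟨_, List.mem_map.2 ⟨i, List.mem_finRange i, rfl⟩, ?_⟩
    exact List.mem_map.2 ⟨a, List.mem_finRange a, rfl⟩
  · right
    refine List.mem_flatten.2 ⟨_, List.mem_map.2 ⟨i, List.mem_finRange i, rfl⟩, ?_⟩
    exact List.mem_map.2 ⟨b, List.mem_finRange b, rfl⟩

theorem nodup_flatten_ringCycles : (ringCycles m).flatten.Nodup := by
  rw [List.nodup_flatten, ringCycles]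
  constructor
  · intro Q hQ
    rcases List.mem_append.1 hQ with h | h
    · obtain ⟨i, -, rfl⟩ := List.mem_map.1 h
      exact (List.nodup_finRange _).map fun a b hab => by simpa using hab
    · obtain ⟨i, -, rfl⟩ := List.mem_map.1 h
      exact (List.nodup_finRange _).map fun a b hab => by simpa using hab
  · rw [List.pairwise_append]
    refine ⟨?_, ?_, ?_⟩
    · rw [List.pairwise_map]
      refine (List.nodup_finRange r).imp fun hij => ?_
      intro h h1 h2
      obtain ⟨a, -, rfl⟩ := List.mem_map.1 h1
      obtain ⟨b, -, hb⟩ := List.mem_map.1 h2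
      simp only [Sum.inl.injEq, Sigma.mk.injEq] at hb
      exact hij hb.1.symm
    · rw [List.pairwise_map]
      refine (List.nodup_finRange r).imp fun hij => ?_
      intro h h1 h2
      obtain ⟨a, -, rfl⟩ := List.mem_map.1 h1
      obtain ⟨b, -, hb⟩ := List.mem_map.1 h2
      simp only [Sum.inr.injEq, Prod.mk.injEq] at hb
      exact hij hb.1.symm
    · intro Q hQ Q' hQ' h h1 h2
      obtain ⟨i, -, rfl⟩ := List.mem_map.1 hQ
      obtain ⟨j, -, rfl⟩ := List.mem_map.1 hQ'
      obtain ⟨a, -, rfl⟩ := List.mem_map.1 h1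
      obtain ⟨b, -, hb⟩ := List.mem_map.1 h2
      simp at hb

end Ring

/-- Half-edges in one orbit of the group generated by the structure maps. -/
def Connects {H : Type} (σ τ : Equiv.Perm H) (h k : H) : Prop :=
  ∃ g ∈ Subgroup.closure {σ, τ}, g h = k

namespace Connects

variable {H : Type} {σ τ : Equiv.Perm H} {h k l : H}

theorem symm (hk : Connects σ τ h k) : Connects σ τ k h := by
  obtain ⟨g, hg, rfl⟩ := hk
  exact ⟨g⁻¹, inv_mem hg, by simp⟩

theorem trans (hk : Connects σ τ h k) (kl : Connects σ τ k l) : Connects σ τ h l := by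
  obtain ⟨g, hg, rfl⟩ := hk
  obtain ⟨g', hg', rfl⟩ := kl
  exact ⟨g' * g, mul_mem hg' hg, rfl⟩

theorem of_sameCycle (hk : σ.SameCycle h k) : Connects σ τ h k := by
  obtain ⟨i, rfl⟩ := hk
  exact ⟨σ ^ i, zpow_mem (Subgroup.subset_closure (by simp)) i, rfl⟩

theorem of_τ (h : H) : Connects σ τ h (τ h) :=
  ⟨τ, Subgroup.subset_closure (by simp), rfl⟩

end Connects

/-- Each vertex is one cycle of `ringσ`; the ring edges lead from vertex i + 1 back to vertex i, and
an edge ties each odd vertex to the ring. -/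
theorem ring_connected {r : ℕ} (m : Fin (r + 1) → ℕ) (h : RingHalfEdge m) :
    Connects (ringσ m) (ringτ m) h (Sum.inr (0, 0)) := by
  have h1 : ∀ i a b, Connects (ringσ m) (ringτ m) (Sum.inl ⟨i, a⟩)
      (Sum.inl ⟨i, b⟩) := fun i a b =>
    Connects.of_sameCycle ((isCycleList_ringCycles m
      ((List.finRange (2 * m i + 2 + 1)).map fun a => Sum.inl ⟨i, a⟩)
      (by simp [ringCycles])).sameCycle (by simp) (by simp))
  have h2 : ∀ i a b, Connects (ringσ m) (ringτ m) (Sum.inr (i, a))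
      (Sum.inr (i, b)) := fun i a b =>
    Connects.of_sameCycle ((isCycleList_ringCycles m
      ((List.finRange 3).map fun a => Sum.inr (i, a))
      (List.mem_append.2 (Or.inr (List.mem_map.2 ⟨i, List.mem_finRange i, rfl⟩)))).sameCycle
        (List.mem_map.2 ⟨a, List.mem_finRange a, rfl⟩)
        (List.mem_map.2 ⟨b, List.mem_finRange b, rfl⟩))
  have h3 : ∀ (i : ℕ) (hi : i < r + 1), Connects (ringσ m) (ringτ m)
      (Sum.inr (⟨i, hi⟩, 0)) (Sum.inr (0, 0)) := by
    intro i
    induction i with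
    | zero => exact fun _ => h2 0 0 0
    | succ i ih =>
      intro hi
      have h4 : Connects (ringσ m) (ringτ m) (Sum.inr (⟨i, by omega⟩, 1))
          (Sum.inr (⟨i + 1, hi⟩, 2)) := by
        have := Connects.of_τ (σ := ringσ m) (τ := ringτ m)
          (Sum.inr (⟨i, by omega⟩, 1))
        have e : ringτ m (Sum.inr (⟨i, by omega⟩, 1)) =
            Sum.inr (⟨i + 1, hi⟩, 2) := by
          change Sum.inr (finRotate (r + 1) ⟨i, by omega⟩, 2) = _
          rw [finRotate_of_lt (by omega)]
        rwa [e] at this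
      exact (h2 _ _ _).trans (h4.symm.trans ((h2 _ _ _).trans (ih (by omega))))
  rcases h with ⟨i, a⟩ | ⟨i, b⟩
  · refine (h1 i a 0).trans (Connects.trans ?_ (h3 i.1 i.2))
    exact Connects.of_τ (σ := ringσ m) (τ := ringτ m) (Sum.inl ⟨i, 0⟩)
  · exact (h2 i b 0).trans (h3 i.1 i.2)

/-- A ring of trivalent vertices, to each of which is attached a vertex of odd valence. -/
def ringGraph {r : ℕ} (m : Fin (r + 1) → ℕ) : RibbonGraph where
  H := RingHalfEdge m
  finite_H := inferInstance
  nonempty_H := ⟨Sum.inr (0, 0)⟩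
  σ := ringσ m
  τ := ringτ m
  τ_τ := ringτFun_involutive m
  τ_ne := ringτFun_ne m
  three_le h := by
    obtain ⟨Q, hQ, hh⟩ := List.mem_flatten.1 (mem_flatten_ringCycles m h)
    rw [(isCycleList_ringCycles m Q hQ).card_eq
      ((List.nodup_flatten.1 (nodup_flatten_ringCycles m)).1 Q hQ) hh]
    rcases List.mem_append.1 hQ with h | h
    · obtain ⟨i, -, rfl⟩ := List.mem_map.1 h
      simp
    · obtain ⟨i, -, rfl⟩ := List.mem_map.1 h
      simp
  connected h k := (ring_connected m h).trans (ring_connected m k).symm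

theorem presents_ringGraph {r : ℕ} (m : Fin (r + 1) → ℕ) :
    Presents (ringGraph m) (ringCycles m) where
  cycle := isCycleList_ringCycles m
  nodup := nodup_flatten_ringCycles m
  mem := mem_flatten_ringCycles m

theorem exists_inW {n : ℕ} (μ : Nat.Partition n) : ∃ Γ : RibbonGraph, InW μ Γ := by
  -- The additional entry 0 keeps the ring nonempty for the empty partition; it produces one more
  -- trivalent vertex, which the filter removes.
  let m : Fin (μ.parts.toList.length + 1) → ℕ := (0 :: μ.parts.toList).get
  refine ⟨ringGraph m, ?_⟩
  rw [InW, (presents_ringGraph m).map_valence]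
  have e : (ringCycles m).map List.length =
      (0 :: μ.parts.toList).map (fun a => 2 * a + 3) ++
        (List.finRange (μ.parts.toList.length + 1)).map fun _ => 3 := by
    rw [ringCycles, List.map_append, List.map_map, List.map_map]
    congr 1
    · conv_rhs => rw [← List.map_get_finRange (0 :: μ.parts.toList), List.map_map]
      refine List.map_congr_left fun i _ => ?_
      simp [m]
  refine (congrArg (fun L : List ℕ => Multiset.filter (fun m => m ≠ 3) (L : Multiset ℕ)) e).trans ?_
  rw [← Multiset.coe_add, Multiset.filter_add]
  have h1 : Multiset.filter (fun m => m ≠ 3)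
      (((List.finRange (μ.parts.toList.length + 1)).map fun _ => 3 : List ℕ) : Multiset ℕ) = 0 := by
    rw [Multiset.filter_eq_nil]
    intro a ha
    simp only [Multiset.mem_coe, List.mem_map] at ha
    obtain ⟨i, -, rfl⟩ := ha
    simp
  rw [h1, add_zero, List.map_cons, ← Multiset.cons_coe, Multiset.filter_cons_of_neg _ (by simp),
    ← Multiset.map_coe, Multiset.coe_toList, Multiset.filter_eq_self]
  intro a ha
  obtain ⟨b, hb, rfl⟩ := Multiset.mem_map.1 ha
  have := μ.parts_pos hb
  omega

/-! ### The numbers `b` -/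

/-- The codimension of a graph with vertices of given valences. -/
def excess (K : Multiset ℕ) : ℤ := (K.map fun m : ℕ => (m : ℤ) - 3).sum

theorem excess_cons (m : ℕ) (K : Multiset ℕ) : excess (m ::ₘ K) = (m : ℤ) - 3 + excess K := by
  rw [excess, excess, Multiset.map_cons, Multiset.sum_cons]

theorem excess_add (K K' : Multiset ℕ) : excess (K + K') = excess K + excess K' := by
  rw [excess, excess, excess, Multiset.map_add, Multiset.sum_add]

/-- Every diagonal replaces m by two sizes with sum m + 2, so the excess drops by exactly one. -/
theorem trackedSum_eq_zero_of_excess {X : Type} {σ : Equiv.Perm X} {a : ℕ} {G : Multiset ℕ → ℚ}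
    {c : ℤ} (hG : ∀ K, excess K ≠ c → G K = 0) (k : ℕ) :
    ∀ (p : ℕ) (M : Multiset ℕ) (Q : List X) (hs : List (Set X)),
      excess (Q.length ::ₘ M) ≠ c + k → trackedSum G σ a k p M Q hs = 0 := by
  induction k with
  | zero =>
    intro p M Q hs h
    rw [trackedSum, hG _ (by simpa using h), mul_zero]
  | succ k ih =>
    intro p M Q hs h
    rw [trackedSum]
    refine Finset.sum_eq_zero fun ij hij => ?_
    have hl := length_cutFst_add_length_cutSnd hij
    rw [excess_cons] at h
    push_cast at h
    rw [ih, ih]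
    · simp
    · rw [excess_cons, excess_cons]
      omega
    · rw [excess_cons, excess_cons]
      omega

/-- Triangles have excess zero, so the number of diagonals, twice the sum of the list, must equal
the initial excess. -/
theorem cellValue_eq_zero_of_excess (l : List ℕ) : ∀ M : Multiset ℕ,
    excess M ≠ 2 * (l.sum : ℤ) → cellValue l M = 0 := by
  induction l with
  | nil =>
    intro M h
    rw [cellValue, if_neg]
    intro h3
    apply h
    rw [excess, Multiset.map_congr (g := fun _ => (0 : ℤ)) rfl fun m hm => by rw [h3 m hm]; rfl]
    simp
  | cons a l ih =>
    intro M h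
    rw [cellValue]
    refine Multiset.sum_eq_zero fun r hr => ?_
    obtain ⟨m, hm, rfl⟩ := Multiset.mem_map.1 hr
    have hM := excess_cons m (M.erase m)
    rw [Multiset.cons_erase hm] at hM
    refine trackedSum_eq_zero_of_excess (c := 2 * (l.sum : ℤ) - excess (M.erase m))
      (fun K hK => ih _ ?_) _ _ _ _ _ ?_
    · rw [excess_add]
      omega
    · rw [excess_cons, List.length_finRange, show excess 0 = 0 from rfl]
      rw [List.sum_cons] at h
      push_cast at h ⊢
      omega

theorem cellValue_filter {l : List ℕ} (hl : ∀ a ∈ l, 0 < a) (M : Multiset ℕ) :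
    cellValue l (M.filter fun m => m ≠ 3) = cellValue l M := by
  induction hM : M.card generalizing M with
  | zero => rw [Multiset.card_eq_zero] at hM; subst hM; rfl
  | succ k ih =>
    by_cases h3 : 3 ∈ M
    · obtain ⟨M', rfl⟩ := Multiset.exists_cons_of_mem h3
      rw [Multiset.filter_cons_of_neg _ (by simp), cellValue_cons_three hl]
      exact ih M' (by simpa using hM)
    · rw [Multiset.filter_eq_self.2]
      rintro m hm rfl
      exact h3 hm

/-- Reversal of the set of indices of a list. -/
def revIndex (l : List ℕ) : Fin l.length ≃ Fin l.reverse.length :=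
  Fin.revPerm.trans (finCongr List.length_reverse.symm)

theorem subList_reverse {r : ℕ} (l : List ℕ) (f : Fin l.reverse.length → Fin r) (i : Fin r) :
    subList l.reverse f i = (subList l (fun j => f (revIndex l j)) i).reverse := by
  have h : List.finRange l.reverse.length = ((List.finRange l.length).map (revIndex l)).reverse := by
    refine List.ext_getElem (by simp) fun j h1 h2 => ?_
    simp only [List.length_finRange, List.length_reverse] at h1
    rw [List.getElem_reverse, List.getElem_map, List.getElem_finRange, List.getElem_finRange]
    ext
    simp [revIndex]
    omega
  rw [subList, subList, h, List.filter_reverse, List.map_reverse, List.filter_map, List.map_map]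
  congr 1
  refine List.map_congr_left fun j _ => ?_
  simp [revIndex]
  congr 1
  omega

/-- The number `b` for a sequence and a partition. -/
def bValue (n : ℕ) (l : Composition n) (μ : Nat.Partition n) : ℚ :=
  (-1) ^ n * cellValue l.blocks.reverse (μ.parts.map fun m => 2 * m + 3)

/-- `cellValue_sum` distributes the factors arbitrarily among the vertices. A distribution in which
some degrees do not add up to the part of `m` vanishes by excess, and the others are the
refinements. -/
theorem cellValue_eq_sum_refinement {n : ℕ} (l m : Composition n) [Fintype (Refinement l m)] :
    cellValue l.blocks.reverse ((m.blocks : Multiset ℕ).map fun a => 2 * a + 3) =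
      ∑ π : Refinement l m, ∏ i : Fin m.length,
        cellValue (π.part i).blocks.reverse {2 * m.blocksFun i + 3} := by
  classical
  have h1 : (m.blocks : Multiset ℕ).map (fun a => 2 * a + 3) =
      ∑ i : Fin m.length, {2 * m.blocksFun i + 3} := by
    have e : (m.blocks : Multiset ℕ) = (Finset.univ : Finset (Fin m.length)).val.map m.blocksFun := by
      rw [Fin.univ_def]
      simp [← m.ofFn_blocksFun, List.ofFn_eq_map]
    rw [e, Multiset.map_map, Finset.sum_eq_multiset_sum, ← Multiset.sum_map_singleton
      ((Finset.univ : Finset (Fin m.length)).val.map _), Multiset.map_map]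
    rfl
  rw [h1, cellValue_sum]
  -- The cup factors are consumed in reverse, so index maps of the reversed list are rewritten as
  -- index maps of the list itself.
  rw [← Equiv.sum_comp ((revIndex l.blocks).arrowCongr (Equiv.refl (Fin m.length)))]
  have h2 : ∀ f : Fin l.length → Fin m.length,
      ∏ i, cellValue (subList l.blocks.reverse
        ((revIndex l.blocks).arrowCongr (Equiv.refl (Fin m.length)) f) i)
          {2 * m.blocksFun i + 3} =
      ∏ i, cellValue (subList l.blocks f i).reverse {2 * m.blocksFun i + 3} := by
    intro f
    refine Finset.prod_congr rfl fun i _ => ?_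
    rw [subList_reverse]
    congr 2
    simp
  rw [Finset.sum_congr rfl fun f _ => h2 f]
  symm
  have h3 : ∀ f : Fin l.length → Fin m.length,
      f ∉ Set.range (Subtype.val : Refinement l m → _) →
      ∏ i, cellValue (subList l.blocks f i).reverse {2 * m.blocksFun i + 3} = 0 := by
    intro f hf
    have : ∃ i, (subList l.blocks f i).sum ≠ m.blocksFun i := by
      by_contra hcon
      push Not at hcon
      exact hf ⟨⟨f, hcon⟩, rfl⟩
    obtain ⟨i, hi⟩ := this
    refine Finset.prod_eq_zero (Finset.mem_univ i) (cellValue_eq_zero_of_excess _ _ ?_)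
    rw [← Multiset.cons_zero, excess_cons, show excess 0 = 0 from rfl, List.sum_reverse]
    omega
  have := Fintype.sum_of_injective (Subtype.val : Refinement l m → _) Subtype.val_injective
    (fun π : Refinement l m => ∏ i : Fin m.length, cellValue (Refinement.part π i).blocks.reverse {2 * m.blocksFun i + 3})
    (fun f => ∏ i, cellValue (subList l.blocks f i).reverse {2 * m.blocksFun i + 3}) h3
    (fun π => rfl)
  exact this

/-- The signs match because the blocks of `m` add up to `n`. -/
theorem bValue_ofComposition {n : ℕ} (l m : Composition n) [Fintype (Refinement l m)] :
    bValue n l (Nat.Partition.ofComposition n m) =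
      ∑ π : Refinement l m, ∏ i : Fin m.length,
        bValue (m.blocksFun i) (π.part i) (Nat.Partition.indiscrete (m.blocksFun i)) := by
  have h1 : ∀ i : Fin m.length, (Nat.Partition.indiscrete (m.blocksFun i)).parts.map
      (fun a => 2 * a + 3) = {2 * m.blocksFun i + 3} := by
    intro i
    have h0 : m.blocksFun i ≠ 0 := (m.blocks_pos (m.blocksFun_mem_blocks i)).ne'
    rw [Nat.Partition.indiscrete_parts h0, Multiset.map_singleton]
  simp only [bValue, h1, Finset.prod_mul_distrib]
  rw [← Finset.mul_sum]
  rw [Finset.prod_pow_eq_pow_sum, m.sum_blocksFun]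
  congr 1
  exact cellValue_eq_sum_refinement l m

theorem cellValue_eq_zero_of_not_refines {n : ℕ} {l : Composition n} {μ : Nat.Partition n}
    (h : ¬ Refines l μ) : cellValue l.blocks.reverse (μ.parts.map fun m => 2 * m + 3) = 0 := by
  classical
  obtain ⟨m, rfl⟩ := Nat.Partition.ofComposition_surj μ
  have : IsEmpty (Refinement l m) := ⟨fun π => h ⟨m, rfl, ⟨π⟩⟩⟩
  have e := cellValue_eq_sum_refinement l m
  rw [Finset.univ_eq_empty, Finset.sum_empty] at e
  exact e

/-! ### Evaluation on dual cells -/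

/-- The valences of the vertices. -/
def valences (Γ : RibbonGraph) : Multiset ℕ := (Finset.univ : Finset Γ.Vertex).val.map Γ.valence

/-- If all valences are odd, the frame sign is the sign with respect to the natural orientation. If
a valence is even, `cellValue` is zero and the default value of `naturalSign` does not matter. -/
theorem sgnL_frame_mul_cellValue {Γ : RibbonGraph} {𝒬 : List (List Γ.H)} (P : Presents Γ 𝒬)
    (ω : Γ.GraphOrientation) (l : List ℕ) :
    (ω.sgnL (Γ.frame 𝒬) : ℚ) * cellValue l (𝒬.map List.length : List ℕ) =
      naturalSign ω * cellValue l (valences Γ) := by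
  rw [valences, P.map_valence]
  by_cases he : ∃ m ∈ ((𝒬.map List.length : List ℕ) : Multiset ℕ), Even m
  · rw [cellValue_eq_zero_of_even l _ he, mul_zero, mul_zero]
  · congr 2
    have hn := P.isNatural_iff (fun Q hQ => by
      rw [← Nat.not_even_iff_odd]
      exact fun h => he ⟨Q.length, by simpa using ⟨Q, hQ, rfl⟩, h⟩) ω
    rw [naturalSign]
    rcases ω.sgnL_eq_one_or P.frame_nodup P.mem_frame with h | h
    · rw [if_pos (hn.2 h), h]
    · rw [if_neg (fun h' => by rw [hn.1 h'] at h; exact absurd h (by decide)), h]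

/-- The common evaluation for dual cells and average dual cells, which differ only in the weight. -/
theorem eval_finsum_overFlag {n : ℕ} {A : OGraph (2 * n)} {K : Set (Over A.graph)}
    {w : Over A.graph → ℚ} (hK : IsWeight K w) (l : Composition n)
    {r : OverFlag A.graph K (2 * n) → ℚ}
    (hr : ∀ Y, r Y = (∏ i, w (Y.1.obj i)) * flagSign Y.1 A.orient) :
    (cFatProd l).eval (∑ᶠ Y : OverFlag A.graph K (2 * n),
      Finsupp.single (Y.1 ⋙ Over.forget A.graph) (r Y)) =
      naturalSign A.orient * cellValue l.blocks.reverse (valences A.graph) := by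
  have := finite_overFlag hK A.codim_eq
  have := Fintype.ofFinite (OverFlag A.graph K (2 * n))
  obtain ⟨𝒬, P⟩ := A.graph.exists_presents
  rw [← sgnL_frame_mul_cellValue P, ← sum_overFlag hK A.codim_eq l.blocks_sum P A.orient,
    finsum_eq_sum_of_fintype, finsum_eq_sum_of_fintype, map_sum]
  refine Finset.sum_congr rfl fun Y _ => ?_
  rw [Cochain.eval, Finsupp.linearCombination_single, hr, smul_eq_mul]
  rfl

theorem eval_dualCell {n : ℕ} {A : OGraph (2 * n)} {D : Chain (2 * n)} (hD : IsDualCell A D)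
    (l : Composition n) : (cFatProd l).eval D =
      naturalSign A.orient * cellValue l.blocks.reverse (valences A.graph) := by
  obtain ⟨R, hR, -, rfl⟩ := hD
  exact eval_finsum_overFlag (isWeight_one hR) l fun Y => by simp

theorem eval_averageDualCell {S : Set RibbonGraph} (hS : IsFiniteModel S) {n : ℕ}
    (A : OGraph (2 * n)) (l : Composition n) : (cFatProd l).eval (averageDualCell S A) =
      naturalSign A.orient * cellValue l.blocks.reverse (valences A.graph) := by
  refine eval_finsum_overFlag (isWeight_finiteModel hS) l fun Y => ?_
  rw [Finset.prod_div_distrib, Finset.prod_const_one]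
  ring

theorem InW.cellValue_eq {n : ℕ} {μ : Nat.Partition n} {Γ : RibbonGraph} (h : InW μ Γ)
    (l : Composition n) : cellValue l.blocks.reverse (valences Γ) =
      cellValue l.blocks.reverse (μ.parts.map fun m => 2 * m + 3) := by
  rw [← h]
  exact (cellValue_filter (fun a ha => l.blocks_pos (List.mem_reverse.1 ha)) _).symm

theorem InW.odd {n : ℕ} {μ : Nat.Partition n} {Γ : RibbonGraph} (h : InW μ Γ) {m : ℕ}
    (hm : m ∈ valences Γ) : Odd m := by
  by_cases h3 : m = 3
  · subst h3; decide
  · have : m ∈ μ.parts.map fun m => 2 * m + 3 := by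
      rw [← h]
      exact Multiset.mem_filter.2 ⟨hm, h3⟩
    obtain ⟨a, -, rfl⟩ := Multiset.mem_map.1 this
    exact ⟨a + 1, by ring⟩

theorem codim_eq_sum_filter (Γ : RibbonGraph) :
    Γ.codim = (((valences Γ).filter fun m => m ≠ 3).map fun m => m - 3).sum := by
  have e1 : Γ.codim = ((valences Γ).map fun m => m - 3).sum := by
    rw [valences, Multiset.map_map, codim, Finset.sum_eq_multiset_sum]
    rfl
  have e2 : ∀ M : Multiset ℕ, (M.map fun m => m - 3).sum =
      ((M.filter fun m => m ≠ 3).map fun m => m - 3).sum := by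
    intro M
    induction M using Multiset.induction_on with
    | empty => rfl
    | cons m M ih =>
      by_cases h3 : m = 3
      · subst h3
        rw [Multiset.filter_cons_of_neg _ (by simp), Multiset.map_cons, Multiset.sum_cons, ih,
          Nat.sub_self, zero_add]
      · rw [Multiset.filter_cons_of_pos (p := fun m => m ≠ 3) _ h3, Multiset.map_cons,
          Multiset.sum_cons, ih, Multiset.map_cons, Multiset.sum_cons]
  rw [e1, e2]

theorem exists_isNatural {n : ℕ} (μ : Nat.Partition n) :
    ∃ A : OGraph (2 * n), InW μ A.graph ∧ IsNatural A.orient := by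
  obtain ⟨Γ, hΓ⟩ := exists_inW μ
  obtain ⟨𝒬, P⟩ := Γ.exists_presents
  obtain ⟨ω, hω⟩ := SetOrientation.exists_sgnL_eq P.frame_nodup P.mem_frame (Or.inl rfl)
  have hc : Γ.codim = 2 * n := by
    rw [codim_eq_sum_filter, valences, hΓ, Multiset.map_map]
    simp only [Function.comp_apply, Nat.add_sub_cancel]
    rw [Multiset.sum_map_mul_left, Multiset.map_id', μ.parts_sum]
  refine ⟨⟨Γ, hc, ω⟩, hΓ, (P.isNatural_iff (fun Q hQ => hΓ.odd ?_) ω).2 hω⟩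
  rw [valences, P.map_valence]
  simpa using ⟨Q, hQ, rfl⟩

theorem exists_isDualCell {n : ℕ} (A : OGraph n) : ∃ D, IsDualCell A D := by
  classical
  let s := isIsomorphicSetoid (Over A.graph)
  let I : Over A.graph := Over.mk (𝟙 A.graph)
  -- The class of the identity must be represented by the identity itself; elsewhere any
  -- representative serves.
  let rep : Quotient s → Over A.graph := fun q => if q = Quotient.mk s I then I else q.out
  have hrep : ∀ q, Quotient.mk s (rep q) = q := by
    intro q
    by_cases h : q = Quotient.mk s I
    · exact (congrArg (Quotient.mk s) (if_pos h)).trans h.symm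
    · exact (congrArg (Quotient.mk s) (if_neg h)).trans q.out_eq
  refine ⟨_, Set.range rep, fun X => ⟨rep (Quotient.mk s X), ⟨⟨_, rfl⟩, ?_⟩, ?_⟩, ?_, rfl⟩
  · exact Quotient.exact (hrep (Quotient.mk s X)).symm
  · rintro Y ⟨⟨q, rfl⟩, hY⟩
    have : Quotient.mk s X = q := (Quotient.sound hY).trans (hrep q)
    rw [this]
  · exact ⟨Quotient.mk s I, if_pos rfl⟩

/-- Uniqueness is not vacuous because every Kontsevich cycle contains a naturally oriented graph and
this graph has a dual cell. -/
theorem isDualCellValue_iff (b : ∀ n : ℕ, Composition n → Nat.Partition n → ℚ) :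
    IsDualCellValue b ↔ b = bValue := by
  have key : ∀ {n : ℕ} (l : Composition n) {μ : Nat.Partition n} {A : OGraph (2 * n)},
      InW μ A.graph → IsNatural A.orient → ∀ {D}, IsDualCell A D →
        (-1) ^ n * (cFatProd l).eval D = bValue n l μ := by
    intro n l μ A hA ho D hD
    rw [eval_dualCell hD, hA.cellValue_eq, naturalSign, if_pos ho, bValue, Int.cast_one, one_mul]
  constructor
  · intro hb
    funext n l μ
    obtain ⟨A, hA, ho⟩ := exists_isNatural μ
    obtain ⟨D, hD⟩ := exists_isDualCell A
    rw [← hb n l μ A hA ho D hD, key l hA ho hD]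
  · rintro rfl n l μ A hA ho D hD
    exact key l hA ho hD

/-! ### Homomorphisms on graph cohomology -/

section LinearExtend

variable {n : ℕ} {M N : Type*} [AddCommGroup M] [AddCommGroup N]

theorem linearExtend_apply (g : OGraph n → M) (f : GraphCohomologyGroup n) :
    linearExtend g f = ∑ᶠ q : Quotient (OGraph.unorientedSetoid n), f.1 (gen q.out) • g q.out := rfl

theorem finite_support_linearExtend (g : OGraph n → M) (f : GraphCohomologyGroup n) :
    (Function.support fun q : Quotient (OGraph.unorientedSetoid n) =>
      f.1 (gen q.out) • g q.out).Finite := by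
  refine Set.Finite.subset f.2 ?_
  intro q hq
  exact ⟨q.out, q.out_eq, fun h => hq (by simp [h])⟩

theorem comp_linearExtend (φ : M →+ N) (g : OGraph n → M) :
    φ.comp (linearExtend g) = linearExtend fun A => φ (g A) := by
  ext f
  rw [AddMonoidHom.comp_apply, linearExtend_apply, linearExtend_apply,
    AddMonoidHom.map_finsum φ (finite_support_linearExtend g f)]
  simp only [map_zsmul]

theorem sum_smul_linearExtend {ι : Type*} (s : Finset ι) (c : ι → ℚ) (g : ι → OGraph n → ℚ) :
    ∑ i ∈ s, c i • linearExtend (g i) = linearExtend fun A => ∑ i ∈ s, c i * g i A := by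
  ext f
  rw [AddMonoidHom.finsetSum_apply, linearExtend_apply]
  simp only [AddMonoidHom.smul_apply, linearExtend_apply, smul_finsum]
  rw [← finsum_sum_comm]
  · refine finsum_congr fun q => ?_
    rw [Finset.smul_sum]
    refine Finset.sum_congr rfl fun i _ => ?_
    rw [smul_comm, smul_eq_mul]
  · intro i _
    refine (finite_support_linearExtend (g i) f).subset fun q hq h => hq ?_
    simp only [h, smul_zero]

/-- A finite set has only two orientations, which differ by a sign. -/
theorem OGraph.oIso_or {A B : OGraph n} (φ : A.graph ≅ B.graph) : A.OIso B ∨ A.OIso (-B) := by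
  obtain ⟨𝒬, P⟩ := B.graph.exists_presents
  have h := SetOrientation.sgnL_eq_one_or (SetOrientation.map (cellEquiv φ) A.orient)
    P.frame_nodup P.mem_frame
  have h' := SetOrientation.sgnL_eq_one_or B.orient P.frame_nodup P.mem_frame
  by_cases he : SetOrientation.sgnL (SetOrientation.map (cellEquiv φ) A.orient)
      (B.graph.frame 𝒬) = B.orient.sgnL (B.graph.frame 𝒬)
  · exact Or.inl ⟨φ, SetOrientation.eq_of_sgnL_eq P.frame_nodup P.mem_frame he⟩
  · refine Or.inr ⟨φ, SetOrientation.eq_of_sgnL_eq P.frame_nodup P.mem_frame ?_⟩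
    change _ = SetOrientation.sgnL (-B.orient) _
    rw [SetOrientation.sgnL_neg]
    rcases h with h | h <;> rcases h' with h' | h' <;> simp_all

/-- The value of a linear extension on a dual generator. -/
theorem linearExtend_dualGen {g : OGraph n → ℚ} {A : OGraph n} (hg : ∀ B, B.OIso A → g B = g A)
    (hg' : ∀ B, B.OIso (-A) → g B = - g A) (hA : ¬ A.OIso (-A)) :
    linearExtend g (dualGen A) = g A := by
  classical
  rw [linearExtend_apply, finsum_eq_single _ (Quotient.mk _ A)]
  · set B := (Quotient.mk (OGraph.unorientedSetoid n) A).out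
    have hB : Nonempty (B.graph ≅ A.graph) :=
      Quotient.exact (Quotient.out_eq (Quotient.mk (OGraph.unorientedSetoid n) A))
    obtain ⟨φ⟩ := hB
    change dualHom A (gen B) • g B = g A
    rw [dualHom_gen]
    -- The representative may carry the opposite orientation; then the dual generator and the odd
    -- function `g` both change sign.
    rcases OGraph.oIso_or φ with h | h
    · have h' : ¬ B.OIso (-A) := fun h' => hA (h.symm.trans h')
      rw [if_pos h, if_neg h', hg B h]
      simp
    · have h' : ¬ B.OIso A := fun h' => hA (h'.symm.trans h)
      rw [if_neg h', if_pos h, hg' B h]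
      simp
  · intro q hq
    change dualHom A (gen q.out) • g q.out = 0
    rw [dualHom_gen, if_neg, if_neg, sub_zero, zero_smul]
    · rintro ⟨φ, -⟩
      exact hq (q.out_eq.symm.trans (Quotient.sound ⟨φ⟩))
    · rintro ⟨φ, -⟩
      exact hq (q.out_eq.symm.trans (Quotient.sound ⟨φ⟩))

end LinearExtend

/-- The binomial coefficient is n + 2n². -/
theorem neg_one_pow_choose_two (n : ℕ) : (-1 : ℚ) ^ ((2 * n + 1).choose 2) = (-1) ^ n := by
  have : (2 * n + 1).choose 2 = n + 2 * (n * n) := by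
    rw [Nat.choose_two_right, Nat.add_sub_cancel]
    have : (2 * n + 1) * (2 * n) = (n + 2 * (n * n)) * 2 := by ring
    rw [this, Nat.mul_div_cancel _ (by norm_num)]
  rw [this, pow_add, pow_mul, neg_one_sq, one_pow, mul_one]

theorem cGraph_eq_linearExtend {S : Set RibbonGraph} (hS : IsFiniteModel S) {n : ℕ}
    (l : Composition n) : cGraph S l = linearExtend fun A : OGraph (2 * n) =>
      (-1) ^ n / autCard A.graph *
        (naturalSign A.orient * cellValue l.blocks.reverse (valences A.graph)) := by
  rw [cGraph, psi, comp_linearExtend]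
  congr 1
  funext A
  change (cFatProd l).eval _ = _
  rw [map_smul, eval_averageDualCell hS, neg_one_pow_choose_two, smul_eq_mul]

theorem autCard_ne_zero (Γ : RibbonGraph) : (autCard Γ : ℚ) ≠ 0 := by
  have : Finite (Aut Γ) := inferInstanceAs (Finite (Γ ≅ Γ))
  have : Nonempty (Aut Γ) := ⟨Iso.refl Γ⟩
  rw [autCard, Nat.cast_ne_zero]
  exact Nat.card_pos.ne'

theorem OGraph.OIso.autCard_eq {n : ℕ} {A B : OGraph n} (h : A.OIso B) :
    autCard A.graph = autCard B.graph := by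
  obtain ⟨φ, -⟩ := h
  exact Nat.card_congr φ.conjAut.toEquiv

theorem valences_eq_of_iso {Γ Γ' : RibbonGraph} (φ : Γ ≅ Γ') : valences Γ = valences Γ' := by
  obtain ⟨𝒬, P⟩ := Γ.exists_presents
  rw [valences, valences, P.map_valence, (P.map_iso φ).map_valence, List.map_map]
  congr 1
  exact List.map_congr_left fun Q _ => (List.length_map _).symm

/-- An isomorphism carries a presentation to a presentation, and for odd cycles any frame computes
the natural sign. -/
theorem naturalSign_map {n : ℕ} {A B : OGraph n} (hodd : ∀ m ∈ valences A.graph, Odd m)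
    (h : A.OIso B) : naturalSign A.orient = naturalSign B.orient := by
  obtain ⟨φ, hφ⟩ := h
  obtain ⟨𝒬, P⟩ := A.graph.exists_presents
  have h1 : ∀ Q ∈ 𝒬, Odd Q.length := fun Q hQ => hodd _ (by
    rw [valences, P.map_valence]; simpa using ⟨Q, hQ, rfl⟩)
  have h2 := P.isNatural_iff h1 A.orient
  have h3 := (P.map_iso φ).isNatural_iff (fun Q hQ => by
    obtain ⟨Q', hQ', rfl⟩ := List.mem_map.1 hQ
    rw [List.length_map]
    exact h1 Q' hQ') B.orient
  rw [← hφ, P.sgnL_map_iso φ A.orient, ← h2, hφ] at h3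
  rw [naturalSign, naturalSign]
  by_cases h4 : IsNatural A.orient
  · rw [if_pos h4, if_pos (h3.2 h4)]
  · rw [if_neg h4, if_neg fun h5 => h4 (h3.1 h5)]

theorem naturalSign_neg {n : ℕ} {A : OGraph n} (hodd : ∀ m ∈ valences A.graph, Odd m) :
    naturalSign (-A).orient = - naturalSign A.orient := by
  obtain ⟨𝒬, P⟩ := A.graph.exists_presents
  have h1 : ∀ Q ∈ 𝒬, Odd Q.length := fun Q hQ => hodd _ (by
    rw [valences, P.map_valence]; simpa using ⟨Q, hQ, rfl⟩)
  have h2 := P.isNatural_iff h1 A.orient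
  have h3 := P.isNatural_iff h1 (-A.orient)
  rw [SetOrientation.sgnL_neg] at h3
  change naturalSign (-A.orient) = _
  rw [naturalSign, naturalSign]
  rcases SetOrientation.sgnL_eq_one_or A.orient P.frame_nodup P.mem_frame with h | h
  · rw [if_pos (h2.2 h), if_neg fun h4 => by have := h3.1 h4; rw [h] at this; omega]
  · rw [if_pos (h3.2 (by rw [h]; rfl)), if_neg fun h4 => by have := h2.1 h4; rw [h] at this; omega]
    rfl

theorem cGraph_intGen {S : Set RibbonGraph} (hS : IsFiniteModel S) {n : ℕ} (l : Composition n)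
    {μ : Nat.Partition n} {A : OGraph (2 * n)} (hA : InW μ A.graph) (ho : IsNatural A.orient) :
    cGraph S l (intGen A) = bValue n l μ := by
  have hodd : ∀ m ∈ valences A.graph, Odd m := fun m hm => hA.odd hm
  have hnat : naturalSign A.orient = 1 := if_pos ho
  rw [intGen, map_nsmul, cGraph_eq_linearExtend hS, linearExtend_dualGen]
  · rw [hnat, hA.cellValue_eq, bValue, nsmul_eq_mul]
    have := autCard_ne_zero A.graph
    push_cast
    field_simp
  · intro B hB
    have hv : valences A.graph = valences B.graph := valences_eq_of_iso hB.symm.choose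
    rw [hB.autCard_eq, naturalSign_map (hv ▸ hodd) hB, hv]
  · intro B hB
    have hv : valences A.graph = valences B.graph := valences_eq_of_iso hB.symm.choose
    have h1 : naturalSign B.orient = - naturalSign A.orient := by
      rw [naturalSign_map (hv ▸ hodd) hB, naturalSign_neg hodd]
    have h2 : autCard B.graph = autCard A.graph := hB.autCard_eq
    rw [h2, h1, hv]
    push_cast
    ring
  -- A graph with odd valences has no orientation-reversing automorphism, because the natural sign
  -- is invariant; hence its dual generator is not zero for this reason.
  · intro h
    have h1 := naturalSign_map hodd h
    rw [naturalSign_neg hodd, hnat] at h1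
    omega

/-- All valences are odd, and the numbers (m - 3)/2 over the non-trivalent vertices are the parts;
they add up to `n` because the codimension is `2 * n`. -/
theorem exists_inW_of_cellValue_ne_zero {n : ℕ} {Γ : RibbonGraph} (hc : Γ.codim = 2 * n)
    {l : List ℕ} (h : cellValue l (valences Γ) ≠ 0) : ∃ μ : Nat.Partition n, InW μ Γ := by
  have hodd : ∀ m ∈ valences Γ, Odd m := by
    intro m hm
    rw [← Nat.not_even_iff_odd]
    exact fun he => h (cellValue_eq_zero_of_even l _ ⟨m, hm, he⟩)
  have h3 : ∀ m ∈ valences Γ, 3 ≤ m := by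
    intro m hm
    obtain ⟨v, -, rfl⟩ := Multiset.mem_map.1 hm
    exact Γ.three_le_valence v
  set F := (valences Γ).filter fun m => m ≠ 3 with hF
  have h5 : ∀ m ∈ F, 2 * ((m - 3) / 2) + 3 = m ∧ 0 < (m - 3) / 2 := by
    intro m hm
    obtain ⟨hm, hne⟩ := Multiset.mem_filter.1 hm
    obtain ⟨a, rfl⟩ := hodd m hm
    have := h3 _ hm
    omega
  refine ⟨⟨F.map fun m => (m - 3) / 2, ?_, ?_⟩, ?_⟩
  · intro i hi
    obtain ⟨m, hm, rfl⟩ := Multiset.mem_map.1 hi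
    exact (h5 m hm).2
  · have e : ((F.map fun m => 2 * ((m - 3) / 2)).sum : ℕ) = 2 * n := by
      rw [← hc, codim_eq_sum_filter, ← hF]
      congr 1
      exact Multiset.map_congr rfl fun m hm => by have := (h5 m hm).1; omega
    rw [Multiset.sum_map_mul_left] at e
    omega
  · rw [InW, Multiset.map_map]
    change F = _
    conv_lhs => rw [← Multiset.map_id F]
    exact Multiset.map_congr rfl fun m hm => (h5 m hm).1.symm

theorem InW.unique {n : ℕ} {μ ν : Nat.Partition n} {Γ : RibbonGraph} (h : InW μ Γ)
    (h' : InW ν Γ) : μ = ν := by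
  refine Nat.Partition.ext ?_
  refine Multiset.map_injective (f := fun m => 2 * m + 3) (fun a b hab => ?_) (h.symm.trans h')
  simpa using hab

open Classical in
-- Comparison on each graph: in a Kontsevich cycle only its own partition contributes, and the value
-- is zero unless this partition is refined by the sequence; on all other graphs both sides vanish.
theorem cGraph_eq_sum {S : Set RibbonGraph} (hS : IsFiniteModel S) {n : ℕ} (l : Composition n) :
    cGraph S l = ∑ μ : Nat.Partition n with Refines l μ, bValue n l μ • dualKontsevich μ := by
  simp only [dualKontsevich]
  rw [cGraph_eq_linearExtend hS, sum_smul_linearExtend]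
  congr 1
  funext A
  by_cases hA : ∃ μ : Nat.Partition n, InW μ A.graph
  · obtain ⟨μ, hμ⟩ := hA
    have hsum : ∀ ν : Nat.Partition n, ν ≠ μ → bValue n l ν *
        (if InW ν A.graph then (naturalSign A.orient : ℚ) / autCard A.graph else 0) = 0 := by
      intro ν hν
      rw [if_neg fun h => hν (h.unique hμ), mul_zero]
    by_cases hr : Refines l μ
    · rw [Finset.sum_eq_single μ (fun ν _ h => hsum ν h)
        (fun h => absurd (Finset.mem_filter.2 ⟨Finset.mem_univ _, hr⟩) h), if_pos hμ, bValue,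
        hμ.cellValue_eq]
      ring
    · rw [hμ.cellValue_eq, cellValue_eq_zero_of_not_refines hr, mul_zero, mul_zero,
        Finset.sum_eq_zero]
      intro ν hν
      refine hsum ν ?_
      rintro rfl
      exact hr (Finset.mem_filter.1 hν).2
  · have h0 : cellValue l.blocks.reverse (valences A.graph) = 0 := by
      by_contra h
      exact hA (exists_inW_of_cellValue_ne_zero A.codim_eq h)
    rw [h0, mul_zero, mul_zero, Finset.sum_eq_zero]
    intro ν _
    rw [if_neg fun h => hA ⟨ν, h⟩, mul_zero]

end RibbonGraph

end

open Classical in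
theorem mainTheorem7 :
    ∃ b : ∀ n : ℕ, Composition n → Nat.Partition n → ℚ,
      (∀ b' : ∀ n : ℕ, Composition n → Nat.Partition n → ℚ,
        RibbonGraph.IsDualCellValue b' ↔ b' = b) ∧
      (∀ S : Set RibbonGraph, RibbonGraph.IsFiniteModel S →
        ∀ (n : ℕ) (l : Composition n),
          (∀ (μ : Nat.Partition n) (A : RibbonGraph.OGraph (2 * n)),
            RibbonGraph.InW μ A.graph → RibbonGraph.IsNatural A.orient →
              RibbonGraph.cGraph S l (RibbonGraph.intGen A) = b n l μ) ∧
          RibbonGraph.cGraph S l =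
            ∑ μ : Nat.Partition n with Refines l μ, b n l μ • RibbonGraph.dualKontsevich μ) ∧
      (∀ (n : ℕ) (l m : Composition n),
        b n l (Nat.Partition.ofComposition n m) =
          ∑ π : Refinement l m, ∏ i : Fin m.length,
            b (m.blocksFun i) (π.part i) (Nat.Partition.indiscrete (m.blocksFun i))) :=
  ⟨RibbonGraph.bValue, RibbonGraph.isDualCellValue_iff, fun _ hS _ l =>
    ⟨fun _ _ hA ho => RibbonGraph.cGraph_intGen hS l hA ho, RibbonGraph.cGraph_eq_sum hS l⟩,
    fun _ l m => RibbonGraph.bValue_ofComposition l m⟩
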